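/- A free game $\mathcal G$ consists of finite nonempty vertex sets $X,Y$, a finite nonempty alphabet $\Sigma$ and, for every $(x,y)\in X\times Y$, a constraint $\pi_{(x,y)}\subseteq\Sigma\times\Sigma$. The value of a labeling $f_X:X\to\Sigma$, $f_Y:Y\to\Sigma$ is the fraction of pairs $(x,y)\in X\times Y$ with $(f_X(x),f_Y(y))\in\pi_{(x,y)}$, and $val(\mathcal G)$ is the maximum value of a labeling. Algorithms run on a word RAM that is given $|X|,|Y|,|\Sigma|$, the truth table of the constraints and the rational numbers $\varepsilon_0,\varepsilon$ (numerators and denominators); its words have $w$ bits, for any $w$ that is at least a suitable constant times the logarithm of the sum of $|X|,|Y|,|\Sigma|$ and these numerators and denominators, and every instruction, including reading one bit of a one-way tape that holds random bits or an advice string, takes unit time. Write $$F_B=|X|\,|Y|\,|\Sigma|^{B\,(1/\varepsilon^2)\log(|\Sigma|/\varepsilon)}.$$ **Theorem 1.3.** The following hold. 1. There are a Las Vegas algorithm and constants $A,B,C,D\in\mathbb N$ and $c>0$ such that, for every free game $\mathcal G$ with vertex sets $X,Y$ and alphabet $\Sigma$, every $\varepsilon_0$ with $val(\mathcal G)\ge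 1-\varepsilon_0$ and every $\varepsilon>0$, the algorithm, given $\mathcal G,\varepsilon_0,\varepsilon$, always halts within time $A\,F_B\,(\log_2(2+F_B))^{D}$, that is, $\tilde O\big(|X||Y||\Sigma|^{O((1/\varepsilon^2)\log(|\Sigma|/\varepsilon))}\big)$; it either returns a labeling of value at least $1-\varepsilon_0-C\varepsilon$ or reports failure, and it reports failure with probability at most $2^{-c|X||\Sigma|}$. 2. There are a deterministic non-uniform algorithm and constants $A,B,C,D\in\mathbb N$ such that, for all sizes $|X|,|Y|,|\Sigma|$ and every $\varepsilon>0$, there is an advice string of at most $A\,F_B\,(\log_2(2+F_B))^{D}$ bits (depending on these sizes and on $\varepsilon$, but not on the game or on $\varepsilon_0$) with which the algorithm, on every free game $\mathcal G$ of these sizes and every $\varepsilon_0$ with $val(\mathcal G)\ge 1-\varepsilon_0$, halts within time $A\,F_B\,(\log_2(2+F_B))^{D}$ and returns a labeling of value at least $1-\varepsilon_0-C\varepsilon$. -/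

import Mathlib

/-! ## Free games -/

/-- A free game on the complete bipartite graph with sides `X`, `Y` and alphabet `S`: every
edge `(x, y)` carries a constraint, a set of allowed pairs of labels. -/
structure FreeGame (X Y S : Type*) where
  constraint : X → Y → Finset (S × S)

namespace FreeGame

variable {X Y S : Type*} [Fintype X] [Fintype Y] [DecidableEq S]

/-- The fraction of the edges satisfied by the labeling `f`, `g`. -/
noncomputable def val (G : FreeGame X Y S) (f : X → S) (g : Y → S) : ℝ :=
  ((Finset.univ.filter fun e : X × Y => (f e.1, g e.2) ∈ G.constraint e.1 e.2).card : ℝ) /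
    ((Fintype.card X : ℝ) * (Fintype.card Y : ℝ))

/-- The value of the game: the maximum (over a finite set) of the values of all labelings. -/
noncomputable def value (G : FreeGame X Y S) : ℝ :=
  ⨆ p : (X → S) × (Y → S), G.val p.1 p.2

end FreeGame

/-! ## A word RAM with an auxiliary bit tape

The machine has registers and finitely many (the ones named in the program) word-addressed
arrays. Words have `w` bits and arithmetic is modulo `2 ^ w`. Every instruction and every test
of a branch or of a loop costs one unit of time. A one-way tape of bits can be read one bit per
unit of time; it holds random bits or an advice string. -/

/-- The arithmetic instructions; `monus` is truncated subtraction. -/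
inductive WordOp
  | plus | monus | times | quot | rem

/-- Result of an arithmetic instruction, before reduction modulo the word range
(`x / 0 = 0` and `x mod 0 = x`). -/
def WordOp.eval : WordOp → ℕ → ℕ → ℕ
  | plus, a, b => a + b
  | monus, a, b => a - b
  | times, a, b => a * b
  | quot, a, b => a / b
  | rem, a, b => a % b

/-- Programs. Registers and arrays are named by numbers. -/
inductive Prog
  /-- do nothing -/
  | skip
  /-- write the constant `c` to register `x` -/
  | const (x c : ℕ)
  /-- copy register `y` to register `x` -/
  | copy (x y : ℕ)
  /-- write the result of `o` on registers `y` and `z` to register `x` -/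
  | arith (o : WordOp) (x y z : ℕ)
  /-- read into register `x` the cell of array `a` whose address is in register `i` -/
  | load (x a i : ℕ)
  /-- write register `x` to the cell of array `a` whose address is in register `i` -/
  | store (a i x : ℕ)
  /-- read the next bit of the tape into register `x` -/
  | bit (x : ℕ)
  /-- sequential composition -/
  | seq (P Q : Prog)
  /-- run `P` if register `x` is less than register `y`, otherwise run `Q` -/
  | ifLt (x y : ℕ) (P Q : Prog)
  /-- repeat `P` as long as register `x` is less than register `y` -/
  | whileLt (x y : ℕ) (P : Prog)

/-- Configurations: registers, arrays, and the unread part of the bit tape. -/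
structure Config where
  reg : ℕ → ℕ
  arr : ℕ → ℕ → ℕ
  tape : List Bool

/-- Write the word `v` to register `x`. -/
def Config.setReg (s : Config) (x v : ℕ) : Config :=
  { s with reg := Function.update s.reg x v }

/-- Write the word `v` to cell `i` of array `a`. -/
def Config.setArr (s : Config) (a i v : ℕ) : Config :=
  { s with arr := Function.update s.arr a (Function.update (s.arr a) i v) }

/-- `Exec w P s t s'`: with word size `w`, the program `P` started in `s` halts in `s'` after
exactly `t` units of time. On an exhausted tape the bit that is read is `0`. -/
inductive Exec (w : ℕ) : Prog → Config → ℕ → Config → Prop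
  | skip (s : Config) : Exec w .skip s 1 s
  | const (x c : ℕ) (s : Config) : Exec w (.const x c) s 1 (s.setReg x (c % 2 ^ w))
  | copy (x y : ℕ) (s : Config) : Exec w (.copy x y) s 1 (s.setReg x (s.reg y))
  | arith (o : WordOp) (x y z : ℕ) (s : Config) :
      Exec w (.arith o x y z) s 1 (s.setReg x (o.eval (s.reg y) (s.reg z) % 2 ^ w))
  | load (x a i : ℕ) (s : Config) :
      Exec w (.load x a i) s 1 (s.setReg x (s.arr a (s.reg i)))
  | store (a i x : ℕ) (s : Config) :
      Exec w (.store a i x) s 1 (s.setArr a (s.reg i) (s.reg x))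
  | bit (x : ℕ) (s : Config) :
      Exec w (.bit x) s 1
        ({ s with tape := s.tape.tail }.setReg x ((s.tape.headD false).toNat % 2 ^ w))
  | seq {P Q : Prog} {s s₁ s₂ : Config} {t₁ t₂ : ℕ} :
      Exec w P s t₁ s₁ → Exec w Q s₁ t₂ s₂ → Exec w (.seq P Q) s (t₁ + t₂) s₂
  | ifTrue {x y : ℕ} {P Q : Prog} {s s₁ : Config} {t : ℕ} :
      s.reg x < s.reg y → Exec w P s t s₁ → Exec w (.ifLt x y P Q) s (t + 1) s₁
  | ifFalse {x y : ℕ} {P Q : Prog} {s s₁ : Config} {t : ℕ} :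
      ¬ s.reg x < s.reg y → Exec w Q s t s₁ → Exec w (.ifLt x y P Q) s (t + 1) s₁
  | whileTrue {x y : ℕ} {P : Prog} {s s₁ s₂ : Config} {t₁ t₂ : ℕ} :
      s.reg x < s.reg y → Exec w P s t₁ s₁ → Exec w (.whileLt x y P) s₁ t₂ s₂ →
        Exec w (.whileLt x y P) s (t₁ + t₂ + 1) s₂
  | whileFalse {x y : ℕ} {P : Prog} {s : Config} :
      ¬ s.reg x < s.reg y → Exec w (.whileLt x y P) s 1 s

/-! ## Input, output, running time -/

open Classical in
/-- The initial configuration. Registers `0, …, 6` hold `|X|`, `|Y|`, `|Σ|` and the numerators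
and denominators of `ε₀` and `ε`. Array `0` is the truth table of the constraints. All other
cells are `0`. The tape holds `tape`. -/
noncomputable def inputConfig {m n q : ℕ} (G : FreeGame (Fin m) (Fin n) (Fin q))
    (ε₀ ε : ℚ) (tape : List Bool) : Config where
  reg := fun i =>
    [m, n, q, ε₀.num.toNat, ε₀.den, ε.num.toNat, ε.den].getD i 0
  arr := fun a i =>
    if a = 0 ∧ ∃ (x : Fin m) (y : Fin n) (σ τ : Fin q),
        i = (((x : ℕ) * n + y) * q + σ) * q + τ ∧ (σ, τ) ∈ G.constraint x y
    then 1 else 0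
  tape := tape

/-- The word size `w` suffices for the input, with factor `K`: it is at least `K` times the
binary logarithm of the total size of the vertex sets, the alphabet and the numbers given. -/
def WordSizeOK (K m n q : ℕ) (ε₀ ε : ℚ) (w : ℕ) : Prop :=
  (m + n + q + ε₀.num.toNat + ε₀.den + ε.num.toNat + ε.den) ^ K ≤ 2 ^ w

/-- A halting configuration reports failure (`⊥`) if register `0` holds `0`. -/
def ReportsFailure (s : Config) : Prop := s.reg 0 = 0

/-- A halting configuration returns (in arrays `1` and `2`) a labeling of value at least `ρ`. -/
def ReturnsLabeling {m n q : ℕ} (G : FreeGame (Fin m) (Fin n) (Fin q)) (ρ : ℝ)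
    (s : Config) : Prop :=
  ¬ ReportsFailure s ∧ ∃ (f : Fin m → Fin q) (g : Fin n → Fin q),
    (∀ x : Fin m, s.arr 1 x = f x) ∧ (∀ y : Fin n, s.arr 2 y = g y) ∧ ρ ≤ G.val f g

/-- The main factor `|X| |Y| |Σ| ^ (B (1 / ε²) log (|Σ| / ε))` of the running time. -/
noncomputable def mainFactor (B m n q : ℕ) (ε : ℚ) : ℝ :=
  (m : ℝ) * n * (q : ℝ) ^ ((B : ℝ) * (1 / (ε : ℝ) ^ 2) * Real.log ((q : ℝ) / (ε : ℝ)))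

/-- The time bound `A · F · (log F) ^ D` with `F` the main factor, i.e. `Õ(F)`; the `2 +` only
keeps the logarithm at least `1`. -/
noncomputable def timeBound (A B D m n q : ℕ) (ε : ℚ) : ℕ :=
  ⌊(A : ℝ) * mainFactor B m n q ε * Real.logb 2 (2 + mainFactor B m n q ε) ^ D⌋₊

open Classical in
/-- On the game `G` with parameters `ε₀`, `ε` and word size `w`, the program `P` is a Las Vegas
algorithm for finding a labeling of value at least `ρ`, with worst-case running time `T` and
error probability at most `δ`: on every outcome of the `T` random bits (it cannot read more) it
halts within time `T` and either reports failure or returns such a labeling, and it reports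
failure on at most a fraction `δ` of the outcomes. -/
def LasVegasOn {m n q : ℕ} (P : Prog) (w : ℕ) (G : FreeGame (Fin m) (Fin n) (Fin q))
    (ε₀ ε : ℚ) (ρ : ℝ) (T : ℕ) (δ : ℝ) : Prop :=
  (∀ r : Fin T → Bool, ∃ t s, Exec w P (inputConfig G ε₀ ε (List.ofFn r)) t s ∧ t ≤ T ∧
    (ReportsFailure s ∨ ReturnsLabeling G ρ s)) ∧
  ((Finset.univ.filter fun r : Fin T → Bool => ∃ t s,
      Exec w P (inputConfig G ε₀ ε (List.ofFn r)) t s ∧ ReportsFailure s).card : ℝ) / 2 ^ T ≤ δ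

/-- On the game `G` with parameters `ε₀`, `ε`, word size `w` and advice `a`, the program `P`
halts within time `T` and returns a labeling of value at least `ρ`. -/
def SolvesWithAdvice {m n q : ℕ} (P : Prog) (w : ℕ) (G : FreeGame (Fin m) (Fin n) (Fin q))
    (ε₀ ε : ℚ) (a : List Bool) (ρ : ℝ) (T : ℕ) : Prop :=
  ∃ t s, Exec w P (inputConfig G ε₀ ε a) t s ∧ t ≤ T ∧ ReturnsLabeling G ρ s

/-! Write `t` for the sample size and `e` for `invEps`, so that `1 / e < ε`. Labels of a random
sample of second-side vertices induce a labeling of the first side: each vertex takes a label that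
satisfies most constraints against the sample. Labels of a random sample of the first side induce a
labeling of the second side in the same way. If the first sample carries the labels of an optimal
labeling, Hoeffding and Markov show that each of the two passages costs only `3 / e` in value
(`prob_response_le`), for samples of size `O(ε⁻² log (q / ε))`. The optimal labels are unknown, but
a sample has only `q ^ t` labelings. Trying all of them and keeping the one that scores best on
random test edges yields a labeling within `8 / e` of the optimum with probability at least `63 /
64` (`prob_group_bad_le`, `group_failure_le`).

The failure probability must drop to `2 ^ -(m n q² + 1)`, so between `2 m n q²` and `8 m n q²` such
groups are drawn. Evaluating every candidate exactly would cost a second factor `m n`. Instead the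
candidates play a knockout tournament of `L` rounds. Round `i` has `2 ^ (L - 1 - i)` matches, each
decided on `2 ^ i * S` fresh edges, so every round uses equally many edges, and the exponents in the
failure bounds of the rounds coincide as well: few matches are compensated by reliable ones. If
fewer than half of the groups are bad and at most a fraction `1 / (4 L)` of the matches of each
round is misjudged by `1 / (e L)` or more, then the proportion of bad players never exceeds `3 / 4`,
so the single final winner is not bad (`not_bad_of_few_upsets`, `prob_champion_lt_le`). The rounds
cost another `2 / e`, and the bias of reducing random words modulo `m` and `n` is absorbed by a last
`2 / e` (`prob_outCount_lt_le`). This explains the constant `12`.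

The winner's value is finally computed exactly and compared with `1 - ε₀ - 12 ε`; falling short is
reported as failure, which makes the algorithm Las Vegas. A failure implies `BadTape`, an event
defined without `ε₀`. There are only `2 ^ (m n q²)` games of given sizes, so a union bound produces
one tape that is bad for none of them, and this tape is the advice.

On the machine side, a Hoare logic with time bounds (`Run`) shows that the program computes pure
functions of the stream of random edges (`solveProg_run`); the probabilistic part speaks of these
functions only. For the running time, `Q = q ^ t` dominates every other polynomial quantity in `q`
and `e`, which gives `m n b L⁴ Q¹¹` with `b` and `L` logarithmic (`solveTime_le`, `le_timeBound`).
If `q = 1` or `ε ≥ 1`, the zero labeling is good enough (`solveProg_run_trivial`). -/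

/-! ## Running programs within a time bound -/

/-- Started in `s`, the program `P` halts within time `T` in a configuration satisfying `Q`. -/
def Run (w : ℕ) (P : Prog) (s : Config) (T : ℕ) (Q : Config → Prop) : Prop :=
  ∃ t s', Exec w P s t s' ∧ t ≤ T ∧ Q s'

/-- Failure is counted over tapes for which some run fails; determinism identifies that run with the
one whose outcome has been analysed. -/
theorem Exec.deterministic {w : ℕ} {P : Prog} {s s₁ s₂ : Config} {t₁ t₂ : ℕ}
    (h₁ : Exec w P s t₁ s₁) (h₂ : Exec w P s t₂ s₂) : t₁ = t₂ ∧ s₁ = s₂ := by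
  induction h₁ generalizing t₂ s₂ with
  | skip | const | copy | arith | load | store | bit => cases h₂; exact ⟨rfl, rfl⟩
  | seq _ _ ih₁ ih₂ =>
    cases h₂ with
    | seq a b =>
      obtain ⟨rfl, rfl⟩ := ih₁ a
      obtain ⟨rfl, rfl⟩ := ih₂ b
      exact ⟨rfl, rfl⟩
  | ifTrue h _ ih =>
    cases h₂ with
    | ifTrue _ a => obtain ⟨rfl, rfl⟩ := ih a; exact ⟨rfl, rfl⟩
    | ifFalse h' _ => exact absurd h h'
  | ifFalse h _ ih =>
    cases h₂ with
    | ifFalse _ a => obtain ⟨rfl, rfl⟩ := ih a; exact ⟨rfl, rfl⟩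
    | ifTrue h' _ => exact absurd h' h
  | whileTrue h _ _ ih₁ ih₂ =>
    cases h₂ with
    | whileTrue _ a b =>
      obtain ⟨rfl, rfl⟩ := ih₁ a
      obtain ⟨rfl, rfl⟩ := ih₂ b
      exact ⟨rfl, rfl⟩
    | whileFalse h' => exact absurd h h'
  | whileFalse h =>
    cases h₂ with
    | whileFalse => exact ⟨rfl, rfl⟩
    | whileTrue h' _ _ => exact absurd h' h

namespace Prog

/-- Whether the program may write register `x`. -/
def writes (x : ℕ) : Prog → Bool
  | skip => false
  | const y _ => x == y
  | copy y _ => x == y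
  | arith _ y _ _ => x == y
  | load y _ _ => x == y
  | store _ _ _ => false
  | bit y => x == y
  | seq P Q => P.writes x || Q.writes x
  | ifLt _ _ P Q => P.writes x || Q.writes x
  | whileLt _ _ P => P.writes x

/-- Whether the program may write array `a`. -/
def stores (a : ℕ) : Prog → Bool
  | store b _ _ => a == b
  | seq P Q => P.stores a || Q.stores a
  | ifLt _ _ P Q => P.stores a || Q.stores a
  | whileLt _ _ P => P.stores a
  | _ => false

/-- Whether the program may read the tape. -/
def reads : Prog → Bool
  | bit _ => true
  | seq P Q => P.reads || Q.reads
  | ifLt _ _ P Q => P.reads || Q.reads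
  | whileLt _ _ P => P.reads
  | _ => false

/-- Whether the program has no loops. -/
def loopFree : Prog → Bool
  | seq P Q => P.loopFree && Q.loopFree
  | ifLt _ _ P Q => P.loopFree && Q.loopFree
  | whileLt _ _ _ => false
  | _ => true

/-- A bound for the running time of a loop-free program. -/
def cost : Prog → ℕ
  | seq P Q => P.cost + Q.cost
  | ifLt _ _ P Q => P.cost + Q.cost + 1
  | _ => 1

/-- The effect of a loop-free program. -/
def sem (w : ℕ) : Prog → Config → Config
  | skip, s => s
  | const x c, s => s.setReg x (c % 2 ^ w)
  | copy x y, s => s.setReg x (s.reg y)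
  | arith o x y z, s => s.setReg x (o.eval (s.reg y) (s.reg z) % 2 ^ w)
  | load x a i, s => s.setReg x (s.arr a (s.reg i))
  | store a i x, s => s.setArr a (s.reg i) (s.reg x)
  | bit x, s => { s with tape := s.tape.tail }.setReg x ((s.tape.headD false).toNat % 2 ^ w)
  | seq P Q, s => Q.sem w (P.sem w s)
  | ifLt x y P Q, s => if s.reg x < s.reg y then P.sem w s else Q.sem w s
  | whileLt _ _ _, s => s

end Prog

/-- The footprint is a Boolean computed from the syntax, so for concrete programs the side condition
is closed by `rfl`. This replaces explicit non-interference assertions in all invariants. -/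
theorem Exec.reg_eq {w : ℕ} {P : Prog} {s s' : Config} {t : ℕ} (h : Exec w P s t s') {x : ℕ}
    (hx : P.writes x = false) : s'.reg x = s.reg x := by
  induction h <;> simp_all [Prog.writes, Config.setReg, Config.setArr]

theorem Exec.arr_eq {w : ℕ} {P : Prog} {s s' : Config} {t : ℕ} (h : Exec w P s t s') {a : ℕ}
    (ha : P.stores a = false) : s'.arr a = s.arr a := by
  induction h <;> simp_all [Prog.stores, Config.setReg, Config.setArr]

theorem Exec.tape_eq {w : ℕ} {P : Prog} {s s' : Config} {t : ℕ} (h : Exec w P s t s')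
    (hP : P.reads = false) : s'.tape = s.tape := by
  induction h <;> simp_all [Prog.reads, Config.setReg, Config.setArr]

/-- `s'` arises from `s` by changing only what `P` may change. -/
structure Frame (P : Prog) (s s' : Config) : Prop where
  reg : ∀ x, P.writes x = false → s'.reg x = s.reg x
  arr : ∀ a, P.stores a = false → s'.arr a = s.arr a
  tape : P.reads = false → s'.tape = s.tape

theorem Frame.refl (P : Prog) (s : Config) : Frame P s s :=
  ⟨fun _ _ => rfl, fun _ _ => rfl, fun _ => rfl⟩

theorem Frame.trans {P : Prog} {s s' s'' : Config} (h : Frame P s s') (h' : Frame P s' s'') :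
    Frame P s s'' :=
  ⟨fun x hx => (h'.reg x hx).trans (h.reg x hx), fun a ha => (h'.arr a ha).trans (h.arr a ha),
    fun hP => (h'.tape hP).trans (h.tape hP)⟩

/-! ### Proof rules for correctness within a time bound -/

namespace Run

variable {w : ℕ} {P P' : Prog} {s : Config} {T T' T₁ T₂ : ℕ} {Q Q' : Config → Prop}

theorem frame (h : Run w P s T Q) : Run w P s T fun s' => Q s' ∧ Frame P s s' := by
  obtain ⟨t, s', h, ht, hQ⟩ := h
  exact ⟨t, s', h, ht, hQ, fun _ => h.reg_eq, fun _ => h.arr_eq, h.tape_eq⟩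

theorem mono (h : Run w P s T Q) (hT : T ≤ T') (hQ : ∀ s', Q s' → Q' s') : Run w P s T' Q' := by
  obtain ⟨t, s', h, ht, h'⟩ := h
  exact ⟨t, s', h, ht.trans hT, hQ _ h'⟩

theorem le (h : Run w P s T Q) (hT : T ≤ T') : Run w P s T' Q := h.mono hT fun _ h => h

/-- Consequence rule that keeps track of the unchanged part of the configuration. -/
theorem post (h : Run w P s T Q) (hQ : ∀ s', Q s' → Frame P s s' → Q' s') : Run w P s T Q' :=
  h.frame.mono le_rfl fun s' h => hQ s' h.1 h.2

/-- The continuation receives the frame of `P` besides `Q'`, so an intermediate assertion has to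
mention only what `P` changes. -/
theorem seq (h₁ : Run w P s T₁ Q') (h₂ : ∀ s', Q' s' → Frame P s s' → Run w P' s' T₂ Q) :
    Run w (P.seq P') s (T₁ + T₂) Q := by
  obtain ⟨t, s', h, ht, hq, hf⟩ := h₁.frame
  obtain ⟨t', s'', h', ht', hq'⟩ := h₂ s' hq hf
  exact ⟨_, _, h.seq h', add_le_add ht ht', hq'⟩

theorem ifLt {x y : ℕ} (h₁ : s.reg x < s.reg y → Run w P s T Q)
    (h₂ : ¬ s.reg x < s.reg y → Run w P' s T Q) : Run w (.ifLt x y P P') s (T + 1) Q := by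
  by_cases h : s.reg x < s.reg y
  · obtain ⟨t, s', h', ht, hq⟩ := h₁ h
    exact ⟨_, _, .ifTrue h h', by omega, hq⟩
  · obtain ⟨t, s', h', ht, hq⟩ := h₂ h
    exact ⟨_, _, .ifFalse h h', by omega, hq⟩

/-- Induction on the number `d` of remaining passes. Since the invariant is indexed by the pass,
termination and the time bound come from the same count: one test per pass and one final test. -/
theorem whileLt_aux {x y : ℕ} (I : ℕ → Config → Prop) (c Tb : ℕ)
    (hb : ∀ k < c, ∀ s, I k s → s.reg x < s.reg y ∧ Run w P s Tb (I (k + 1)))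
    (he : ∀ s, I c s → ¬ s.reg x < s.reg y) (d : ℕ) :
    ∀ k s, k + d = c → I k s → Run w (.whileLt x y P) s (d * (Tb + 1) + 1) (I c) := by
  induction d with
  | zero =>
    rintro k s rfl hI
    exact ⟨_, _, .whileFalse (he s hI), by simp, hI⟩
  | succ d ih =>
    intro k s hk hI
    obtain ⟨hlt, t, s', h, ht, hq⟩ := hb k (by omega) s hI
    obtain ⟨t', s'', h', ht', hq'⟩ := ih (k + 1) s' (by omega) hq
    exact ⟨_, _, .whileTrue hlt h h', by rw [add_mul]; omega, hq'⟩

/-- Rule for a loop that is run exactly `c` times. -/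
theorem whileLt {x y : ℕ} (I : ℕ → Config → Prop) (c Tb : ℕ) (h0 : I 0 s)
    (hb : ∀ k < c, ∀ s', Frame (.whileLt x y P) s s' → I k s' →
      s'.reg x < s'.reg y ∧ Run w P s' Tb (I (k + 1)))
    (he : ∀ s', Frame (.whileLt x y P) s s' → I c s' → ¬ s'.reg x < s'.reg y) :
    Run w (.whileLt x y P) s (c * (Tb + 1) + 1) (I c) := by
  refine (whileLt_aux (fun k s' => Frame (.whileLt x y P) s s' ∧ I k s') c Tb ?_ ?_ c 0 s
    (by simp) ⟨.refl _ _, h0⟩).mono le_rfl fun s' h => h.2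
  · rintro k hk s' ⟨hf, hI⟩
    obtain ⟨h1, h2⟩ := hb k hk s' hf hI
    exact ⟨h1, h2.post fun s'' h hf' => ⟨hf.trans ⟨hf'.reg, hf'.arr, hf'.tape⟩, h⟩⟩
  · rintro s' ⟨hf, hI⟩
    exact he s' hf hI

theorem of_loopFree (hP : P.loopFree = true) : Run w P s P.cost fun s' => s' = P.sem w s := by
  induction P generalizing s with
  | skip => exact ⟨1, _, .skip _, le_rfl, rfl⟩
  | const x c => exact ⟨1, _, .const _ _ _, le_rfl, rfl⟩
  | copy x y => exact ⟨1, _, .copy _ _ _, le_rfl, rfl⟩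
  | arith o x y z => exact ⟨1, _, .arith _ _ _ _ _, le_rfl, rfl⟩
  | load x a i => exact ⟨1, _, .load _ _ _ _, le_rfl, rfl⟩
  | store a i x => exact ⟨1, _, .store _ _ _ _, le_rfl, rfl⟩
  | bit x => exact ⟨1, _, .bit _ _, le_rfl, rfl⟩
  | seq P R ihP ihR =>
    simp only [Prog.loopFree, Bool.and_eq_true] at hP
    exact (ihP hP.1).seq fun s' h _ => by subst h; exact ihR hP.2
  | ifLt x y P R ihP ihR =>
    simp only [Prog.loopFree, Bool.and_eq_true] at hP
    refine Run.ifLt (fun h => ?_) (fun h => ?_)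
    · exact (ihP hP.1).mono (by simp) fun s' h' => by simp [h', Prog.sem, h]
    · exact (ihR hP.2).mono (by simp) fun s' h' => by simp [h', Prog.sem, h]
  | whileLt x y P _ => simp [Prog.loopFree] at hP

/-- A loop-free program is run by computing its effect. -/
theorem straight (hP : P.loopFree = true) (h : Q (P.sem w s)) : Run w P s P.cost Q :=
  (of_loopFree hP).mono le_rfl fun s' h' => by subst h'; exact h

end Run

/-- The loop `for i := 0 to n - 1 do P`; register `99` is scratch. -/
def Prog.forLt (i n : ℕ) (P : Prog) : Prog :=
  .seq (.const i 0) (.whileLt i n (.seq P (.seq (.const 99 1) (.arith .plus i i 99))))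

/-- `hI` asks that the invariant ignore the counter and register `99`, both of which the increment
overwrites. The `3` per pass is the test and the two instructions of the increment; the `2` is the
initialization and the last test. The bound `c < 2 ^ w` keeps the counter from wrapping around. -/
theorem Run.forLt {w : ℕ} {P : Prog} {s : Config} {i n : ℕ} (I : ℕ → Config → Prop)
    (c Tb : ℕ) (hi : P.writes i = false) (hn : P.writes n = false) (hin : n ≠ i) (h99 : n ≠ 99)
    (hi99 : i ≠ 99) (hc : c < 2 ^ w) (hsn : s.reg n = c)
    (h0 : I 0 (s.setReg i 0))
    (hb : ∀ k < c, ∀ s', Frame (.forLt i n P) s s' → I k s' → s'.reg i = k →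
      Run w P s' Tb (I (k + 1)))
    (hI : ∀ k s v, I k s → I k ((s.setReg 99 1).setReg i v)) :
    Run w (.forLt i n P) s (c * (Tb + 3) + 2) (I c) := by
  have key : Run w (.forLt i n P) s (1 + (c * (Tb + 2 + 1) + 1))
      (fun s => I c s ∧ s.reg i = c ∧ s.reg n = c) := by
    refine Run.seq (Q' := fun s' => I 0 s' ∧ s'.reg i = 0 ∧ s'.reg n = c)
      ((Run.straight rfl ?_).le le_rfl) ?_
    · simp only [Prog.sem, Nat.zero_mod]
      exact ⟨h0, by simp [Config.setReg], by simp [Config.setReg, hin, hsn]⟩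
    · intro s' hs' hf0
      have hf0' : Frame (.forLt i n P) s s' :=
        ⟨fun x hx => hf0.reg x (by simp_all [Prog.writes, Prog.forLt]),
          fun a ha => hf0.arr a rfl, fun h => hf0.tape rfl⟩
      refine Run.whileLt (fun k s => I k s ∧ s.reg i = k ∧ s.reg n = c) c (Tb + 2) hs' ?_ ?_
      · rintro k hk s₀ hf ⟨hIk, hik, hnk⟩
        have hf' : Frame (.forLt i n P) s s₀ := hf0'.trans
          ⟨fun x hx => hf.reg x (by simp_all [Prog.writes, Prog.forLt]),
            fun a ha => hf.arr a (by simp_all [Prog.stores, Prog.forLt]),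
            fun h => hf.tape (by simp_all [Prog.reads, Prog.forLt])⟩
        refine ⟨by omega, (hb k hk s₀ hf' hIk hik).seq fun s₁ h₁ hf =>
          (Run.straight rfl ?_).le le_rfl⟩
        have e1 : 1 % 2 ^ w = 1 := Nat.mod_eq_of_lt (by omega)
        have e2 : (k + 1) % 2 ^ w = k + 1 := Nat.mod_eq_of_lt (by omega)
        have e3 : s₁.reg i = k := (hf.reg i hi).trans hik
        have e4 : s₁.reg n = c := (hf.reg n hn).trans hnk
        have : (Prog.sem w ((Prog.const 99 1).seq (.arith .plus i i 99)) s₁)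
            = (s₁.setReg 99 1).setReg i (k + 1) := by
          simp [Prog.sem, WordOp.eval, Config.setReg, e1, hi99, e3, e2]
        rw [this]
        exact ⟨hI _ _ _ h₁, by simp [Config.setReg], by simp [Config.setReg, hin, h99, e4]⟩
      · rintro s _ ⟨_, h1, h2⟩
        omega
  exact key.mono (by rw [show Tb + 2 + 1 = Tb + 3 from rfl]; omega) fun s h => h.1

/-! ## The algorithm as a function -/

/-- The first index below the bound at which `c` is largest, and the value of `c` there
(both are `0` if `c` vanishes below the bound). -/
def scan (c : ℕ → ℕ) : ℕ → ℕ × ℕ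
  | 0 => (0, 0)
  | k + 1 => if (scan c k).2 < c k then (k, c k) else scan c k

theorem scan_fst_lt (c : ℕ → ℕ) {k : ℕ} (hk : 0 < k) : (scan c k).1 < k := by
  induction k with
  | zero => omega
  | succ k ih =>
    rw [scan]
    split_ifs
    · simp
    · rcases Nat.eq_zero_or_pos k with rfl | h
      · simp [scan]
      · exact (ih h).trans (Nat.lt_succ_self k)

/-- Only an inequality: for the empty range the recorded pair is `(0, 0)`, whatever `c 0` is. -/
theorem scan_snd_le (c : ℕ → ℕ) (k : ℕ) : (scan c k).2 ≤ c (scan c k).1 := by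
  induction k with
  | zero => simp [scan]
  | succ k ih =>
    rw [scan]
    split_ifs <;> simp [ih]

theorem le_scan_snd (c : ℕ → ℕ) {i k : ℕ} (h : i < k) : c i ≤ (scan c k).2 := by
  induction k with
  | zero => omega
  | succ k ih =>
    rw [scan]
    rcases Nat.lt_succ_iff_lt_or_eq.mp h with h | rfl
    · have := ih h
      split_ifs <;> omega
    · split_ifs <;> omega

theorem le_scan (c : ℕ → ℕ) {i k : ℕ} (h : i < k) : c i ≤ c (scan c k).1 :=
  (le_scan_snd c h).trans (scan_snd_le c k)

/-! ### Best responses to labeled samples, and their score -/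

section Pure

variable (tb : ℕ → ℕ → ℕ → ℕ → ℕ) (q t : ℕ)

/-- The label of `x` satisfying most constraints against the labels `lab` of the sample `ys`. -/
def bestX (ys lab : ℕ → ℕ) (x : ℕ) : ℕ :=
  (scan (fun σ => ∑ k ∈ Finset.range t, tb x (ys k) σ (lab k)) q).1

/-- The label of `y` satisfying most constraints against the labels `fx` of the sample `xs`. -/
def bestY (xs fx : ℕ → ℕ) (y : ℕ) : ℕ :=
  (scan (fun τ => ∑ k ∈ Finset.range t, tb (xs k) y (fx k) τ) q).1

/-- The label of `y` satisfying most constraints against the labels of the sample `xs` that are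
induced by the labels `lab` of the sample `ys`. -/
def respY (ys lab xs : ℕ → ℕ) (y : ℕ) : ℕ :=
  bestY tb q t xs (fun k => bestX tb q t ys lab (xs k)) y

/-- Whether the labeling induced by `ys`, `lab`, `xs` satisfies the edge `(x, y)`. -/
def hit (ys lab xs : ℕ → ℕ) (x y : ℕ) : ℕ :=
  tb x y (bestX tb q t ys lab x) (respY tb q t ys lab xs y)

/-- The number of satisfied edges among the first `S` of the list `ex`, `ey`. -/
def score (ys lab xs ex ey : ℕ → ℕ) (S : ℕ) : ℕ :=
  ∑ k ∈ Finset.range S, hit tb q t ys lab xs (ex k) (ey k)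

/-- Digit `k` of `a` in base `q`. -/
def digit (q a k : ℕ) : ℕ := a / q ^ k % q

/-- The number of the labeling of the sample `ys` with the best score on the given edges. -/
def bestLab (ys xs ex ey : ℕ → ℕ) (S : ℕ) : ℕ :=
  (scan (fun a => score tb q t ys (digit q a) xs ex ey S) (q ^ t)).1

variable {tb q t}

/-- This and the following congruences record that only the first `t` sample entries (and the first
`S` edges) matter. They serve twice: to match memory contents with the random stream, and to see
which coordinates of the probability space an event depends on. -/
theorem bestX_congr {ys ys' lab lab' : ℕ → ℕ} (h : ∀ k < t, ys k = ys' k)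
    (h' : ∀ k < t, lab k = lab' k) (x : ℕ) : bestX tb q t ys lab x = bestX tb q t ys' lab' x := by
  unfold bestX
  congr 2
  funext σ
  refine Finset.sum_congr rfl fun k hk => ?_
  rw [h k (Finset.mem_range.mp hk), h' k (Finset.mem_range.mp hk)]

theorem bestY_congr {xs xs' fx fx' : ℕ → ℕ} (h : ∀ k < t, xs k = xs' k)
    (h' : ∀ k < t, fx k = fx' k) (y : ℕ) : bestY tb q t xs fx y = bestY tb q t xs' fx' y := by
  unfold bestY
  congr 2
  funext τ
  refine Finset.sum_congr rfl fun k hk => ?_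
  rw [h k (Finset.mem_range.mp hk), h' k (Finset.mem_range.mp hk)]

theorem respY_congr {ys ys' lab lab' xs xs' : ℕ → ℕ} (h : ∀ k < t, ys k = ys' k)
    (h' : ∀ k < t, lab k = lab' k) (h'' : ∀ k < t, xs k = xs' k) (y : ℕ) :
    respY tb q t ys lab xs y = respY tb q t ys' lab' xs' y :=
  bestY_congr h'' (fun k hk => by rw [bestX_congr h h', h'' k hk]) y

theorem hit_congr {ys ys' lab lab' xs xs' : ℕ → ℕ} (h : ∀ k < t, ys k = ys' k)
    (h' : ∀ k < t, lab k = lab' k) (h'' : ∀ k < t, xs k = xs' k) (x y : ℕ) :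
    hit tb q t ys lab xs x y = hit tb q t ys' lab' xs' x y := by
  rw [hit, hit, bestX_congr h h', respY_congr h h' h'']

theorem score_congr {ys ys' lab lab' xs xs' ex ex' ey ey' : ℕ → ℕ} {S : ℕ}
    (h : ∀ k < t, ys k = ys' k) (h' : ∀ k < t, lab k = lab' k) (h'' : ∀ k < t, xs k = xs' k)
    (hx : ∀ k < S, ex k = ex' k) (hy : ∀ k < S, ey k = ey' k) :
    score tb q t ys lab xs ex ey S = score tb q t ys' lab' xs' ex' ey' S := by
  refine Finset.sum_congr rfl fun k hk => ?_
  rw [hx k (Finset.mem_range.mp hk), hy k (Finset.mem_range.mp hk), hit_congr h h' h'']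

theorem bestLab_congr {ys ys' xs xs' ex ex' ey ey' : ℕ → ℕ} {S : ℕ}
    (h : ∀ k < t, ys k = ys' k) (h'' : ∀ k < t, xs k = xs' k)
    (hx : ∀ k < S, ex k = ex' k) (hy : ∀ k < S, ey k = ey' k) :
    bestLab tb q t ys xs ex ey S = bestLab tb q t ys' xs' ex' ey' S := by
  unfold bestLab
  congr 2
  funext a
  exact score_congr h (fun _ _ => rfl) h'' hx hy

theorem bestX_lt (hq : 0 < q) (ys lab : ℕ → ℕ) (x : ℕ) : bestX tb q t ys lab x < q :=
  scan_fst_lt _ hq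

theorem respY_lt (hq : 0 < q) (ys lab xs : ℕ → ℕ) (y : ℕ) : respY tb q t ys lab xs y < q :=
  scan_fst_lt _ hq

theorem hit_le (h : ∀ x y σ τ, tb x y σ τ ≤ 1) (ys lab xs : ℕ → ℕ) (x y : ℕ) :
    hit tb q t ys lab xs x y ≤ 1 := h _ _ _ _

theorem score_le (h : ∀ x y σ τ, tb x y σ τ ≤ 1) (ys lab xs ex ey : ℕ → ℕ) (S : ℕ) :
    score tb q t ys lab xs ex ey S ≤ S := by
  refine (Finset.sum_le_card_nsmul _ _ 1 fun k _ => hit_le h _ _ _ _ _).trans (by simp)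

theorem digit_lt (hq : 0 < q) (a k : ℕ) : digit q a k < q := Nat.mod_lt _ hq

end Pure

/-- The truth table of the constraints, as laid out in memory. -/
def tableAt (n q : ℕ) (a : ℕ → ℕ) (x y σ τ : ℕ) : ℕ := a (((x * n + y) * q + σ) * q + τ)

/-! ### Groups and tournament as functions of a stream of random edges -/

section Streams

variable (tb : ℕ → ℕ → ℕ → ℕ → ℕ) (q t s₀ : ℕ) (ω : ℕ → ℕ × ℕ)

/-- The number of random edges used by each sample. -/
def groupSize (t s₀ : ℕ) : ℕ := 2 * t + s₀

/-- The sample of the second side in group `j`. -/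
def sampleY (j k : ℕ) : ℕ := (ω (j * groupSize t s₀ + k)).2

/-- The sample of the first side in group `j`. -/
def sampleX (j k : ℕ) : ℕ := (ω (j * groupSize t s₀ + (t + k))).1

/-- The edges on which the labelings of the sample of group `j` are compared. -/
def edgeAt (j k : ℕ) : ℕ × ℕ := ω (j * groupSize t s₀ + (2 * t + k))

/-- The labels of the sample of the second side that are chosen in group `j`. -/
def sampleLab (j : ℕ) : ℕ → ℕ :=
  digit q (bestLab tb q t (sampleY t s₀ ω j) (sampleX t s₀ ω j) (fun k => (edgeAt t s₀ ω j k).1)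
    (fun k => (edgeAt t s₀ ω j k).2) s₀)

/-- The score of the labeling of group `j` on the `S` edges starting at position `o`. -/
def groupScore (j o S : ℕ) : ℕ :=
  score tb q t (sampleY t s₀ ω j) (sampleLab tb q t s₀ ω j) (sampleX t s₀ ω j)
    (fun k => (ω (o + k)).1) (fun k => (ω (o + k)).2) S

/-- The position of the first random edge used in round `i` of the tournament. -/
def roundStart (t s₀ L S i : ℕ) : ℕ := 2 ^ L * groupSize t s₀ + i * (2 ^ (L - 1) * S)

/-- The group at place `p` after `i` rounds of the knockout tournament. -/
def champion (L S : ℕ) : ℕ → ℕ → ℕ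
  | 0, p => p
  | i + 1, p =>
    let o := roundStart t s₀ L S i + p * (2 ^ i * S)
    if groupScore tb q t s₀ ω (champion L S i (2 * p)) o (2 ^ i * S) <
        groupScore tb q t s₀ ω (champion L S i (2 * p + 1)) o (2 ^ i * S)
    then champion L S i (2 * p + 1) else champion L S i (2 * p)

end Streams

/-! ## The program: evaluating a labeling

Registers: `0, …, 6` input, `7` holds `1`, `8` `e`, `9` the sample size `t`, `10` the range of the
random numbers, `11` the number of groups, `12` the number of rounds, `13` the number of edges per
group, `14` the base number of edges per match, `15` holds `2 * t`. Registers from `20` on are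
variables. Arrays: `0` input, `1`, `2` output, `3`, `4` the samples, `5` their labels, `6` induced
labels, `7`, `8` the current edges, `9` the champions. -/

/-- Load the truth value of `(σ, τ)` on the edge `(x, y)` into register `24`. -/
def lookup (x y σ τ : ℕ) : Prog :=
  .seq (.arith .times 24 x 1) <| .seq (.arith .plus 24 24 y) <| .seq (.arith .times 24 24 2) <|
  .seq (.arith .plus 24 24 σ) <| .seq (.arith .times 24 24 2) <| .seq (.arith .plus 24 24 τ) <|
  .load 24 0 24

/-- Set register `28` to the index (register `22`) below `|Σ|` at which the sum over register
`25` of the bit computed by `P` in register `24` is largest. -/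
def argmaxCount (P : Prog) : Prog :=
  .seq (.const 27 0) <| .seq (.const 28 0) <| .forLt 22 2 <|
    .seq (.const 26 0) <| .seq (.forLt 25 9 (.seq P (.arith .plus 26 26 24))) <|
    .ifLt 27 26 (.seq (.copy 27 26) (.copy 28 22)) .skip

/-- Compute in register `28` the label of the vertex in register `20`. -/
def evalX : Prog :=
  argmaxCount <|
    .seq (.seq (.arith .plus 24 29 25) <| .seq (.load 21 4 24) <|
      .seq (.arith .plus 24 30 25) (.load 23 5 24)) (lookup 20 21 22 23)

/-- Compute in array `6` the labels of the sample of the first side. -/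
def prepare : Prog :=
  .forLt 34 9 <|
    .seq (.seq (.arith .plus 24 29 9) <| .seq (.arith .plus 24 24 34) (.load 20 3 24)) <|
    .seq evalX (.store 6 34 28)

/-- Compute in register `28` the label of the vertex in register `21`. -/
def evalY : Prog :=
  argmaxCount <|
    .seq (.seq (.arith .plus 24 29 9) <| .seq (.arith .plus 24 24 25) <| .seq (.load 20 3 24) <|
      .load 23 6 25) (lookup 20 21 23 22)

/-- Test the edge in registers `35`, `36`. -/
def testEdge : Prog :=
  .seq (.copy 20 35) <| .seq evalX <| .seq (.seq (.copy 37 28) (.copy 21 36)) <| .seq evalY <|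
  lookup 35 36 37 28

/-- Count in register `33` the satisfied edges among the current ones (register `32` many). -/
def scoreProg : Prog :=
  .seq prepare <| .seq (.const 33 0) <| .forLt 31 32 <|
    .seq (.seq (.load 35 7 31) (.load 36 8 31)) <| .seq testEdge (.arith .plus 33 33 24)

/-- The parameters are in place and the truth table can be addressed. -/
structure Env (w m n q t : ℕ) (s : Config) : Prop where
  m_eq : s.reg 0 = m
  n_eq : s.reg 1 = n
  q_eq : s.reg 2 = q
  one_eq : s.reg 7 = 1
  t_eq : s.reg 9 = t
  m_pos : 0 < m
  n_pos : 0 < n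
  q_pos : 0 < q
  t_pos : 0 < t
  table_lt : m * n * q * q < 2 ^ w
  t_lt : t < 2 ^ w
  table_le : ∀ i, s.arr 0 i ≤ 1

theorem Env.frame {w m n q t : ℕ} {s s' : Config} {P : Prog} (h : Env w m n q t s)
    (hf : Frame P s s')
    (hw : (P.writes 0 || P.writes 1 || P.writes 2 || P.writes 7 || P.writes 9 || P.stores 0) =
      false) :
    Env w m n q t s' := by
  simp only [Bool.or_eq_false_iff] at hw
  obtain ⟨⟨⟨⟨⟨h0, h1⟩, h2⟩, h7⟩, h9⟩, ha⟩ := hw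
  exact { h with
    m_eq := (hf.reg 0 h0).trans h.m_eq
    n_eq := (hf.reg 1 h1).trans h.n_eq
    q_eq := (hf.reg 2 h2).trans h.q_eq
    one_eq := (hf.reg 7 h7).trans h.one_eq
    t_eq := (hf.reg 9 h9).trans h.t_eq
    table_le := by rw [hf.arr 0 ha]; exact h.table_le }

/-- Addresses in the truth table are in range. -/
theorem address_lt {m n q x y σ τ : ℕ} (hx : x < m) (hy : y < n) (hσ : σ < q) (hτ : τ < q) :
    x * n + y < m * n ∧ (x * n + y) * q + σ < m * n * q ∧
      ((x * n + y) * q + σ) * q + τ < m * n * q * q := by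
  have h1 : x * n + y < m * n := by nlinarith
  have h2 : (x * n + y) * q + σ < m * n * q := by nlinarith
  exact ⟨h1, h2, by nlinarith⟩

/-- Register `24` is the accumulator of the Horner scheme, so `y`, `σ` and `τ` must differ from it;
`x` is read before `24` is first written and needs no such condition. Every intermediate value is
below the table size, hence nothing is reduced modulo `2 ^ w`. -/
theorem lookup_run {w m n q t : ℕ} {s : Config} (h : Env w m n q t s) {x y σ τ : ℕ}
    (hy24 : y ≠ 24) (hσ24 : σ ≠ 24) (hτ24 : τ ≠ 24)
    (hx : s.reg x < m) (hy : s.reg y < n) (hσ : s.reg σ < q) (hτ : s.reg τ < q) :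
    Run w (lookup x y σ τ) s 7 fun s' =>
      s'.reg 24 = tableAt n q (s.arr 0) (s.reg x) (s.reg y) (s.reg σ) (s.reg τ) := by
  obtain ⟨h1, h2, h3⟩ := address_lt hx hy hσ hτ
  have hw := h.table_lt
  have hq := h.q_pos
  have hm : m * n ≤ m * n * q := Nat.le_mul_of_pos_right _ hq
  have hm' : m * n * q ≤ m * n * q * q := Nat.le_mul_of_pos_right _ hq
  have a1 : s.reg x * n < 2 ^ w := by omega
  have a2 : s.reg x * n + s.reg y < 2 ^ w := by omega
  have a4 : (s.reg x * n + s.reg y) * q + s.reg σ < 2 ^ w := by omega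
  have a3 : (s.reg x * n + s.reg y) * q < 2 ^ w := by omega
  have a6 : ((s.reg x * n + s.reg y) * q + s.reg σ) * q + s.reg τ < 2 ^ w := by omega
  have a5 : ((s.reg x * n + s.reg y) * q + s.reg σ) * q < 2 ^ w := by omega
  refine (Run.straight rfl ?_).le (by rfl)
  simp [lookup, Prog.sem, WordOp.eval, Config.setReg, h.n_eq, h.q_eq, Nat.mod_eq_of_lt, a1, a2, a3,
    a4, a5, a6, hy24, hσ24, hτ24, tableAt]

/-- The outer loop performs the recursion of `scan` in registers `27` and `28`, the inner loop
computes one count in register `26`. The body `P` is abstract because the two sides of the game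
differ only in it. Since `β` is at most `1`, a count is at most `t` and cannot overflow. -/
theorem argmaxCount_run {w m n q t : ℕ} {s : Config} (h : Env w m n q t s) {P : Prog} {Tb : ℕ}
    (β : ℕ → ℕ → ℕ) (hβ : ∀ σ < q, ∀ k < t, β σ k ≤ 1)
    (hw : (P.writes 2 || P.writes 9 || P.writes 22 || P.writes 25 || P.writes 26 || P.writes 27 ||
      P.writes 28 || P.reads || P.stores 0) = false)
    (hP : ∀ s', Frame (argmaxCount P) s s' → s'.reg 22 < q → s'.reg 25 < t →
      Run w P s' Tb fun s'' => s''.reg 24 = β (s'.reg 22) (s'.reg 25)) (hq : q < 2 ^ w) :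
    Run w (argmaxCount P) s (q * (t * (Tb + 4) + 10) + 4) fun s' =>
      s'.reg 28 = (scan (fun σ => ∑ k ∈ Finset.range t, β σ k) q).1 := by
  simp only [Bool.or_eq_false_iff] at hw
  obtain ⟨⟨⟨⟨⟨⟨⟨⟨w2, w9⟩, w22⟩, w25⟩, w26⟩, w27⟩, w28⟩, -⟩, -⟩ := hw
  set c : ℕ → ℕ := fun σ => ∑ k ∈ Finset.range t, β σ k with hc
  have htw := h.t_lt
  refine Run.le (T := 1 + (1 + (q * (1 + (t * (Tb + 1 + 3) + 2 + 4) + 3) + 2)))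
    (Run.seq (Q' := fun s' => s'.reg 27 = 0) ((Run.straight rfl ?_).le le_rfl) fun s₁ h₁ hf₁ =>
    Run.seq (Q' := fun s' => s'.reg 27 = 0 ∧ s'.reg 28 = 0) ((Run.straight rfl ?_).le le_rfl)
    fun s₂ h₂ hf₂ => ?_) ?_
  · simp [Prog.sem, Config.setReg]
  · simp [Prog.sem, Config.setReg, h₁]
  · have hs₂ : ∀ x, x ≠ 27 → x ≠ 28 → s₂.reg x = s.reg x := fun x h1 h2 =>
      (hf₂.reg x (by simp [Prog.writes, h2])).trans (hf₁.reg x (by simp [Prog.writes, h1]))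
    have ha₂ : ∀ a, s₂.arr a = s.arr a := fun a => (hf₂.arr a rfl).trans (hf₁.arr a rfl)
    have ht₂ : s₂.tape = s.tape := (hf₂.tape rfl).trans (hf₁.tape rfl)
    refine (Run.forLt (fun k s' => s'.reg 27 = (scan c k).2 ∧ s'.reg 28 = (scan c k).1) q
      (1 + (t * (Tb + 1 + 3) + 2 + 4)) ?_ ?_ (by decide) (by decide) (by decide) hq ?_ ?_ ?_ ?_).mono
      le_rfl fun s' h' => h'.2
    · simp [Prog.writes, Prog.forLt, w22]
    · simp [Prog.writes, Prog.forLt, w2]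
    · rw [hs₂ 2 (by decide) (by decide), h.q_eq]
    · simpa [Config.setReg, scan] using h₂
    · rintro σ hσ s₃ hf₃ ⟨h27, h28⟩ h22
      have hF3 : ∀ x, x ≠ 27 → x ≠ 28 → x ≠ 22 → x ≠ 26 → x ≠ 25 → x ≠ 99 → P.writes x = false →
          s₃.reg x = s.reg x := fun x a b c d e f g =>
        (hf₃.reg x (by simp [Prog.writes, Prog.forLt, *])).trans (hs₂ x a b)
      refine Run.seq (Q' := fun s' => s'.reg 26 = 0) ((Run.straight rfl ?_).le le_rfl)
        fun s₄ h₄ hf₄ => Run.seq (Q' := fun s' => s'.reg 26 = c σ) ?_ fun s₅ h₅ hf₅ => ?_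
      · simp [Prog.sem, Config.setReg]
      · refine Run.forLt (fun k s' => s'.reg 26 = ∑ i ∈ Finset.range k, β σ i) t (Tb + 1) ?_ ?_
          (by decide) (by decide) (by decide) htw ?_ ?_ ?_ ?_
        · simp [Prog.writes, w25]
        · simp [Prog.writes, w9]
        · rw [hf₄.reg 9 rfl, hF3 9 (by decide) (by decide) (by decide) (by decide) (by decide)
            (by decide) w9, h.t_eq]
        · simpa [Config.setReg] using h₄
        · intro k hk s₆ hf₆ h₆ h25
          have h22' : s₆.reg 22 = σ := by
            rw [hf₆.reg 22 (by simp [Prog.writes, Prog.forLt, w22]), hf₄.reg 22 rfl, h22]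
          have hF : Frame (argmaxCount P) s s₆ := by
            refine ⟨fun x hx => ?_, fun a ha => ?_, fun hr => ?_⟩
            · simp [argmaxCount, Prog.writes, Prog.forLt] at hx
              rw [hf₆.reg x (by simp [Prog.writes, Prog.forLt, *]),
                hf₄.reg x (by simp [Prog.writes, *]), hF3 x] <;> simp [*]
            · simp [argmaxCount, Prog.stores, Prog.forLt] at ha
              rw [hf₆.arr a (by simp [Prog.stores, Prog.forLt, *]), hf₄.arr a rfl,
                hf₃.arr a (by simp [Prog.stores, Prog.forLt, *]), ha₂]
            · simp [argmaxCount, Prog.reads, Prog.forLt] at hr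
              rw [hf₆.tape (by simp [Prog.reads, Prog.forLt, *]), hf₄.tape rfl,
                hf₃.tape (by simp [Prog.reads, Prog.forLt, *]), ht₂]
          refine Run.seq (hP s₆ hF (by omega) (by omega)) fun s₇ h₇ hf₇ =>
            (Run.straight rfl ?_).le le_rfl
          have hb := hβ σ hσ k hk
          have hle : ∑ i ∈ Finset.range k, β σ i ≤ k :=
            (Finset.sum_le_card_nsmul _ _ 1 fun i hi =>
              hβ σ hσ i ((Finset.mem_range.mp hi).trans hk)).trans (by simp)
          have e : (∑ i ∈ Finset.range k, β σ i) + β σ k < 2 ^ w := by omega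
          have e26 : s₇.reg 26 = ∑ i ∈ Finset.range k, β σ i := (hf₇.reg 26 w26).trans h₆
          rw [h22', h25] at h₇
          simp [Prog.sem, Config.setReg, WordOp.eval, h₇, e26, Nat.mod_eq_of_lt e,
            Finset.sum_range_succ]
        · intro k s' v h'
          simpa [Config.setReg] using h'
      · have h27' : s₅.reg 27 = (scan c σ).2 := by
          rw [hf₅.reg 27 (by simp [Prog.writes, Prog.forLt, w27]), hf₄.reg 27 rfl, h27]
        have h28' : s₅.reg 28 = (scan c σ).1 := by
          rw [hf₅.reg 28 (by simp [Prog.writes, Prog.forLt, w28]), hf₄.reg 28 rfl, h28]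
        have h22' : s₅.reg 22 = σ := by
          rw [hf₅.reg 22 (by simp [Prog.writes, Prog.forLt, w22]), hf₄.reg 22 rfl, h22]
        refine (Run.straight rfl ?_).le le_rfl
        by_cases hlt : (scan c σ).2 < c σ <;>
          simp [Prog.sem, Config.setReg, scan, h27', h28', h22', h₅, hlt]
    · intro k s' v h'
      simpa [Config.setReg] using h'
  · apply le_of_eq
    ring

theorem Env.q_lt {w m n q t : ℕ} {s : Config} (h : Env w m n q t s) : q < 2 ^ w := by
  have h1 := h.table_lt
  have h2 : q ≤ m * n * q * q := Nat.le_mul_of_pos_left q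
    (Nat.mul_pos (Nat.mul_pos h.m_pos h.n_pos) h.q_pos)
  omega

/-- The samples starting at `jb` with the labels starting at `lb` are well-formed. -/
structure ArmOK (w m n q t jb lb : ℕ) (s : Config) : Prop where
  ys_lt : ∀ k < t, s.arr 4 (jb + k) < n
  xs_lt : ∀ k < t, s.arr 3 (jb + (t + k)) < m
  lab_lt : ∀ k < t, s.arr 5 (lb + k) < q
  jb_lt : jb + 2 * t < 2 ^ w
  lb_lt : lb + t < 2 ^ w

theorem ArmOK.frame {w m n q t jb lb : ℕ} {s s' : Config} {P : Prog}
    (h : ArmOK w m n q t jb lb s) (hf : Frame P s s')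
    (hw : (P.stores 3 || P.stores 4 || P.stores 5) = false) : ArmOK w m n q t jb lb s' := by
  simp only [Bool.or_eq_false_iff] at hw
  obtain ⟨⟨h3, h4⟩, h5⟩ := hw
  exact { h with
    ys_lt := by rw [hf.arr 4 h4]; exact h.ys_lt
    xs_lt := by rw [hf.arr 3 h3]; exact h.xs_lt
    lab_lt := by rw [hf.arr 5 h5]; exact h.lab_lt }

variable {w m n q t : ℕ} {s : Config}

theorem evalX_run (h : Env w m n q t s) {jb lb : ℕ} (hA : ArmOK w m n q t jb lb s)
    (hj : s.reg 29 = jb) (hl : s.reg 30 = lb) (hx : s.reg 20 < m) :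
    Run w evalX s (30 * (q * t)) fun s' =>
      s'.reg 28 = bestX (tableAt n q (s.arr 0)) q t (fun k => s.arr 4 (jb + k))
        (fun k => s.arr 5 (lb + k)) (s.reg 20) := by
  -- `11` is four instructions that fetch a sample vertex and its label, plus seven for the table
  -- lookup.
  refine Run.le (argmaxCount_run h (Tb := 11) (fun σ k => tableAt n q (s.arr 0) (s.reg 20)
    (s.arr 4 (jb + k)) σ (s.arr 5 (lb + k))) (fun σ _ k _ => h.table_le _) rfl ?_ h.q_lt) ?_
  · intro s₁ hf h22 h25
    have hE := h.frame hf rfl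
    have hA₁ := hA.frame hf rfl
    have e29 : s₁.reg 29 = jb := (hf.reg 29 rfl).trans hj
    have e30 : s₁.reg 30 = lb := (hf.reg 30 rfl).trans hl
    have e20 : s₁.reg 20 = s.reg 20 := hf.reg 20 rfl
    have j1 : jb + s₁.reg 25 < 2 ^ w := by have := hA.jb_lt; omega
    have j2 : lb + s₁.reg 25 < 2 ^ w := by have := hA.lb_lt; omega
    refine Run.seq (T₁ := 4) (T₂ := 7) (Q' := fun s' => s'.reg 20 = s.reg 20 ∧
      s'.reg 21 = s.arr 4 (jb + s₁.reg 25) ∧ s'.reg 22 = s₁.reg 22 ∧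
      s'.reg 23 = s.arr 5 (lb + s₁.reg 25)) ((Run.straight rfl ?_).le (by rfl)) fun s₂ h₂ hf₂ => ?_
    · simp [Prog.sem, Config.setReg, WordOp.eval, e29, e30, e20, Nat.mod_eq_of_lt, j1, j2,
        hf.arr 4 rfl, hf.arr 5 rfl]
    · obtain ⟨a20, a21, a22, a23⟩ := h₂
      refine (lookup_run (hE.frame hf₂ rfl) (by decide) (by decide) (by decide) (by omega)
        (a21 ▸ hA.ys_lt _ h25) (by omega) (a23 ▸ hA.lab_lt _ h25)).mono le_rfl fun s₃ h₃ => ?_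
      rw [h₃, a20, a21, a22, a23, hf₂.arr 0 rfl, hf.arr 0 rfl]
  · have : 1 ≤ q * t := Nat.mul_pos h.q_pos h.t_pos
    have : q ≤ q * t := Nat.le_mul_of_pos_right _ h.t_pos
    nlinarith

theorem evalY_run (h : Env w m n q t s) {jb lb : ℕ} (hA : ArmOK w m n q t jb lb s)
    (hj : s.reg 29 = jb) (hy : s.reg 21 < n) (h6 : ∀ k < t, s.arr 6 k < q) :
    Run w evalY s (30 * (q * t)) fun s' =>
      s'.reg 28 = bestY (tableAt n q (s.arr 0)) q t (fun k => s.arr 3 (jb + (t + k)))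
        (s.arr 6) (s.reg 21) := by
  refine Run.le (argmaxCount_run h (Tb := 11) (fun τ k => tableAt n q (s.arr 0)
    (s.arr 3 (jb + (t + k))) (s.reg 21) (s.arr 6 k) τ) (fun σ _ k _ => h.table_le _) rfl ?_
    h.q_lt) ?_
  · intro s₁ hf h22 h25
    have hE := h.frame hf rfl
    have e29 : s₁.reg 29 = jb := (hf.reg 29 rfl).trans hj
    have e21 : s₁.reg 21 = s.reg 21 := hf.reg 21 rfl
    have e9 := hE.t_eq
    have j1 : jb + t + s₁.reg 25 < 2 ^ w := by have := hA.jb_lt; omega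
    have j2 : jb + t < 2 ^ w := by have := hA.jb_lt; omega
    refine Run.seq (T₁ := 4) (T₂ := 7) (Q' := fun s' =>
      s'.reg 20 = s.arr 3 (jb + (t + s₁.reg 25)) ∧ s'.reg 21 = s.reg 21 ∧
      s'.reg 22 = s₁.reg 22 ∧ s'.reg 23 = s.arr 6 (s₁.reg 25)) ((Run.straight rfl ?_).le (by rfl))
      fun s₂ h₂ hf₂ => ?_
    · simp [Prog.sem, Config.setReg, WordOp.eval, e29, e21, e9, Nat.mod_eq_of_lt, j2,
        hf.arr 3 rfl, hf.arr 6 rfl, add_assoc]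
      simp [← add_assoc, Nat.mod_eq_of_lt, j1]
    · obtain ⟨a20, a21, a22, a23⟩ := h₂
      refine (lookup_run (hE.frame hf₂ rfl) (by decide) (by decide) (by decide)
        (a20 ▸ hA.xs_lt _ h25) (by omega) (a23 ▸ h6 _ h25) (by omega)).mono le_rfl fun s₃ h₃ => ?_
      rw [h₃, a20, a21, a22, a23, hf₂.arr 0 rfl, hf.arr 0 rfl]
  · have : 1 ≤ q * t := Nat.mul_pos h.q_pos h.t_pos
    have : q ≤ q * t := Nat.le_mul_of_pos_right _ h.t_pos
    nlinarith

theorem prepare_run (h : Env w m n q t s) {jb lb : ℕ} (hA : ArmOK w m n q t jb lb s)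
    (hj : s.reg 29 = jb) (hl : s.reg 30 = lb) :
    Run w prepare s (40 * (q * t * t)) fun s' => ∀ k < t,
      s'.arr 6 k = bestX (tableAt n q (s.arr 0)) q t (fun k => s.arr 4 (jb + k))
        (fun k => s.arr 5 (lb + k)) (s.arr 3 (jb + (t + k))) := by
  refine Run.le (Run.forLt (fun i s' => ∀ k < i,
      s'.arr 6 k = bestX (tableAt n q (s.arr 0)) q t (fun k => s.arr 4 (jb + k))
        (fun k => s.arr 5 (lb + k)) (s.arr 3 (jb + (t + k)))) t (3 + (30 * (q * t) + 1)) rfl rfl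
        (by decide) (by decide) (by decide) h.t_lt h.t_eq (by simp) ?_ ?_) ?_
  · intro i hi s₁ hf h₁ h34
    have hE := h.frame hf rfl
    have hA₁ := hA.frame hf rfl
    have e29 : s₁.reg 29 = jb := (hf.reg 29 rfl).trans hj
    have e30 : s₁.reg 30 = lb := (hf.reg 30 rfl).trans hl
    have e9 := hE.t_eq
    have j1 : jb + t + i < 2 ^ w := by have := hA.jb_lt; omega
    have j2 : jb + t < 2 ^ w := by have := hA.jb_lt; omega
    refine Run.seq (T₁ := 3) (Q' := fun s' => s'.reg 20 = s.arr 3 (jb + (t + i)))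
      ((Run.straight rfl ?_).le (by rfl)) fun s₂ h₂ hf₂ => ?_
    · simp [Prog.sem, Config.setReg, WordOp.eval, e29, e9, Nat.mod_eq_of_lt, j2, h34,
        hf.arr 3 rfl, add_assoc]
      simp [← add_assoc, Nat.mod_eq_of_lt, j1]
    · refine Run.seq (evalX_run (hE.frame hf₂ rfl) (hA₁.frame hf₂ rfl)
        ((hf₂.reg 29 rfl).trans e29) ((hf₂.reg 30 rfl).trans e30) (h₂ ▸ hA.xs_lt _ hi))
        fun s₃ h₃ hf₃ => (Run.straight rfl ?_).le (by rfl)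
      intro k hk
      have e34 : s₃.reg 34 = i := by rw [hf₃.reg 34 rfl, hf₂.reg 34 rfl, h34]
      rw [h₂, hf₂.arr 0 rfl, hf₂.arr 4 rfl, hf₂.arr 5 rfl, hf.arr 0 rfl, hf.arr 4 rfl,
        hf.arr 5 rfl] at h₃
      rcases Nat.lt_succ_iff_lt_or_eq.mp hk with hk | rfl
      · simp [Prog.sem, Config.setArr, e34, hk.ne]
        rw [hf₃.arr 6 rfl, hf₂.arr 6 rfl, h₁ k hk]
      · simp [Prog.sem, Config.setArr, e34, h₃]
  · intro k s' v h'
    simpa [Config.setReg] using h'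
  · have h1 : 1 ≤ q * t := Nat.mul_pos h.q_pos h.t_pos
    have : t ≤ q * t * t := Nat.le_mul_of_pos_left _ h1
    have : 1 ≤ t := h.t_pos
    nlinarith

/-- Array `6` caches the induced labels of the first-side sample (`h6`); thanks to it an edge is
tested in time `O(q t)` instead of `O(q t²)`. -/
theorem testEdge_run (h : Env w m n q t s) {jb lb : ℕ} (hA : ArmOK w m n q t jb lb s)
    (hj : s.reg 29 = jb) (hl : s.reg 30 = lb) (hx : s.reg 35 < m) (hy : s.reg 36 < n)
    (h6 : ∀ k < t, s.arr 6 k = bestX (tableAt n q (s.arr 0)) q t (fun k => s.arr 4 (jb + k))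
        (fun k => s.arr 5 (lb + k)) (s.arr 3 (jb + (t + k)))) :
    Run w testEdge s (70 * (q * t)) fun s' =>
      s'.reg 24 = hit (tableAt n q (s.arr 0)) q t (fun k => s.arr 4 (jb + k))
        (fun k => s.arr 5 (lb + k)) (fun k => s.arr 3 (jb + (t + k))) (s.reg 35) (s.reg 36) := by
  refine Run.le (T := 1 + (30 * (q * t) + (2 + (30 * (q * t) + 7)))) (Run.seq
    (Q' := fun s' => s'.reg 20 = s.reg 35) ((Run.straight rfl ?_).le (by rfl))
    fun s₁ h₁ hf₁ => ?_) ?_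
  · simp [Prog.sem, Config.setReg]
  · have hE₁ := h.frame hf₁ rfl
    have hA₁ := hA.frame hf₁ rfl
    refine Run.seq (evalX_run hE₁ hA₁ ((hf₁.reg 29 rfl).trans hj)
      ((hf₁.reg 30 rfl).trans hl) (by omega)) fun s₂ h₂ hf₂ => ?_
    have hE₂ := hE₁.frame hf₂ rfl
    have hA₂ := hA₁.frame hf₂ rfl
    simp only [h₁, hf₁.arr 0 rfl, hf₁.arr 4 rfl, hf₁.arr 5 rfl] at h₂
    refine Run.seq (Q' := fun s' => s'.reg 37 = s₂.reg 28 ∧ s'.reg 21 = s.reg 36)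
      ((Run.straight rfl ?_).le (by rfl)) fun s₃ h₃ hf₃ => ?_
    · simp [Prog.sem, Config.setReg]
      rw [hf₂.reg 36 rfl, hf₁.reg 36 rfl]
    have hE₃ := hE₂.frame hf₃ rfl
    have hA₃ := hA₂.frame hf₃ rfl
    obtain ⟨e37, e21⟩ := h₃
    have e6 : s₃.arr 6 = s.arr 6 := by rw [hf₃.arr 6 rfl, hf₂.arr 6 rfl, hf₁.arr 6 rfl]
    have e3 : s₃.arr 3 = s.arr 3 := by rw [hf₃.arr 3 rfl, hf₂.arr 3 rfl, hf₁.arr 3 rfl]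
    have e0 : s₃.arr 0 = s.arr 0 := by rw [hf₃.arr 0 rfl, hf₂.arr 0 rfl, hf₁.arr 0 rfl]
    refine Run.seq (evalY_run hE₃ hA₃ (by
      rw [hf₃.reg 29 rfl, hf₂.reg 29 rfl, hf₁.reg 29 rfl, hj]) (by omega)
      (fun k hk => by rw [e6, h6 k hk]; exact bestX_lt h.q_pos _ _ _)) fun s₄ h₄ hf₄ => ?_
    rw [e21, e6, e3, e0] at h₄
    have h28 : s₄.reg 28 = respY (tableAt n q (s.arr 0)) q t (fun k => s.arr 4 (jb + k))
        (fun k => s.arr 5 (lb + k)) (fun k => s.arr 3 (jb + (t + k))) (s.reg 36) :=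
      h₄.trans (bestY_congr (fun _ _ => rfl) h6 _)
    have e35 : s₄.reg 35 = s.reg 35 := by
      rw [hf₄.reg 35 rfl, hf₃.reg 35 rfl, hf₂.reg 35 rfl, hf₁.reg 35 rfl]
    have e36 : s₄.reg 36 = s.reg 36 := by
      rw [hf₄.reg 36 rfl, hf₃.reg 36 rfl, hf₂.reg 36 rfl, hf₁.reg 36 rfl]
    have e37' : s₄.reg 37 = s₂.reg 28 := by rw [hf₄.reg 37 rfl, e37]
    refine (lookup_run (hE₃.frame hf₄ rfl) (by decide) (by decide) (by decide) (by omega) (by omega)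
      (by rw [e37', h₂]; exact bestX_lt h.q_pos _ _ _)
      (by rw [h28]; exact respY_lt h.q_pos _ _ _ _)).mono le_rfl fun s₅ h₅ => ?_
    rw [h₅, e35, e36, e37', h₂, h28, hf₄.arr 0 rfl, e0, hit]
  · have : 1 ≤ q * t := Nat.mul_pos h.q_pos h.t_pos
    omega

theorem scoreProg_run (h : Env w m n q t s) {jb lb S : ℕ} (hA : ArmOK w m n q t jb lb s)
    (hj : s.reg 29 = jb) (hl : s.reg 30 = lb) (hS : s.reg 32 = S) (hSw : S < 2 ^ w)
    (hx : ∀ k < S, s.arr 7 k < m) (hy : ∀ k < S, s.arr 8 k < n) :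
    Run w scoreProg s (80 * (q * t * (t + S))) fun s' =>
      s'.reg 33 = score (tableAt n q (s.arr 0)) q t (fun k => s.arr 4 (jb + k))
        (fun k => s.arr 5 (lb + k)) (fun k => s.arr 3 (jb + (t + k))) (s.arr 7) (s.arr 8) S := by
  have hle : ∀ x y σ τ, tableAt n q (s.arr 0) x y σ τ ≤ 1 := fun _ _ _ _ => h.table_le _
  refine Run.le (T := 40 * (q * t * t) + (1 + (S * ((2 + (70 * (q * t) + 1)) + 3) + 2))) (Run.seq
    (prepare_run h hA hj hl) fun s₁ h₁ hf₁ => Run.seq (Q' := fun s' => s'.reg 33 = 0)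
    ((Run.straight rfl ?_).le (by rfl)) fun s₂ h₂ hf₂ => ?_) ?_
  · simp [Prog.sem, Config.setReg]
  · refine Run.forLt (fun i s' => s'.reg 33 = score (tableAt n q (s.arr 0)) q t
      (fun k => s.arr 4 (jb + k)) (fun k => s.arr 5 (lb + k)) (fun k => s.arr 3 (jb + (t + k)))
      (s.arr 7) (s.arr 8) i) S _ rfl rfl (by decide) (by decide) (by decide) hSw
      (by rw [hf₂.reg 32 rfl, hf₁.reg 32 rfl, hS]) (by simpa [Config.setReg, score] using h₂) ?_ ?_
    · intro k hk s₃ hf₃ h₃ h31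
      have hE₃ := ((h.frame hf₁ rfl).frame hf₂ rfl).frame hf₃ rfl
      have hA₃ := ((hA.frame hf₁ rfl).frame hf₂ rfl).frame hf₃ rfl
      refine Run.seq (Q' := fun s' => s'.reg 35 = s.arr 7 k ∧ s'.reg 36 = s.arr 8 k)
        ((Run.straight rfl ?_).le (by rfl)) fun s₄ h₄ hf₄ => ?_
      · simp [Prog.sem, Config.setReg, h31]
        rw [hf₃.arr 7 rfl, hf₂.arr 7 rfl, hf₁.arr 7 rfl, hf₃.arr 8 rfl, hf₂.arr 8 rfl,
          hf₁.arr 8 rfl]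
        exact ⟨rfl, rfl⟩
      · have e0 : s₄.arr 0 = s.arr 0 := by
          rw [hf₄.arr 0 rfl, hf₃.arr 0 rfl, hf₂.arr 0 rfl, hf₁.arr 0 rfl]
        have e3 : s₄.arr 3 = s.arr 3 := by
          rw [hf₄.arr 3 rfl, hf₃.arr 3 rfl, hf₂.arr 3 rfl, hf₁.arr 3 rfl]
        have e4 : s₄.arr 4 = s.arr 4 := by
          rw [hf₄.arr 4 rfl, hf₃.arr 4 rfl, hf₂.arr 4 rfl, hf₁.arr 4 rfl]
        have e5 : s₄.arr 5 = s.arr 5 := by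
          rw [hf₄.arr 5 rfl, hf₃.arr 5 rfl, hf₂.arr 5 rfl, hf₁.arr 5 rfl]
        have e6 : s₄.arr 6 = s₁.arr 6 := by rw [hf₄.arr 6 rfl, hf₃.arr 6 rfl, hf₂.arr 6 rfl]
        refine Run.seq (testEdge_run (hE₃.frame hf₄ rfl) (hA₃.frame hf₄ rfl) (jb := jb) (lb := lb)
          (by rw [hf₄.reg 29 rfl, hf₃.reg 29 rfl, hf₂.reg 29 rfl, hf₁.reg 29 rfl, hj])
          (by rw [hf₄.reg 30 rfl, hf₃.reg 30 rfl, hf₂.reg 30 rfl, hf₁.reg 30 rfl, hl])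
          (h₄.1 ▸ hx k hk) (h₄.2 ▸ hy k hk) (by rw [e0, e3, e4, e5, e6]; exact h₁))
          fun s₅ h₅ hf₅ => (Run.straight rfl ?_).le (by rfl)
        rw [e0, e3, e4, e5, h₄.1, h₄.2] at h₅
        have e33 : s₅.reg 33 = score (tableAt n q (s.arr 0)) q t (fun k => s.arr 4 (jb + k))
            (fun k => s.arr 5 (lb + k)) (fun k => s.arr 3 (jb + (t + k))) (s.arr 7) (s.arr 8) k := by
          rw [hf₅.reg 33 rfl, hf₄.reg 33 rfl, h₃]
        have b1 := score_le (q := q) (t := t) hle (fun k => s.arr 4 (jb + k))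
          (fun k => s.arr 5 (lb + k)) (fun k => s.arr 3 (jb + (t + k))) (s.arr 7) (s.arr 8) k
        have b2 := hit_le (q := q) (t := t) hle (fun k => s.arr 4 (jb + k))
          (fun k => s.arr 5 (lb + k)) (fun k => s.arr 3 (jb + (t + k))) (s.arr 7 k) (s.arr 8 k)
        simp [Prog.sem, Config.setReg, WordOp.eval, h₅, e33]
        rw [Nat.mod_eq_of_lt (by omega), score, score, Finset.sum_range_succ]
    · intro k s' v h'
      simpa [Config.setReg] using h'
  · have h1 : 1 ≤ q * t := Nat.mul_pos h.q_pos h.t_pos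
    have : t ≤ q * t * t := Nat.le_mul_of_pos_left _ h1
    have : S ≤ q * t * S := Nat.le_mul_of_pos_left _ h1
    have : 1 ≤ t := h.t_pos
    nlinarith

/-! ## The program: reading random edges -/

/-- The number whose binary digits are the first `b` bits of the tape. -/
def bitsVal (τ : List Bool) : ℕ → ℕ
  | 0 => 0
  | b + 1 => 2 * bitsVal τ b + (τ.getD b false).toNat

theorem bitsVal_lt (τ : List Bool) (b : ℕ) : bitsVal τ b < 2 ^ b := by
  induction b with
  | zero => simp [bitsVal]
  | succ b ih =>
    have := Bool.toNat_le (τ.getD b false)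
    rw [bitsVal, pow_succ]
    omega

/-- The random edge number `i` of a tape, made of two numbers of `b` bits. -/
def itemAt (b m n : ℕ) (τ : List Bool) (i : ℕ) : ℕ × ℕ :=
  (bitsVal (τ.drop (i * (2 * b))) b % m, bitsVal (τ.drop (i * (2 * b) + b)) b % n)

/-- Read a number below register `10`, a power of two, into register `x`. -/
def readNum (x : ℕ) : Prog :=
  .seq (.seq (.const x 0) (.const 40 1)) <| .whileLt 40 10 <|
    .seq (.bit 41) <| .seq (.arith .plus x x x) <| .seq (.arith .plus x x 41) (.arith .plus 40 40 40)

/-- Read random edges (as many as register `cnt` says) into the arrays `ax`, `ay`, starting at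
the address in register `45`. -/
def readItems (ax ay cnt : ℕ) : Prog :=
  .forLt 44 cnt <|
    .seq (readNum 43) <|
    .seq (.seq (.arith .plus 42 45 44) <| .seq (.arith .rem 43 43 0) (.store ax 42 43)) <|
    .seq (readNum 43) <|
    .seq (.arith .rem 43 43 1) (.store ay 42 43)

/-- Register `40` runs through the powers of two up to `2 ^ b`, so the comparison with register `10`
counts exactly `b` bits without using `b` itself. -/
theorem readNum_run {w b : ℕ} {s : Config} (hU : s.reg 10 = 2 ^ b) (hb : 2 ^ b < 2 ^ w) :
    Run w (readNum 43) s (5 * b + 3) fun s' =>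
      s'.reg 43 = bitsVal s.tape b ∧ s'.tape = s.tape.drop b := by
  have h1 : 1 % 2 ^ w = 1 := Nat.mod_eq_of_lt (by have := Nat.one_le_two_pow (n := b); omega)
  refine Run.le (T := 2 + (b * (4 + 1) + 1)) (Run.seq
    (Q' := fun s' => s'.reg 43 = 0 ∧ s'.reg 40 = 1) ((Run.straight rfl ?_).le (by rfl))
    fun s₁ h₁ hf₁ => ?_) (by omega)
  · simp [Prog.sem, Config.setReg, h1]
  · refine (Run.whileLt (fun k s' => s'.reg 40 = 2 ^ k ∧ s'.reg 43 = bitsVal s.tape k ∧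
      s'.tape = s.tape.drop k) b 4 ?_ ?_ ?_).mono le_rfl fun s' h => h.2
    · simpa [h₁.2, bitsVal, h₁.1] using hf₁.tape rfl
    · rintro k hk s₂ hf₂ ⟨h40, h43, htp⟩
      have e10 : s₂.reg 10 = 2 ^ b := by rw [hf₂.reg 10 rfl, hf₁.reg 10 rfl, hU]
      have hlt : 2 ^ (k + 1) ≤ 2 ^ b := Nat.pow_le_pow_right (by decide) hk
      have hv := bitsVal_lt s.tape (k + 1)
      have hp : 2 ^ (k + 1) = 2 ^ k + 2 ^ k := by ring
      have h2 : 2 ≤ 2 ^ b := le_trans (by have := Nat.one_le_two_pow (n := k); omega) hlt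
      refine ⟨by have := Nat.one_le_two_pow (n := k); omega, (Run.straight rfl ?_).le (by rfl)⟩
      have hhd : (s.tape.drop k).headD false = s.tape.getD k false := by
        rw [List.headD_eq_head?_getD, List.head?_drop, List.getD_eq_getElem?_getD]
      have hbit := Bool.toNat_le (s.tape.getD k false)
      rw [bitsVal] at hv
      have e1 : (s.tape.getD k false).toNat % 2 ^ w = (s.tape.getD k false).toNat :=
        Nat.mod_eq_of_lt (by omega)
      have e2 : (bitsVal s.tape k + bitsVal s.tape k) % 2 ^ w = 2 * bitsVal s.tape k := by
        rw [Nat.mod_eq_of_lt (by omega), two_mul]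
      have e3 : (2 ^ k + 2 ^ k) % 2 ^ w = 2 ^ (k + 1) := by
        rw [Nat.mod_eq_of_lt (by omega), hp]
      simp only [Prog.sem, Config.setReg, WordOp.eval, htp, hhd]
      simp only [Function.update_apply]
      simp only [Nat.reduceEqDiff, ↓reduceIte, h40, h43, e1, e2, e3]
      refine ⟨by simp, ?_, by simp⟩
      rw [Nat.mod_eq_of_lt (by omega), bitsVal]
    · rintro s₂ hf₂ ⟨h40, -⟩
      rw [h40, hf₂.reg 10 rfl, hf₁.reg 10 rfl, hU]
      simp

/-- An item consumes `2 * b` bits, and `i₀` counts the items consumed before. That cells below the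
base address survive is what allows the samples of successive groups to be appended to the same
arrays. -/
theorem readItems_run {w m n b c i₀ : ℕ} {s : Config} {τ : List Bool} {ax ay cnt : ℕ}
    (hc43 : cnt ≠ 43) (hc40 : cnt ≠ 40) (hc41 : cnt ≠ 41) (hc42 : cnt ≠ 42) (hc44 : cnt ≠ 44)
    (hc99 : cnt ≠ 99) (hax : ax ≠ ay)
    (hm : s.reg 0 = m) (hn : s.reg 1 = n) (hm0 : 0 < m) (hn0 : 0 < n) (hmw : m < 2 ^ w)
    (hnw : n < 2 ^ w) (hU : s.reg 10 = 2 ^ b)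
    (hb0 : 0 < b) (hb : 2 ^ b < 2 ^ w) (hc : s.reg cnt = c) (hbase : s.reg 45 + c < 2 ^ w)
    (hτ : s.tape = τ.drop (i₀ * (2 * b))) :
    Run w (readItems ax ay cnt) s (24 * (b * c) + 2) fun s' =>
      (∀ k < c, s'.arr ax (s.reg 45 + k) = (itemAt b m n τ (i₀ + k)).1 ∧
        s'.arr ay (s.reg 45 + k) = (itemAt b m n τ (i₀ + k)).2) ∧
      (∀ i < s.reg 45, s'.arr ax i = s.arr ax i ∧ s'.arr ay i = s.arr ay i) ∧
      s'.tape = τ.drop ((i₀ + c) * (2 * b)) := by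
  have hax' := hax.symm
  refine Run.le (T := c * ((5 * b + 3 + (3 + (5 * b + 3 + 2))) + 3) + 2) (Run.forLt (fun j s' =>
      (∀ k < j, s'.arr ax (s.reg 45 + k) = (itemAt b m n τ (i₀ + k)).1 ∧
        s'.arr ay (s.reg 45 + k) = (itemAt b m n τ (i₀ + k)).2) ∧
      (∀ i < s.reg 45, s'.arr ax i = s.arr ax i ∧ s'.arr ay i = s.arr ay i) ∧
      s'.tape = τ.drop ((i₀ + j) * (2 * b))) c _ rfl ?_ hc44 hc99 (by decide) (by omega) hc ?_
      ?_ ?_) ?_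
  · simp [Prog.writes, readNum, hc43, hc40, hc41, hc42]
  · refine ⟨by simp, by simp [Config.setReg], by simpa [Config.setReg] using hτ⟩
  · rintro j hj s₁ hf₁ ⟨h₁, h₁', htp₁⟩ h44
    have e0 : s₁.reg 0 = m := (hf₁.reg 0 rfl).trans hm
    have e1 : s₁.reg 1 = n := (hf₁.reg 1 rfl).trans hn
    have e10 : s₁.reg 10 = 2 ^ b := (hf₁.reg 10 rfl).trans hU
    have e45 : s₁.reg 45 = s.reg 45 := hf₁.reg 45 rfl
    refine Run.seq (readNum_run e10 hb) fun s₂ h₂ hf₂ => ?_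
    refine Run.seq (Q' := fun s' => s'.reg 42 = s.reg 45 + j ∧
      s'.arr ax = Function.update (s₁.arr ax) (s.reg 45 + j) (itemAt b m n τ (i₀ + j)).1 ∧
      (∀ a, a ≠ ax → s'.arr a = s₁.arr a) ∧ s'.tape = s₂.tape)
      ((Run.straight rfl ?_).le (by rfl)) fun s₃ h₃ hf₃ => ?_
    · have hmod : bitsVal s₁.tape b % m < m := Nat.mod_lt _ hm0
      have r1 : s₂.reg 45 + s₂.reg 44 = s.reg 45 + j := by
        rw [hf₂.reg 45 rfl, hf₂.reg 44 rfl, h44, e45]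
      have r2 : (s.reg 45 + j) % 2 ^ w = s.reg 45 + j := Nat.mod_eq_of_lt (by omega)
      have r3 : bitsVal s₁.tape b % m % 2 ^ w = (itemAt b m n τ (i₀ + j)).1 := by
        rw [Nat.mod_eq_of_lt (by omega), itemAt, htp₁]
      simp [Prog.sem, Config.setReg, Config.setArr, WordOp.eval, r1, r2, h₂.1, hf₂.reg 0 rfl, e0,
        r3, hf₂.arr ax rfl]
      intro a ha
      rw [Function.update_of_ne ha, hf₂.arr a rfl]
    obtain ⟨e42, eax, eaa, etp⟩ := h₃
    refine Run.seq (readNum_run (by rw [hf₃.reg 10 rfl, hf₂.reg 10 rfl, e10]) hb)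
      fun s₄ h₄ hf₄ => (Run.straight rfl ?_).le (by rfl)
    have htp₄ : s₃.tape = τ.drop ((i₀ + j) * (2 * b) + b) := by
      rw [etp, h₂.2, htp₁, List.drop_drop]
    have hmod : bitsVal s₃.tape b % n < n := Nat.mod_lt _ hn0
    have r3 : bitsVal s₃.tape b % n % 2 ^ w = (itemAt b m n τ (i₀ + j)).2 := by
      rw [Nat.mod_eq_of_lt (by omega), itemAt, htp₄]
    have r1 : s₄.reg 1 = n := by rw [hf₄.reg 1 rfl, hf₃.reg 1 rfl, hf₂.reg 1 rfl, e1]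
    have r42 : s₄.reg 42 = s.reg 45 + j := by rw [hf₄.reg 42 rfl, e42]
    have hA : (Prog.sem w ((Prog.arith .rem 43 43 1).seq (.store ay 42 43)) s₄).arr =
        Function.update (Function.update s₁.arr ax (Function.update (s₁.arr ax) (s.reg 45 + j)
          (itemAt b m n τ (i₀ + j)).1)) ay (Function.update (s₁.arr ay) (s.reg 45 + j)
          (itemAt b m n τ (i₀ + j)).2) := by
      have hs4 : s₄.arr = Function.update s₁.arr ax (Function.update (s₁.arr ax) (s.reg 45 + j)
          (itemAt b m n τ (i₀ + j)).1) := by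
        funext a
        rw [hf₄.arr a rfl]
        rcases eq_or_ne a ax with rfl | ha
        · simp [eax]
        · simp [ha, eaa a ha]
      simp [Prog.sem, Config.setReg, Config.setArr, WordOp.eval, h₄.1, r1, r3, r42, hs4, hax']
    refine ⟨?_, ?_, ?_⟩
    · intro k hk
      rw [hA]
      rcases Nat.lt_succ_iff_lt_or_eq.mp hk with hk | rfl
      · simp [hax, hk.ne, h₁ k hk]
      · simp [hax]
    · intro i hi
      rw [hA]
      have : i ≠ s.reg 45 + j := by omega
      simp [hax, this, h₁' i hi]
    · simp only [Prog.sem, Config.setReg, Config.setArr]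
      rw [h₄.2, htp₄, List.drop_drop]
      congr 1
      ring
  · rintro k s' v ⟨h, h', h''⟩
    exact ⟨by simpa [Config.setReg] using h, by simpa [Config.setReg] using h',
      by simpa [Config.setReg] using h''⟩
  · nlinarith

/-! ## The program: choosing the labels of the samples -/

/-- The hypothesis characterizes the carry `c` into place `k` without recursion: it is the increment
of the quotient by `q ^ k`. It is thus the loop invariant of the ripple-carry addition, equal to `1`
at place `0`. -/
theorem digit_add_carry {q a k c : ℕ} (hq : 0 < q) (h : a / q ^ k + c = (a + 1) / q ^ k) :
    (digit q a k + c) % q = digit q (a + 1) k ∧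
      a / q ^ (k + 1) + (digit q a k + c) / q = (a + 1) / q ^ (k + 1) := by
  have e : a / q ^ k + c = q * (a / q ^ k / q) + (digit q a k + c) := by
    have := Nat.div_add_mod (a / q ^ k) q
    unfold digit
    omega
  constructor
  · rw [digit, Nat.mod_add_mod, h, digit]
  · rw [pow_succ, ← Nat.div_div_eq_div_mul, ← Nat.div_div_eq_div_mul, ← h, e,
      Nat.mul_add_div hq]

theorem carry_le_one {d a c : ℕ} (hd : 0 < d) (h : a / d + c = (a + 1) / d) : c ≤ 1 := by
  have : (a + 1) / d ≤ (a + d) / d := Nat.div_le_div_right (by omega)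
  rw [Nat.add_div_right _ hd] at this
  omega

/-- Increase the counter in array `5` by one; the carry is left in register `49`. -/
def increment : Prog :=
  .seq (.copy 49 7) <| .forLt 50 9 <|
    .seq (.load 51 5 50) <| .seq (.arith .plus 51 51 49) <| .seq (.arith .quot 49 51 2) <|
    .seq (.arith .rem 51 51 2) (.store 5 50 51)

/-- Copy the counter to the address in register `47`. -/
def copyLab : Prog :=
  .forLt 50 9 <| .seq (.load 51 5 50) <| .seq (.arith .plus 52 47 50) (.store 5 52 51)

/-- Enumerate all labelings of the current sample and store the one of largest score at the
address in register `47`. -/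
def enumerate : Prog :=
  .seq (.seq (.const 48 0) (.const 49 0)) <| .whileLt 49 7 <|
    .seq scoreProg <| .seq (.ifLt 48 33 (.seq (.copy 48 33) copyLab) .skip) increment

variable {w m n q t : ℕ} {s : Config}

/-- The outgoing carry `(a + 1) / q ^ t` is nonzero only when the counter overflows, that is, after
the last labeling; the enumeration loop stops on it. -/
theorem increment_run (h : Env w m n q t s) {a : ℕ} (ha : ∀ k < t, s.arr 5 k = digit q a k)
    (hat : a < q ^ t) :
    Run w increment s (8 * t + 3) fun s' => (∀ k < t, s'.arr 5 k = digit q (a + 1) k) ∧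
      (∀ i, t ≤ i → s'.arr 5 i = s.arr 5 i) ∧ s'.reg 49 = (a + 1) / q ^ t := by
  have hq := h.q_pos
  have hqw := h.q_lt
  refine Run.le (T := 1 + (t * (5 + 3) + 2)) (Run.seq (Q' := fun s' => s'.reg 49 = 1)
    ((Run.straight rfl ?_).le (by rfl)) fun s₁ h₁ hf₁ => ?_) (by omega)
  · simp [Prog.sem, Config.setReg, h.one_eq]
  · refine (Run.forLt (fun i s' => (∀ k < i, s'.arr 5 k = digit q (a + 1) k) ∧
      (∀ k, i ≤ k → s'.arr 5 k = s.arr 5 k) ∧ a / q ^ i + s'.reg 49 = (a + 1) / q ^ i) t 5 rfl rfl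
      (by decide) (by decide) (by decide) h.t_lt (by rw [hf₁.reg 9 rfl, h.t_eq]) ?_ ?_ ?_).mono
      le_rfl ?_
    · refine ⟨by simp, ?_, by simp [Config.setReg, h₁]⟩
      intro k _
      simp [Config.setReg, hf₁.arr 5 rfl]
    · rintro i hi s₂ hf₂ ⟨h₂, h₂', hc⟩ h50
      refine (Run.straight rfl ?_).le (by rfl)
      have c1 := carry_le_one (pow_pos hq _) hc
      obtain ⟨d1, d2⟩ := digit_add_carry hq hc
      have dl := digit_lt hq a i
      have dl' := digit_lt hq (a + 1) i
      have e5 : s₂.arr 5 i = digit q a i := by rw [h₂' i le_rfl, ha i hi]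
      have e2 : s₂.reg 2 = q := by rw [hf₂.reg 2 rfl, hf₁.reg 2 rfl, h.q_eq]
      have m1 : (digit q a i + s₂.reg 49) % 2 ^ w = digit q a i + s₂.reg 49 :=
        Nat.mod_eq_of_lt (by omega)
      have m2 : (digit q a i + s₂.reg 49) / q % 2 ^ w = (digit q a i + s₂.reg 49) / q :=
        Nat.mod_eq_of_lt (lt_of_le_of_lt (Nat.div_le_self _ _) (by omega))
      have m3 : digit q (a + 1) i % 2 ^ w = digit q (a + 1) i := Nat.mod_eq_of_lt (by omega)
      simp only [Prog.sem, Config.setReg, Config.setArr, WordOp.eval, Function.update_apply]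
      simp only [Nat.reduceEqDiff, ↓reduceIte, h50, e5, e2, m1, m2, d1, m3, d2, and_true]
      refine ⟨fun k hk => ?_, fun k hk => ?_⟩
      · rcases Nat.lt_succ_iff_lt_or_eq.mp hk with hk | rfl
        · rw [Function.update_of_ne hk.ne, h₂ k hk]
        · simp
      · rw [Function.update_of_ne (by omega), h₂' k (by omega)]
    · rintro k s' v h'
      simpa [Config.setReg] using h'
    · rintro s' ⟨h', h'', h'''⟩
      refine ⟨h', h'', ?_⟩
      rwa [Nat.div_eq_of_lt hat, zero_add] at h'''

theorem copyLab_run (h : Env w m n q t s) {l : ℕ} (hl : s.reg 47 = l) (htl : t ≤ l)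
    (hlw : l + t < 2 ^ w) :
    Run w copyLab s (6 * t + 2) fun s' => (∀ k < t, s'.arr 5 (l + k) = s.arr 5 k) ∧
      (∀ i, i < l ∨ l + t ≤ i → s'.arr 5 i = s.arr 5 i) := by
  refine (Run.forLt (fun i s' => (∀ k < i, s'.arr 5 (l + k) = s.arr 5 k) ∧
      (∀ k, k < l ∨ l + i ≤ k → s'.arr 5 k = s.arr 5 k)) t 3 rfl rfl
      (by decide) (by decide) (by decide) h.t_lt h.t_eq ?_ ?_ ?_).mono (by omega) fun s' h' => h'
  · simp [Config.setReg]
  · rintro i hi s₂ hf₂ ⟨h₂, h₂'⟩ h50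
    refine (Run.straight rfl ?_).le (by rfl)
    have e47 : s₂.reg 47 = l := (hf₂.reg 47 rfl).trans hl
    have m1 : (l + i) % 2 ^ w = l + i := Nat.mod_eq_of_lt (by omega)
    simp only [Prog.sem, Config.setReg, Config.setArr, WordOp.eval, Function.update_apply]
    simp only [Nat.reduceEqDiff, ↓reduceIte, h50, e47, m1]
    refine ⟨fun k hk => ?_, fun k hk => ?_⟩
    · rcases Nat.lt_succ_iff_lt_or_eq.mp hk with hk | rfl
      · rw [Function.update_of_ne (by omega), h₂ k hk]
      · rw [Function.update_self, h₂' _ (by omega)]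
    · rw [Function.update_of_ne (by omega), h₂' k (by omega)]
  · rintro k s' v h'
    simpa [Config.setReg] using h'

theorem digit_zero (q k : ℕ) : digit q 0 k = 0 := by simp [digit]

/-- The overflowing counter is zero again, so the next group finds it initialized. -/
theorem digit_pow {q t k : ℕ} (hq : 0 < q) (hk : k < t) : digit q (q ^ t) k = 0 := by
  obtain ⟨d, rfl⟩ := Nat.exists_eq_add_of_lt hk
  rw [digit, show q ^ (k + d + 1) = q ^ k * (q ^ d * q) by ring,
    Nat.mul_div_cancel_left _ (pow_pos hq k), Nat.mul_mod_left]

/-- The loop carries out `scan` on the scores. The target cells must be zero at the start (`hl0`),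
because if every score is `0` nothing is ever copied, and the winner is then labeling number `0`,
whose digits all vanish. -/
theorem enumerate_run (h : Env w m n q t s) {jb l S : ℕ}
    (hys : ∀ k < t, s.arr 4 (jb + k) < n) (hxs : ∀ k < t, s.arr 3 (jb + (t + k)) < m)
    (hjw : jb + 2 * t < 2 ^ w) (hlw : l + t < 2 ^ w) (htl : t ≤ l)
    (h29 : s.reg 29 = jb) (h30 : s.reg 30 = 0) (h47 : s.reg 47 = l)
    (hS : s.reg 32 = S) (hSw : S < 2 ^ w) (hx : ∀ k < S, s.arr 7 k < m) (hy : ∀ k < S, s.arr 8 k < n)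
    (h0 : ∀ k < t, s.arr 5 k = 0) (hl0 : ∀ k < t, s.arr 5 (l + k) = 0) :
    Run w enumerate s (110 * (q ^ t * (q * t * (t + S)))) fun s' =>
      (∀ k < t, s'.arr 5 k = 0) ∧
      (∀ k < t, s'.arr 5 (l + k) = digit q (bestLab (tableAt n q (s.arr 0)) q t
        (fun k => s.arr 4 (jb + k)) (fun k => s.arr 3 (jb + (t + k))) (s.arr 7) (s.arr 8) S) k) ∧
      ∀ i, t ≤ i → (i < l ∨ l + t ≤ i) → s'.arr 5 i = s.arr 5 i := by
  have hq := h.q_pos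
  set c : ℕ → ℕ := fun a => score (tableAt n q (s.arr 0)) q t (fun k => s.arr 4 (jb + k))
    (digit q a) (fun k => s.arr 3 (jb + (t + k))) (s.arr 7) (s.arr 8) S with hc
  refine Run.le (T := 2 + (q ^ t * ((80 * (q * t * (t + S)) + (1 + (6 * t + 2) + 1 + (8 * t + 3)))
    + 1) + 1)) (Run.seq (Q' := fun s' => s'.reg 48 = 0 ∧ s'.reg 49 = 0)
    ((Run.straight rfl ?_).le (by rfl)) fun s₁ h₁ hf₁ => ?_) ?_
  · simp [Prog.sem, Config.setReg]
  · refine (Run.whileLt (fun a s' => s'.reg 49 = a / q ^ t ∧ s'.reg 48 = (scan c a).2 ∧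
      (∀ k < t, s'.arr 5 k = digit q a k) ∧
      (∀ k < t, s'.arr 5 (l + k) = digit q (scan c a).1 k) ∧
      ∀ i, t ≤ i → (i < l ∨ l + t ≤ i) → s'.arr 5 i = s.arr 5 i) (q ^ t) _ ?_ ?_ ?_).mono le_rfl ?_
    · simp only [Nat.zero_div, scan, digit_zero, hf₁.arr 5 rfl]
      exact ⟨h₁.2, h₁.1, h0, hl0, fun _ _ _ => trivial⟩
    · rintro a ha s₂ hf₂ ⟨e49, e48, h5, h5l, h5o⟩
      have hE₂ : Env w m n q t s₂ := (h.frame hf₁ rfl).frame hf₂ rfl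
      refine ⟨by rw [e49, hE₂.one_eq, Nat.div_eq_of_lt ha]; exact one_pos, ?_⟩
      have e0 : s₂.arr 0 = s.arr 0 := by rw [hf₂.arr 0 rfl, hf₁.arr 0 rfl]
      have e3 : s₂.arr 3 = s.arr 3 := by rw [hf₂.arr 3 rfl, hf₁.arr 3 rfl]
      have e4 : s₂.arr 4 = s.arr 4 := by rw [hf₂.arr 4 rfl, hf₁.arr 4 rfl]
      have e7 : s₂.arr 7 = s.arr 7 := by rw [hf₂.arr 7 rfl, hf₁.arr 7 rfl]
      have e8 : s₂.arr 8 = s.arr 8 := by rw [hf₂.arr 8 rfl, hf₁.arr 8 rfl]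
      -- The counter at the beginning of array `5` is itself the labeling under test, hence the
      -- label address `0`.
      have hA : ArmOK w m n q t jb 0 s₂ := ⟨by rwa [e4], by rwa [e3],
        fun k hk => by rw [zero_add, h5 k hk]; exact digit_lt hq _ _, hjw, by have := h.t_lt; omega⟩
      refine Run.seq (scoreProg_run hE₂ hA (by rw [hf₂.reg 29 rfl, hf₁.reg 29 rfl, h29])
        (by rw [hf₂.reg 30 rfl, hf₁.reg 30 rfl, h30])
        (by rw [hf₂.reg 32 rfl, hf₁.reg 32 rfl, hS]) hSw (by rwa [e7]) (by rwa [e8]))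
        fun s₃ h₃ hf₃ => ?_
      have hE₃ := hE₂.frame hf₃ rfl
      have h33 : s₃.reg 33 = c a := by
        rw [h₃, e0, e3, e4, e7, e8]
        exact score_congr (fun _ _ => rfl) (fun k hk => by rw [zero_add, h5 k hk])
          (fun _ _ => rfl) (fun _ _ => rfl) (fun _ _ => rfl)
      have e48' : s₃.reg 48 = (scan c a).2 := by rw [hf₃.reg 48 rfl, e48]
      have e5 : s₃.arr 5 = s₂.arr 5 := hf₃.arr 5 rfl
      have e47 : s₃.reg 47 = l := by rw [hf₃.reg 47 rfl, hf₂.reg 47 rfl, hf₁.reg 47 rfl, h47]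
      refine Run.seq (Q' := fun s' => s'.reg 48 = (scan c (a + 1)).2 ∧
        (∀ k < t, s'.arr 5 k = digit q a k) ∧
        (∀ k < t, s'.arr 5 (l + k) = digit q (scan c (a + 1)).1 k) ∧
        ∀ i, t ≤ i → (i < l ∨ l + t ≤ i) → s'.arr 5 i = s.arr 5 i)
        (Run.ifLt (fun hlt => ?_) (fun hlt => ?_)) fun s₄ h₄ hf₄ => ?_
      · rw [e48', h33] at hlt
        refine Run.seq (Q' := fun s' => s'.reg 48 = c a) ((Run.straight rfl ?_).le (by rfl))
          fun s₄ h₄ hf₄ => ?_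
        · simp [Prog.sem, Config.setReg, h33]
        · refine (copyLab_run (hE₃.frame hf₄ rfl) ((hf₄.reg 47 rfl).trans e47) htl
            hlw).post fun s₅ h₅ hf₅ => ?_
          simp only [scan, if_pos hlt]
          refine ⟨by rw [hf₅.reg 48 rfl, h₄], fun k hk => ?_, fun k hk => ?_, fun i hi hi' => ?_⟩
          · rw [h₅.2 k (by omega), hf₄.arr 5 rfl, e5, h5 k hk]
          · rw [h₅.1 k hk, hf₄.arr 5 rfl, e5, h5 k hk]
          · rw [h₅.2 i hi', hf₄.arr 5 rfl, e5, h5o i hi hi']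
      · rw [e48', h33] at hlt
        refine (Run.straight (P := .skip) rfl ?_).le (by simp only [Prog.cost]; omega)
        simp only [Prog.sem, scan, if_neg hlt, e5]
        exact ⟨e48', h5, h5l, h5o⟩
      · obtain ⟨f48, f5, f5l, f5o⟩ := h₄
        refine (increment_run (hE₃.frame hf₄ rfl) f5 ha).post fun s₅ h₅ hf₅ => ?_
        refine ⟨h₅.2.2, by rw [hf₅.reg 48 rfl, f48], h₅.1, fun k hk => ?_, fun i hi hi' => ?_⟩
        · rw [h₅.2.1 _ (by omega), f5l k hk]
        · rw [h₅.2.1 _ (by omega), f5o i hi hi']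
    · rintro s₂ hf₂ ⟨e49, -⟩
      rw [e49, Nat.div_self (pow_pos hq t), ((h.frame hf₁ rfl).frame hf₂ rfl).one_eq]
      simp
    · rintro s' ⟨-, -, h5, h5l, h5o⟩
      exact ⟨fun k hk => by rw [h5 k hk, digit_pow hq hk], h5l, h5o⟩
  · have ht := h.t_pos
    have h1 : 1 ≤ q ^ t := Nat.one_le_pow _ _ hq
    have h2 : t ≤ q * t * (t + S) := by nlinarith [Nat.mul_pos hq ht]
    have h3 : q ^ t * 1 ≤ q ^ t * (q * t * (t + S)) := Nat.mul_le_mul_left _ (by omega)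
    have h4 : q ^ t * t ≤ q ^ t * (q * t * (t + S)) := Nat.mul_le_mul_left _ h2
    nlinarith

/-! ## The program: groups and tournament -/

/-- Set the addresses of the sample and labels of the group in register `r`. -/
def selectArm (r : ℕ) : Prog :=
  .seq (.arith .times 29 r 15) <| .seq (.arith .plus 30 r 7) (.arith .times 30 30 9)

/-- Draw the samples of the group in register `46` and choose their labels. -/
def groupProg : Prog :=
  .seq (.seq (.arith .times 29 46 15) (.copy 45 29)) <| .seq (readItems 3 4 15) <|
  .seq (.const 45 0) <| .seq (readItems 7 8 13) <|
  .seq (.seq (.copy 32 13) <| .seq (.const 30 0) <| .seq (.arith .plus 47 46 7)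
    (.arith .times 47 47 9)) <|
  .seq enumerate (.store 9 46 46)

/-- Compare the champions at places `2 * p` and `2 * p + 1`, where `p` is in register `64`. -/
def matchProg : Prog :=
  .seq (.const 45 0) <| .seq (readItems 7 8 61) <|
  .seq (.seq (.seq (.copy 32 61) <| .seq (.arith .plus 65 64 64) <| .seq (.load 66 9 65) <|
    .seq (.arith .plus 65 65 7) (.load 67 9 65)) (selectArm 66)) <|
  .seq scoreProg <| .seq (.seq (.copy 68 33) (selectArm 67)) <| .seq scoreProg <|
  .ifLt 68 33 (.store 9 64 67) (.store 9 64 66)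

/-- The knockout tournament. -/
def tournament : Prog :=
  .seq (.seq (.const 53 2) <| .seq (.arith .quot 60 11 53) <| .seq (.copy 61 14) (.const 63 0)) <|
  .whileLt 63 60 <| .seq (.forLt 64 60 matchProg) <|
    .seq (.const 53 2) <| .seq (.arith .quot 60 60 53) (.arith .plus 61 61 61)

/-- The environment together with the parameters of the random choices. -/
structure GEnv (w m n q t b N s₀ : ℕ) (s : Config) : Prop extends Env w m n q t s where
  U_eq : s.reg 10 = 2 ^ b
  N_eq : s.reg 11 = N
  s₀_eq : s.reg 13 = s₀
  tt_eq : s.reg 15 = 2 * t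
  b_pos : 0 < b
  U_lt : 2 ^ b < 2 ^ w
  N_lt : (N + 1) * (2 * t) < 2 ^ w
  s₀_lt : s₀ < 2 ^ w

theorem GEnv.frame {w m n q t b N s₀ : ℕ} {s s' : Config} {P : Prog}
    (h : GEnv w m n q t b N s₀ s) (hf : Frame P s s')
    (hw : (P.writes 0 || P.writes 1 || P.writes 2 || P.writes 7 || P.writes 9 || P.stores 0) =
      false)
    (hw' : (P.writes 10 || P.writes 11 || P.writes 13 || P.writes 15) = false) :
    GEnv w m n q t b N s₀ s' := by
  simp only [Bool.or_eq_false_iff (y := P.writes _)] at hw'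
  obtain ⟨⟨⟨h0, h1⟩, h2⟩, h3⟩ := hw'
  exact { h with
    toEnv := h.toEnv.frame hf hw
    U_eq := (hf.reg 10 h0).trans h.U_eq
    N_eq := (hf.reg 11 h1).trans h.N_eq
    s₀_eq := (hf.reg 13 h2).trans h.s₀_eq
    tt_eq := (hf.reg 15 h3).trans h.tt_eq }

theorem GEnv.m_lt {w m n q t b N s₀ : ℕ} {s : Config} (h : GEnv w m n q t b N s₀ s) :
    m < 2 ^ w := by
  refine lt_of_le_of_lt ?_ h.table_lt
  rw [mul_assoc, mul_assoc]
  exact Nat.le_mul_of_pos_right m (Nat.mul_pos h.n_pos (Nat.mul_pos h.q_pos h.q_pos))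

theorem GEnv.n_lt {w m n q t b N s₀ : ℕ} {s : Config} (h : GEnv w m n q t b N s₀ s) :
    n < 2 ^ w := by
  refine lt_of_le_of_lt ?_ h.table_lt
  rw [mul_assoc]
  exact (Nat.le_mul_of_pos_left n h.m_pos).trans
    (Nat.le_mul_of_pos_right _ (Nat.mul_pos h.q_pos h.q_pos))

/-- The first `J` groups are in memory. -/
structure Loaded (m n q t b s₀ : ℕ) (τ : List Bool) (J : ℕ) (s : Config) : Prop where
  ys : ∀ j < J, ∀ k < t, s.arr 4 (j * (2 * t) + k) = sampleY t s₀ (itemAt b m n τ) j k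
  xs : ∀ j < J, ∀ k < t, s.arr 3 (j * (2 * t) + (t + k)) = sampleX t s₀ (itemAt b m n τ) j k
  lab : ∀ j < J, ∀ k < t, s.arr 5 ((j + 1) * t + k) =
    sampleLab (tableAt n q (s.arr 0)) q t s₀ (itemAt b m n τ) j k

theorem Loaded.frame {m n q t b s₀ J : ℕ} {τ : List Bool} {s s' : Config} {P : Prog}
    (h : Loaded m n q t b s₀ τ J s) (hf : Frame P s s')
    (hw : (P.stores 0 || P.stores 3 || P.stores 4 || P.stores 5) = false) :
    Loaded m n q t b s₀ τ J s' := by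
  simp only [Bool.or_eq_false_iff] at hw
  obtain ⟨⟨⟨h0, h3⟩, h4⟩, h5⟩ := hw
  exact ⟨by rw [hf.arr 4 h4]; exact h.ys, by rw [hf.arr 3 h3]; exact h.xs,
    by rw [hf.arr 5 h5, hf.arr 0 h0]; exact h.lab⟩

variable {w m n q t b N s₀ : ℕ} {s : Config} {τ : List Bool}

theorem place_lt {j N t : ℕ} (h : j < N) :
    j * (2 * t) + 2 * t ≤ (N + 1) * (2 * t) ∧ (j + 1) * t + t ≤ (N + 1) * (2 * t) := by
  have h1 : (j + 1) * (2 * t) ≤ N * (2 * t) := Nat.mul_le_mul_right _ h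
  constructor <;> nlinarith

theorem Loaded.armOK {J j : ℕ} (h : GEnv w m n q t b N s₀ s) (hL : Loaded m n q t b s₀ τ J s)
    (hj : j < J) (hJ : J ≤ N) : ArmOK w m n q t (j * (2 * t)) ((j + 1) * t) s := by
  have h1 := place_lt (t := t) (hj.trans_le hJ)
  have h2 := h.N_lt
  exact ⟨fun k hk => by rw [hL.ys j hj k hk]; exact Nat.mod_lt _ h.n_pos,
    fun k hk => by rw [hL.xs j hj k hk]; exact Nat.mod_lt _ h.m_pos,
    fun k hk => by rw [hL.lab j hj k hk]; exact digit_lt h.q_pos _ _, by omega, by omega⟩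

/-- The label cells from `(j + 1) * t` on are carried along as zero, since `enumerate` needs a clean
target for every later group. Group `j` enters the tournament at place `j`. -/
theorem groupProg_run (h : GEnv w m n q t b N s₀ s) {j : ℕ} (hj : j < N) (h46 : s.reg 46 = j)
    (hL : Loaded m n q t b s₀ τ j s) (hτ : s.tape = τ.drop (j * groupSize t s₀ * (2 * b)))
    (h0 : ∀ k < t, s.arr 5 k = 0) (hl0 : ∀ i, (j + 1) * t ≤ i → s.arr 5 i = 0) :
    Run w groupProg s (200 * (b * q ^ t * (q * t * (t + s₀)))) fun s' =>
      Loaded m n q t b s₀ τ (j + 1) s' ∧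
      s'.tape = τ.drop ((j + 1) * groupSize t s₀ * (2 * b)) ∧
      (∀ k < t, s'.arr 5 k = 0) ∧ (∀ i, (j + 1 + 1) * t ≤ i → s'.arr 5 i = 0) ∧
      s'.arr 9 = Function.update (s.arr 9) j j := by
  obtain ⟨p1, p2⟩ := place_lt (t := t) hj
  have hNw := h.N_lt
  have htw := h.t_lt
  have ht0 := h.t_pos
  have hjN : j + 1 < 2 ^ w := by nlinarith
  have hmw := h.m_lt
  have hnw := h.n_lt
  refine Run.le (T := 2 + ((24 * (b * (2 * t)) + 2) + (1 + ((24 * (b * s₀) + 2) + (4 +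
    (110 * (q ^ t * (q * t * (t + s₀))) + 1)))))) (Run.seq (Q' := fun s' =>
      s'.reg 29 = j * (2 * t) ∧ s'.reg 45 = j * (2 * t)) ((Run.straight rfl ?_).le (by rfl))
    fun s₁ h₁ hf₁ => ?_) ?_
  · simp [Prog.sem, Config.setReg, WordOp.eval, h46, h.tt_eq,
      Nat.mod_eq_of_lt (show j * (2 * t) < 2 ^ w by omega)]
  · have hE₁ := h.frame hf₁ rfl rfl
    refine Run.seq (readItems_run (c := 2 * t) (i₀ := j * groupSize t s₀) (τ := τ) (m := m) (n := n)
      (b := b)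
      (by decide) (by decide) (by decide) (by decide) (by decide) (by decide) (by decide)
      hE₁.m_eq hE₁.n_eq h.m_pos h.n_pos hmw hnw hE₁.U_eq h.b_pos h.U_lt hE₁.tt_eq
      (by rw [h₁.2]; omega) ((hf₁.tape rfl).trans hτ)) fun s₂ h₂ hf₂ => ?_
    rw [h₁.2] at h₂
    obtain ⟨h₂, h₂', htp₂⟩ := h₂
    have hE₂ := hE₁.frame hf₂ rfl rfl
    refine Run.seq (Q' := fun s' => s'.reg 45 = 0) ((Run.straight rfl ?_).le (by rfl))
      fun s₃ h₃ hf₃ => ?_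
    · simp [Prog.sem, Config.setReg]
    have hE₃ := hE₂.frame hf₃ rfl rfl
    refine Run.seq (readItems_run (c := s₀) (i₀ := j * groupSize t s₀ + 2 * t) (τ := τ) (m := m)
      (n := n) (b := b)
      (by decide) (by decide) (by decide) (by decide) (by decide) (by decide) (by decide)
      hE₃.m_eq hE₃.n_eq h.m_pos h.n_pos hmw hnw hE₃.U_eq h.b_pos h.U_lt hE₃.s₀_eq
      (by rw [h₃, zero_add]; exact h.s₀_lt) ((hf₃.tape rfl).trans htp₂)) fun s₄ h₄ hf₄ => ?_
    rw [h₃] at h₄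
    obtain ⟨h₄, -, htp₄⟩ := h₄
    have hE₄ := hE₃.frame hf₄ rfl rfl
    have e46 : s₄.reg 46 = j := by
      rw [hf₄.reg 46 rfl, hf₃.reg 46 rfl, hf₂.reg 46 rfl, hf₁.reg 46 rfl, h46]
    refine Run.seq (Q' := fun s' => s'.reg 32 = s₀ ∧ s'.reg 30 = 0 ∧ s'.reg 47 = (j + 1) * t)
      ((Run.straight rfl ?_).le (by rfl)) fun s₅ h₅ hf₅ => ?_
    · simp [Prog.sem, Config.setReg, WordOp.eval, e46, hE₄.one_eq, hE₄.t_eq, hE₄.s₀_eq,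
        Nat.mod_eq_of_lt hjN, Nat.mod_eq_of_lt (show (j + 1) * t < 2 ^ w by omega)]
    have hE₅ := hE₄.frame hf₅ rfl rfl
    have a0 : s₅.arr 0 = s.arr 0 := by
      rw [hf₅.arr 0 rfl, hf₄.arr 0 rfl, hf₃.arr 0 rfl, hf₂.arr 0 rfl, hf₁.arr 0 rfl]
    have a3 : s₅.arr 3 = s₂.arr 3 := by rw [hf₅.arr 3 rfl, hf₄.arr 3 rfl, hf₃.arr 3 rfl]
    have a4 : s₅.arr 4 = s₂.arr 4 := by rw [hf₅.arr 4 rfl, hf₄.arr 4 rfl, hf₃.arr 4 rfl]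
    have a5 : s₅.arr 5 = s.arr 5 := by
      rw [hf₅.arr 5 rfl, hf₄.arr 5 rfl, hf₃.arr 5 rfl, hf₂.arr 5 rfl, hf₁.arr 5 rfl]
    have a7 : s₅.arr 7 = s₄.arr 7 := hf₅.arr 7 rfl
    have a8 : s₅.arr 8 = s₄.arr 8 := hf₅.arr 8 rfl
    have b3 : ∀ k < t, s₂.arr 3 (j * (2 * t) + (t + k)) = sampleX t s₀ (itemAt b m n τ) j k :=
      fun k hk => (h₂ (t + k) (by omega)).1
    have b4 : ∀ k < t, s₂.arr 4 (j * (2 * t) + k) = sampleY t s₀ (itemAt b m n τ) j k :=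
      fun k hk => (h₂ k (by omega)).2
    have b7 : ∀ k < s₀, s₄.arr 7 k = (edgeAt t s₀ (itemAt b m n τ) j k).1 := fun k hk => by
      have := (h₄ k hk).1
      rwa [zero_add, add_assoc] at this
    have b8 : ∀ k < s₀, s₄.arr 8 k = (edgeAt t s₀ (itemAt b m n τ) j k).2 := fun k hk => by
      have := (h₄ k hk).2
      rwa [zero_add, add_assoc] at this
    refine Run.seq (enumerate_run hE₅.toEnv (jb := j * (2 * t)) (l := (j + 1) * t) (S := s₀)
      (fun k hk => by rw [a4, b4 k hk]; exact Nat.mod_lt _ h.n_pos)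
      (fun k hk => by rw [a3, b3 k hk]; exact Nat.mod_lt _ h.m_pos)
      (by omega) (by omega) (by nlinarith)
      (by rw [hf₅.reg 29 rfl, hf₄.reg 29 rfl, hf₃.reg 29 rfl, hf₂.reg 29 rfl, h₁.1])
      h₅.2.1 h₅.2.2 h₅.1 h.s₀_lt
      (fun k hk => by rw [a7, b7 k hk]; exact Nat.mod_lt _ h.m_pos)
      (fun k hk => by rw [a8, b8 k hk]; exact Nat.mod_lt _ h.n_pos)
      (by rwa [a5]) (fun k hk => by rw [a5]; exact hl0 _ (by omega)))
      fun s₆ h₆ hf₆ => (Run.straight rfl ?_).le (by rfl)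
    obtain ⟨c5, c5l, c5o⟩ := h₆
    have e46' : s₆.reg 46 = j := by rw [hf₆.reg 46 rfl, hf₅.reg 46 rfl, e46]
    have a9 : s₆.arr 9 = s.arr 9 := by
      rw [hf₆.arr 9 rfl, hf₅.arr 9 rfl, hf₄.arr 9 rfl, hf₃.arr 9 rfl, hf₂.arr 9 rfl, hf₁.arr 9 rfl]
    have hs : ∀ a, a ≠ 9 → (Prog.sem w (.store 9 46 46) s₆).arr a = s₆.arr a := fun a ha => by
      simp [Prog.sem, Config.setArr, ha]
    have hprev : ∀ j' < j, (j' + 1) * (2 * t) ≤ j * (2 * t) ∧ (j' + 1 + 1) * t ≤ (j + 1) * t :=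
      fun j' hj' => ⟨Nat.mul_le_mul_right _ hj', Nat.mul_le_mul_right _ (by omega)⟩
    have o3 : s₁.arr 3 = s.arr 3 := hf₁.arr 3 rfl
    have o4 : s₁.arr 4 = s.arr 4 := hf₁.arr 4 rfl
    refine ⟨⟨fun j' hj' k hk => ?_, fun j' hj' k hk => ?_, fun j' hj' k hk => ?_⟩, ?_, ?_, ?_, ?_⟩
    · rw [hs 4 (by decide), hf₆.arr 4 rfl, a4]
      rcases Nat.lt_succ_iff_lt_or_eq.mp hj' with hj' | rfl
      · have := hprev j' hj'
        rw [add_mul] at this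
        rw [(h₂' _ (by omega)).2, o4, hL.ys j' hj' k hk]
      · exact b4 k hk
    · rw [hs 3 (by decide), hf₆.arr 3 rfl, a3]
      rcases Nat.lt_succ_iff_lt_or_eq.mp hj' with hj' | rfl
      · have := hprev j' hj'
        rw [add_mul] at this
        rw [(h₂' _ (by omega)).1, o3, hL.xs j' hj' k hk]
      · exact b3 k hk
    · rw [hs 5 (by decide), hs 0 (by decide), hf₆.arr 0 rfl, a0]
      rcases Nat.lt_succ_iff_lt_or_eq.mp hj' with hj' | rfl
      · have := (hprev j' hj').2
        rw [add_mul (j' + 1)] at this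
        have h1 : t ≤ (j' + 1) * t := by nlinarith
        rw [c5o _ (by omega) (by omega), a5, hL.lab j' hj' k hk]
      · rw [c5l k hk, sampleLab, a0]
        congr 1
        refine bestLab_congr (fun k hk => ?_) (fun k hk => ?_) (fun k hk => ?_) (fun k hk => ?_)
        · rw [a4, b4 k hk]
        · rw [a3, b3 k hk]
        · rw [a7, b7 k hk]
        · rw [a8, b8 k hk]
    · simp only [Prog.sem, Config.setArr]
      rw [hf₆.tape rfl, hf₅.tape rfl, htp₄]
      congr 1
      unfold groupSize
      ring
    · rw [hs 5 (by decide)]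
      exact c5
    · intro i hi
      rw [add_mul (j + 1)] at hi
      have h1 : t ≤ (j + 1) * t := by nlinarith
      rw [hs 5 (by decide), c5o i (by omega) (by omega), a5]
      exact hl0 i (by omega)
    · simp [Prog.sem, Config.setArr, e46', a9]
  · have hb := h.b_pos
    have hq := h.q_pos
    have h1 : 1 ≤ q ^ t := Nat.one_le_pow _ _ hq
    have h2 : t + s₀ ≤ q * t * (t + s₀) := Nat.le_mul_of_pos_left _ (Nat.mul_pos hq ht0)
    have h3 : b * (t + s₀) ≤ b * q ^ t * (q * t * (t + s₀)) :=
      Nat.mul_le_mul (Nat.le_mul_of_pos_right _ h1) h2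
    have h4 : q ^ t * (q * t * (t + s₀)) ≤ b * q ^ t * (q * t * (t + s₀)) :=
      Nat.mul_le_mul_right _ (Nat.le_mul_of_pos_left _ hb)
    have h5 : 1 ≤ b * (t + s₀) := Nat.mul_pos hb (by omega)
    nlinarith

variable {w m n q t b N s₀ : ℕ} {s : Config} {τ : List Bool}

theorem groups_run (h : GEnv w m n q t b N s₀ s) (hτ : s.tape = τ)
    (h5 : ∀ i, s.arr 5 i = 0) :
    Run w (.forLt 46 11 groupProg) s
      (N * (200 * (b * q ^ t * (q * t * (t + s₀))) + 3) + 2) fun s' =>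
      Loaded m n q t b s₀ τ N s' ∧ s'.tape = τ.drop (N * groupSize t s₀ * (2 * b)) ∧
      ∀ j < N, s'.arr 9 j = j := by
  have hNw : N < 2 ^ w := by
    have := h.N_lt
    have := h.t_pos
    nlinarith
  refine (Run.forLt (fun j s' => Loaded m n q t b s₀ τ j s' ∧
      s'.tape = τ.drop (j * groupSize t s₀ * (2 * b)) ∧
      (∀ k < t, s'.arr 5 k = 0) ∧ (∀ i, (j + 1) * t ≤ i → s'.arr 5 i = 0) ∧
      ∀ j' < j, s'.arr 9 j' = j') N _ rfl rfl (by decide) (by decide) (by decide) hNw h.N_eq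
      ?_ ?_ ?_).mono le_rfl fun s' hs' => ⟨hs'.1, hs'.2.1, hs'.2.2.2.2⟩
  · refine ⟨⟨by simp, by simp, by simp⟩, by simp [Config.setReg, hτ], ?_, ?_, by simp⟩ <;>
      simp [Config.setReg, h5]
  · rintro j hj s₁ hf ⟨hL, htp, h0, hl0, h9⟩ h46
    refine (groupProg_run (h.frame hf rfl rfl) hj h46 hL htp h0 hl0).mono le_rfl ?_
    rintro s₂ ⟨hL', htp', h0', hl0', h9'⟩
    refine ⟨hL', htp', h0', hl0', fun j' hj' => ?_⟩
    rw [h9']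
    rcases Nat.lt_succ_iff_lt_or_eq.mp hj' with hj' | rfl
    · rw [Function.update_of_ne hj'.ne, h9 j' hj']
    · simp
  · rintro k s' v ⟨h1, h2, h3, h4, h6⟩
    exact ⟨⟨h1.ys, h1.xs, h1.lab⟩, h2, h3, h4, h6⟩

theorem selectArm_sem {w t N : ℕ} {s : Config} {r c : ℕ} (h15 : s.reg 15 = 2 * t)
    (h7 : s.reg 7 = 1) (h9 : s.reg 9 = t) (ht : 0 < t) (hNw : (N + 1) * (2 * t) < 2 ^ w)
    (hr : s.reg r = c) (hc : c < N) (hr29 : r ≠ 29) :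
    Prog.sem w (selectArm r) s =
      ((s.setReg 29 (c * (2 * t))).setReg 30 (c + 1)).setReg 30 ((c + 1) * t) := by
  obtain ⟨p1, p2⟩ := place_lt (t := t) hc
  have h1 : (c + 1) % 2 ^ w = c + 1 := Nat.mod_eq_of_lt (by nlinarith)
  have h2 : (c + 1) * t % 2 ^ w = (c + 1) * t := Nat.mod_eq_of_lt (by omega)
  have h3 : c * (2 * t) % 2 ^ w = c * (2 * t) := Nat.mod_eq_of_lt (by omega)
  simp [selectArm, Prog.sem, Config.setReg, WordOp.eval, hr, h15, h7, h9, hr29, h1, h2, h3]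

theorem armScore_run (h : GEnv w m n q t b N s₀ s) (hL : Loaded m n q t b s₀ τ N s) {c o S : ℕ}
    (hc : c < N) (h29 : s.reg 29 = c * (2 * t)) (h30 : s.reg 30 = (c + 1) * t)
    (h32 : s.reg 32 = S) (hSw : S < 2 ^ w)
    (h7 : ∀ k < S, s.arr 7 k = (itemAt b m n τ (o + k)).1)
    (h8 : ∀ k < S, s.arr 8 k = (itemAt b m n τ (o + k)).2) :
    Run w scoreProg s (80 * (q * t * (t + S))) fun s' =>
      s'.reg 33 = groupScore (tableAt n q (s.arr 0)) q t s₀ (itemAt b m n τ) c o S := by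
  refine (scoreProg_run h.toEnv (hL.armOK h hc le_rfl) h29 h30 h32 hSw
    (fun k hk => by rw [h7 k hk]; exact Nat.mod_lt _ h.m_pos)
    (fun k hk => by rw [h8 k hk]; exact Nat.mod_lt _ h.n_pos)).mono le_rfl fun s' hs' => ?_
  rw [hs']
  exact score_congr (hL.ys c hc) (hL.lab c hc) (hL.xs c hc) h7 h8

/-- Both candidates are scored on the same freshly read edges. A tie is won by `c₁`, in agreement
with `champion`. -/
theorem matchProg_run (h : GEnv w m n q t b N s₀ s) (hL : Loaded m n q t b s₀ τ N s)
    {p c₁ c₂ o S : ℕ} (h64 : s.reg 64 = p) (h61 : s.reg 61 = S) (hSw : S < 2 ^ w)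
    (hpw : 2 * p + 1 < 2 ^ w) (hτ : s.tape = τ.drop (o * (2 * b)))
    (hc₁ : s.arr 9 (2 * p) = c₁) (hc₂ : s.arr 9 (2 * p + 1) = c₂) (hc₁N : c₁ < N) (hc₂N : c₂ < N) :
    Run w matchProg s (220 * (b * (q * t * (t + S)))) fun s' =>
      s'.tape = τ.drop ((o + S) * (2 * b)) ∧
      s'.arr 9 = Function.update (s.arr 9) p
        (if groupScore (tableAt n q (s.arr 0)) q t s₀ (itemAt b m n τ) c₁ o S <
          groupScore (tableAt n q (s.arr 0)) q t s₀ (itemAt b m n τ) c₂ o S then c₂ else c₁) := by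
  refine Run.le (T := 1 + ((24 * (b * S) + 2) + (8 + (80 * (q * t * (t + S)) + (4 +
    (80 * (q * t * (t + S)) + (1 + 1))))))) (Run.seq (Q' := fun s' => s'.reg 45 = 0)
    ((Run.straight rfl ?_).le (by rfl)) fun s₁ h₁ hf₁ => ?_) ?_
  · simp [Prog.sem, Config.setReg]
  · have hE₁ := h.frame hf₁ rfl rfl
    refine Run.seq (readItems_run (c := S) (i₀ := o) (τ := τ) (m := m) (n := n) (b := b)
      (by decide) (by decide) (by decide) (by decide) (by decide) (by decide) (by decide)
      hE₁.m_eq hE₁.n_eq h.m_pos h.n_pos h.m_lt h.n_lt hE₁.U_eq h.b_pos h.U_lt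
      ((hf₁.reg 61 rfl).trans h61) (by rw [h₁, zero_add]; exact hSw) ((hf₁.tape rfl).trans hτ))
      fun s₂ h₂ hf₂ => ?_
    rw [h₁] at h₂
    simp only [zero_add] at h₂
    obtain ⟨h₂, -, htp₂⟩ := h₂
    have hE₂ := hE₁.frame hf₂ rfl rfl
    have e64 : s₂.reg 64 = p := by rw [hf₂.reg 64 rfl, hf₁.reg 64 rfl, h64]
    have e61 : s₂.reg 61 = S := by rw [hf₂.reg 61 rfl, hf₁.reg 61 rfl, h61]
    have a9 : s₂.arr 9 = s.arr 9 := by rw [hf₂.arr 9 rfl, hf₁.arr 9 rfl]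
    refine Run.seq (Q' := fun s' => s'.reg 32 = S ∧ s'.reg 29 = c₁ * (2 * t) ∧
      s'.reg 30 = (c₁ + 1) * t ∧ s'.reg 67 = c₂ ∧ s'.reg 66 = c₁) ((Run.straight rfl ?_).le (by rfl))
      fun s₃ h₃ hf₃ => ?_
    · have r1 : (p + p) % 2 ^ w = 2 * p := by rw [Nat.mod_eq_of_lt (by omega), two_mul]
      have r2 : (2 * p + 1) % 2 ^ w = 2 * p + 1 := Nat.mod_eq_of_lt hpw
      rw [Prog.sem, selectArm_sem (c := c₁) (r := 66) (t := t) (N := N) ?_ ?_ ?_ h.t_pos h.N_lt ?_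
        hc₁N (by decide)]
      all_goals simp [Prog.sem, Config.setReg, WordOp.eval, e64, e61, hE₂.one_eq, hE₂.tt_eq,
        hE₂.t_eq, r1, r2, a9, hc₁, hc₂]
    obtain ⟨e32, e29, e30, e67, e66⟩ := h₃
    have hE₃ := hE₂.frame hf₃ rfl rfl
    have hL₃ := ((hL.frame hf₁ rfl).frame hf₂ rfl).frame hf₃ rfl
    have a7 : ∀ k < S, s₃.arr 7 k = (itemAt b m n τ (o + k)).1 := by
      rw [hf₃.arr 7 rfl]
      exact fun k hk => (h₂ k hk).1
    have a8 : ∀ k < S, s₃.arr 8 k = (itemAt b m n τ (o + k)).2 := by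
      rw [hf₃.arr 8 rfl]
      exact fun k hk => (h₂ k hk).2
    have a0 : s₃.arr 0 = s.arr 0 := by rw [hf₃.arr 0 rfl, hf₂.arr 0 rfl, hf₁.arr 0 rfl]
    refine Run.seq (armScore_run hE₃ hL₃ hc₁N e29 e30 e32 hSw a7 a8) fun s₄ h₄ hf₄ => ?_
    have hE₄ := hE₃.frame hf₄ rfl rfl
    have hL₄ := hL₃.frame hf₄ rfl
    have f67 : s₄.reg 67 = c₂ := by rw [hf₄.reg 67 rfl, e67]
    refine Run.seq (Q' := fun s' => s'.reg 68 = s₄.reg 33 ∧ s'.reg 29 = c₂ * (2 * t) ∧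
      s'.reg 30 = (c₂ + 1) * t) ((Run.straight rfl ?_).le (by rfl)) fun s₅ h₅ hf₅ => ?_
    · rw [Prog.sem, selectArm_sem (c := c₂) (r := 67) (t := t) (N := N) ?_ ?_ ?_ h.t_pos h.N_lt ?_
        hc₂N (by decide)]
      all_goals simp [Prog.sem, Config.setReg, hE₄.one_eq, hE₄.tt_eq, hE₄.t_eq, f67]
    obtain ⟨e68, e29, e30⟩ := h₅
    have hE₅ := hE₄.frame hf₅ rfl rfl
    have hL₅ := hL₄.frame hf₅ rfl
    refine Run.seq (armScore_run (o := o) hE₅ hL₅ hc₂N e29 e30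
      (by rw [hf₅.reg 32 rfl, hf₄.reg 32 rfl, e32]) hSw
      (by rw [hf₅.arr 7 rfl, hf₄.arr 7 rfl]; exact a7)
      (by rw [hf₅.arr 8 rfl, hf₄.arr 8 rfl]; exact a8)) fun s₆ h₆ hf₆ => ?_
    have g68 : s₆.reg 68 = groupScore (tableAt n q (s.arr 0)) q t s₀ (itemAt b m n τ) c₁ o S := by
      rw [hf₆.reg 68 rfl, e68, h₄, a0]
    have g33 : s₆.reg 33 = groupScore (tableAt n q (s.arr 0)) q t s₀ (itemAt b m n τ) c₂ o S := by
      rw [h₆, hf₅.arr 0 rfl, hf₄.arr 0 rfl, a0]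
    have g64 : s₆.reg 64 = p := by
      rw [hf₆.reg 64 rfl, hf₅.reg 64 rfl, hf₄.reg 64 rfl, hf₃.reg 64 rfl, e64]
    have g66 : s₆.reg 66 = c₁ := by rw [hf₆.reg 66 rfl, hf₅.reg 66 rfl, hf₄.reg 66 rfl, e66]
    have g67 : s₆.reg 67 = c₂ := by rw [hf₆.reg 67 rfl, hf₅.reg 67 rfl, f67]
    have g9 : s₆.arr 9 = s.arr 9 := by
      rw [hf₆.arr 9 rfl, hf₅.arr 9 rfl, hf₄.arr 9 rfl, hf₃.arr 9 rfl, a9]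
    have gtp : s₆.tape = τ.drop ((o + S) * (2 * b)) := by
      rw [hf₆.tape rfl, hf₅.tape rfl, hf₄.tape rfl, hf₃.tape rfl, htp₂]
    refine Run.ifLt (fun hlt => ?_) (fun hlt => ?_) <;> rw [g68, g33] at hlt <;>
      refine (Run.straight rfl ?_).le (by rfl)
    · simp [Prog.sem, Config.setArr, g64, g67, g9, gtp, if_pos hlt]
    · simp [Prog.sem, Config.setArr, g64, g66, g9, gtp, if_neg hlt]
  · have hb := h.b_pos
    have h2 : t + S ≤ q * t * (t + S) := Nat.le_mul_of_pos_left _ (Nat.mul_pos h.q_pos h.t_pos)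
    have h3 : b * (t + S) ≤ b * (q * t * (t + S)) := Nat.mul_le_mul_left _ h2
    have h4 : q * t * (t + S) ≤ b * (q * t * (t + S)) := Nat.le_mul_of_pos_left _ hb
    have h5 : 1 ≤ t + S := by have := h.t_pos; omega
    nlinarith

/-- A bound for the time of the tournament. -/
def tournamentTime (q t b L S : ℕ) : ℕ := L * (300 * (2 ^ L * (b * (q * t * (t + S))))) + 5

/-- Champions are updated in place. After `p` matches the cells below `p` belong to the next round
and those from `p` on to the current one; match `p` reads cells `2 * p` and `2 * p + 1` and writes
cell `p`, so nothing is lost. Register `63` is exported as `0` because the output phase uses it as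
the address of the winner. -/
theorem tournament_run {L S : ℕ} (h : GEnv w m n q t b (2 ^ L) s₀ s)
    (hL : Loaded m n q t b s₀ τ (2 ^ L) s)
    (h14 : s.reg 14 = S) (hSw : 2 ^ L * S < 2 ^ w) (hS : 0 < S)
    (hτ : s.tape = τ.drop (2 ^ L * groupSize t s₀ * (2 * b))) (h9 : ∀ j < 2 ^ L, s.arr 9 j = j)
    (hch : ∀ i ≤ L, ∀ p < 2 ^ (L - i),
      champion (tableAt n q (s.arr 0)) q t s₀ (itemAt b m n τ) L S i p < 2 ^ L) :
    Run w tournament s (tournamentTime q t b L S) fun s' =>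
      s'.arr 9 0 = champion (tableAt n q (s.arr 0)) q t s₀ (itemAt b m n τ) L S L 0 ∧
      s'.reg 63 = 0 := by
  set ch := champion (tableAt n q (s.arr 0)) q t s₀ (itemAt b m n τ) L S with hchd
  have ht0 := h.t_pos
  have hNlt : 2 * 2 ^ L < 2 ^ w := by
    have h1 := h.N_lt
    have h2 : 2 ^ L * 2 ≤ (2 ^ L + 1) * (2 * t) := Nat.mul_le_mul (by omega) (by omega)
    omega
  have hN1 : 1 ≤ 2 ^ L := Nat.one_le_two_pow
  have h2 : 2 % 2 ^ w = 2 := Nat.mod_eq_of_lt (by omega)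
  have hhalf : ∀ i ≤ L, 2 ^ (L - i) / 2 % 2 ^ w = 2 ^ (L - i) / 2 := fun i hi =>
    Nat.mod_eq_of_lt (by
      have : 2 ^ (L - i) ≤ 2 ^ L := Nat.pow_le_pow_right (by decide) (by omega)
      omega)
  refine Run.le (T := 4 + (L * ((2 ^ L * (220 * (b * (q * t * (t + S))) + 3) + 2 + 3) + 1) + 1))
    (Run.seq (Q' := fun s' => s'.reg 60 = 2 ^ (L - 0) / 2 ∧ s'.reg 61 = S ∧ s'.reg 63 = 0)
    ((Run.straight rfl ?_).le (by rfl)) fun s₁ h₁ hf₁ => ?_) ?_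
  · have := hhalf 0 (Nat.zero_le _)
    simp only [Nat.sub_zero] at this
    simp [Prog.sem, Config.setReg, WordOp.eval, h.N_eq, h14, h2, this]
  -- Register `60` is the number of matches of the coming round. At `i = L` it is `1 / 2 = 0`, which
  -- ends the loop.
  · refine (Run.whileLt (fun i s' => s'.reg 60 = 2 ^ (L - i) / 2 ∧
      (i < L → s'.reg 61 = 2 ^ i * S) ∧
      s'.tape = τ.drop (roundStart t s₀ L S i * (2 * b)) ∧
      ∀ p < 2 ^ (L - i), s'.arr 9 p = ch i p) L _ ?_ ?_ ?_).post ?_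
    · refine ⟨h₁.1, fun _ => by simp [h₁.2.1], ?_, fun p hp => ?_⟩
      · rw [hf₁.tape rfl, hτ, roundStart, zero_mul, add_zero]
      · rw [hf₁.arr 9 rfl, h9 p hp, hchd, champion]
    · rintro i hi s₂ hf₂ ⟨e60, e61, htp, hc⟩
      have e61 := e61 hi
      have hpow : 2 ^ (L - i) = 2 * 2 ^ (L - (i + 1)) := by
        rw [← pow_succ']
        congr 1
        omega
      have hhalf' : 2 ^ (L - i) / 2 = 2 ^ (L - (i + 1)) := by omega
      have hE₂ := (h.frame hf₁ rfl rfl).frame hf₂ rfl rfl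
      have hL₂ := (hL.frame hf₁ rfl).frame hf₂ rfl
      have a0 : s₂.arr 0 = s.arr 0 := by rw [hf₂.arr 0 rfl, hf₁.arr 0 rfl]
      have e63 : s₂.reg 63 = 0 := by rw [hf₂.reg 63 rfl, h₁.2.2]
      have hle : 2 ^ (L - (i + 1)) * (2 ^ i * S) * 2 = 2 ^ L * S := by
        have : 2 ^ L = 2 ^ (L - (i + 1)) * 2 ^ i * 2 := by
          rw [← pow_add, ← pow_succ]
          congr 1
          omega
        rw [this]
        ring
      have hp1 : 1 ≤ 2 ^ (L - (i + 1)) := Nat.one_le_two_pow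
      have hSi : 2 ^ i * S * 2 ≤ 2 ^ L * S := by
        rw [← hle]
        exact Nat.mul_le_mul_right _ (Nat.le_mul_of_pos_left _ hp1)
      have hpL : 2 ^ (L - (i + 1)) * 2 ≤ 2 ^ L := by
        rw [← pow_succ]
        exact Nat.pow_le_pow_right (by decide) (by omega)
      refine ⟨by rw [e63, e60, hhalf']; omega, ?_⟩
      refine Run.seq (Q' := fun s' =>
        s'.tape = τ.drop ((roundStart t s₀ L S i + 2 ^ (L - (i + 1)) * (2 ^ i * S)) * (2 * b)) ∧
        ∀ p < 2 ^ (L - (i + 1)), s'.arr 9 p = ch (i + 1) p)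
        (T₁ := 2 ^ L * (220 * (b * (q * t * (t + S))) + 3) + 2)
        (Run.mono (Run.forLt (w := w) (i := 64) (n := 60) (P := matchProg) (fun p s' => s'.tape = τ.drop
            ((roundStart t s₀ L S i + p * (2 ^ i * S)) * (2 * b)) ∧
          (∀ p' < p, s'.arr 9 p' = ch (i + 1) p') ∧
          ∀ p', p ≤ p' → p' < 2 ^ (L - i) → s'.arr 9 p' = ch i p') (2 ^ (L - (i + 1)))
          (220 * (b * (q * t * (t + 2 ^ i * S)))) rfl rfl (by decide) (by decide) (by decide)
          (by omega) (e60.trans hhalf') ?_ ?_ ?_) ?_ fun s' h' => ⟨h'.1, h'.2.1⟩)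
        fun s₃ h₃ hf₃ => (Run.straight (P := .seq (.const 53 2) <|
          .seq (.arith .quot 60 60 53) (.arith .plus 61 61 61)) rfl ?_).le (by rfl)
      · refine ⟨?_, by simp, ?_⟩
        · simpa [Config.setReg] using htp
        · intro p' _ hp'
          simpa [Config.setReg] using hc p' hp'
      · rintro p hp s₃ hf₃ ⟨htp₃, hlo, hhi⟩ e64
        have hE₃ := hE₂.frame hf₃ rfl rfl
        have hL₃ := hL₂.frame hf₃ rfl
        refine (matchProg_run hE₃ hL₃ (p := p) (S := 2 ^ i * S) e64
          ((hf₃.reg 61 rfl).trans e61) (by omega) (by omega) htp₃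
          (hhi (2 * p) (by omega) (by omega)) (hhi (2 * p + 1) (by omega) (by omega))
          (hch i hi.le _ (by omega)) (hch i hi.le _ (by omega))).mono le_rfl ?_
        rintro s₄ ⟨htp₄, h9₄⟩
        refine ⟨?_, fun p' hp' => ?_, fun p' hp' hp'' => ?_⟩
        · rw [htp₄]
          congr 1
          ring
        · rw [h9₄]
          rcases Nat.lt_succ_iff_lt_or_eq.mp hp' with hp' | rfl
          · rw [Function.update_of_ne hp'.ne, hlo p' hp']
          · rw [Function.update_self, hchd, champion, hf₃.arr 0 rfl, a0]
        · rw [h9₄, Function.update_of_ne (by omega), hhi p' (by omega) hp'']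
      · rintro k s' v h'
        simpa [Config.setReg] using h'
      -- A round is no more expensive than the bound for the first one: the number of matches halves
      -- when the number of edges per match doubles.
      · have h1 : 2 ^ (L - (i + 1)) * (t + 2 ^ i * S) ≤ 2 ^ L * (t + S) := by
          nlinarith
        have h2 : 2 ^ (L - (i + 1)) * (220 * (b * (q * t * (t + 2 ^ i * S)))) ≤
            2 ^ L * (220 * (b * (q * t * (t + S)))) := by
          calc _ = 220 * (b * (q * t)) * (2 ^ (L - (i + 1)) * (t + 2 ^ i * S)) := by ring
            _ ≤ 220 * (b * (q * t)) * (2 ^ L * (t + S)) := Nat.mul_le_mul_left _ h1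
            _ = _ := by ring
        rw [mul_add (2 ^ (L - (i + 1))), mul_add (2 ^ L)]
        omega
      · have f60 : s₃.reg 60 = 2 ^ (L - i) / 2 := by rw [hf₃.reg 60 rfl, e60]
        have f61 : s₃.reg 61 = 2 ^ i * S := by rw [hf₃.reg 61 rfl, e61]
        have m1 : (2 ^ i * S + 2 ^ i * S) % 2 ^ w = 2 ^ (i + 1) * S := by
          rw [Nat.mod_eq_of_lt (by omega)]
          ring
        have m2 := hhalf (i + 1) hi
        simp only [Prog.sem, Config.setReg, WordOp.eval, Function.update_apply]
        simp only [Nat.reduceEqDiff, ↓reduceIte, f60, f61, m1, m2, h2, hhalf', true_and]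
        refine ⟨fun _ => trivial, ?_, h₃.2⟩
        rw [h₃.1]
        congr 2
        have : 2 ^ (L - 1) = 2 ^ (L - (i + 1)) * 2 ^ i := by
          rw [← pow_add]
          congr 1
          omega
        rw [roundStart, roundStart, this]
        ring
    · rintro s₂ hf₂ ⟨e60, -⟩
      rw [e60]
      simp
    · rintro s₂ ⟨-, -, -, hc⟩ hf₂
      exact ⟨hc 0 (by simp), by rw [hf₂.reg 63 rfl, h₁.2.2]⟩
  · have h1 : 1 ≤ b * (q * t * (t + S)) :=
      Nat.mul_pos h.b_pos (Nat.mul_pos (Nat.mul_pos h.q_pos ht0) (by omega))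
    have h3 : 2 ^ L * 1 ≤ 2 ^ L * (b * (q * t * (t + S))) := Nat.mul_le_mul_left _ h1
    have h4 : 2 ^ L * (220 * (b * (q * t * (t + S))) + 3) + 2 + 3 + 1 ≤
        300 * (2 ^ L * (b * (q * t * (t + S)))) := by
      rw [mul_add]
      nlinarith
    have := Nat.mul_le_mul_left L h4
    rw [tournamentTime]
    omega

/-! ## The program: output and initialization -/

/-- Compute the labeling of the winner and the number of edges it satisfies. -/
def labelProg : Prog :=
  .seq (.seq (.load 66 9 63) (selectArm 66)) <| .seq prepare <|
  .seq (.forLt 70 0 (.seq (.copy 20 70) <| .seq evalX (.store 1 70 28))) <|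
  .seq (.forLt 71 1 (.seq (.copy 21 71) <| .seq evalY (.store 2 71 28))) <|
  .seq (.const 72 0) <| .forLt 70 0 <| .forLt 71 1 <|
    .seq (.seq (.load 73 1 70) (.load 74 2 71)) <|
    .seq (lookup 70 71 73 74) (.arith .plus 72 72 24)

/-- Report failure unless enough edges are satisfied. -/
def checkProg : Prog :=
  .seq (.seq (.arith .times 75 0 1) <| .seq (.arith .times 76 4 6) <| .seq (.arith .times 77 72 76) <|
    .seq (.arith .times 78 75 3) <| .seq (.arith .times 78 78 6) <| .seq (.arith .plus 77 77 78) <|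
    .seq (.const 79 12) <| .seq (.arith .times 79 79 5) <| .seq (.arith .times 79 79 75) <|
    .seq (.arith .times 79 79 4) <| .seq (.arith .plus 77 77 79) (.arith .times 76 75 76)) <|
  .ifLt 77 76 (.const 0 0) (.const 0 1)

/-- Set register `l` to the binary logarithm (rounded up) of register `x`, register `p` to the
corresponding power of two. -/
def log2Prog (x p l : ℕ) : Prog :=
  .seq (.seq (.const p 1) <| .seq (.const l 0) (.const 54 1)) <|
  .whileLt p x (.seq (.arith .plus p p p) (.arith .plus l l 54))

/-- The test is `c / (m n) < 1 - p₀ / d₀ - 12 p / d` multiplied by `m n d₀ d`, with the subtracted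
terms moved to the left so that only natural numbers occur. -/
theorem checkProg_run {w m n p₀ d₀ p d c : ℕ} {s : Config} (h0 : s.reg 0 = m) (h1 : s.reg 1 = n)
    (h3 : s.reg 3 = p₀) (h4 : s.reg 4 = d₀) (h5 : s.reg 5 = p) (h6 : s.reg 6 = d)
    (h72 : s.reg 72 = c) (hc : c ≤ m * n) (hm : 0 < m) (hn : 0 < n) (hd₀ : 0 < d₀) (hd : 0 < d)
    (hw : m * n * (d₀ * d) + m * n * p₀ * d + 12 * p * (m * n) * d₀ + 12 < 2 ^ w) :
    Run w checkProg s 15 fun s' => s'.reg 0 =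
      if c * (d₀ * d) + m * n * p₀ * d + 12 * p * (m * n) * d₀ < m * n * (d₀ * d) then 0 else 1 := by
  have hmn : 0 < m * n := Nat.mul_pos hm hn
  have a1 : m * n ≤ m * n * (d₀ * d) := Nat.le_mul_of_pos_right _ (Nat.mul_pos hd₀ hd)
  have a2 : d₀ * d ≤ m * n * (d₀ * d) := Nat.le_mul_of_pos_left _ hmn
  have a3 : c * (d₀ * d) ≤ m * n * (d₀ * d) := Nat.mul_le_mul_right _ hc
  have a4 : m * n * p₀ ≤ m * n * p₀ * d := Nat.le_mul_of_pos_right _ hd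
  have a5 : 12 * p ≤ 12 * p * (m * n) := Nat.le_mul_of_pos_right _ hmn
  have a6 : 12 * p * (m * n) ≤ 12 * p * (m * n) * d₀ := Nat.le_mul_of_pos_right _ hd₀
  have b1 : m * n % 2 ^ w = m * n := Nat.mod_eq_of_lt (by omega)
  have b2 : d₀ * d % 2 ^ w = d₀ * d := Nat.mod_eq_of_lt (by omega)
  have b3 : c * (d₀ * d) % 2 ^ w = c * (d₀ * d) := Nat.mod_eq_of_lt (by omega)
  have b4 : m * n * p₀ % 2 ^ w = m * n * p₀ := Nat.mod_eq_of_lt (by omega)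
  have b5 : m * n * p₀ * d % 2 ^ w = m * n * p₀ * d := Nat.mod_eq_of_lt (by omega)
  have b6 : (c * (d₀ * d) + m * n * p₀ * d) % 2 ^ w = c * (d₀ * d) + m * n * p₀ * d :=
    Nat.mod_eq_of_lt (by omega)
  have b7 : 12 % 2 ^ w = 12 := Nat.mod_eq_of_lt (by omega)
  have b8 : 12 * p % 2 ^ w = 12 * p := Nat.mod_eq_of_lt (by omega)
  have b9 : 12 * p * (m * n) % 2 ^ w = 12 * p * (m * n) := Nat.mod_eq_of_lt (by omega)
  have b10 : 12 * p * (m * n) * d₀ % 2 ^ w = 12 * p * (m * n) * d₀ := Nat.mod_eq_of_lt (by omega)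
  have b11 : (c * (d₀ * d) + m * n * p₀ * d + 12 * p * (m * n) * d₀) % 2 ^ w =
    c * (d₀ * d) + m * n * p₀ * d + 12 * p * (m * n) * d₀ := Nat.mod_eq_of_lt (by omega)
  have b12 : m * n * (d₀ * d) % 2 ^ w = m * n * (d₀ * d) := Nat.mod_eq_of_lt (by omega)
  have b13 : 1 % 2 ^ w = 1 := Nat.mod_eq_of_lt (by omega)
  refine Run.le (T := 12 + (1 + 1)) (Run.seq (Q' := fun s' =>
    s'.reg 77 = c * (d₀ * d) + m * n * p₀ * d + 12 * p * (m * n) * d₀ ∧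
    s'.reg 76 = m * n * (d₀ * d)) ((Run.straight rfl ?_).le (by rfl)) fun s₁ h₁ _ =>
    Run.ifLt (fun hlt => ?_) (fun hlt => ?_)) (by omega)
  · simp [Prog.sem, Config.setReg, WordOp.eval, h0, h1, h3, h4, h5, h6, h72, b1, b2, b3, b4, b5, b6,
      b7, b8, b9, b10, b11, b12]
  · rw [h₁.1, h₁.2] at hlt
    exact (Run.straight rfl (by simp [Prog.sem, Config.setReg, hlt])).le (by rfl)
  · rw [h₁.1, h₁.2] at hlt
    exact (Run.straight rfl (by simp [Prog.sem, Config.setReg, hlt, b13])).le (by rfl)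

/-- The guard `2 ^ k < v` holds exactly for `k` below the rounded-up logarithm. The last doubling
starts below `v`, so `2 * v < 2 ^ w` excludes an overflow. -/
theorem log2Prog_run {w x p l v : ℕ} {s : Config} (hpl : p ≠ l) (hp : p ≠ 54) (hl : l ≠ 54)
    (hxp : x ≠ p) (hxl : x ≠ l) (hx54 : x ≠ 54) (hx : s.reg x = v) (hv : 1 < v)
    (hw : 2 * v < 2 ^ w) :
    Run w (log2Prog x p l) s (3 * Nat.clog 2 v + 4) fun s' =>
      s'.reg p = 2 ^ Nat.clog 2 v ∧ s'.reg l = Nat.clog 2 v := by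
  have hlp := hpl.symm
  have hpow : ∀ k < Nat.clog 2 v, 2 ^ k < v := fun k hk =>
    (Nat.lt_clog_iff_pow_lt (by decide)).mp hk
  have h1 : 1 % 2 ^ w = 1 := Nat.mod_eq_of_lt (by omega)
  refine Run.le (T := 3 + (Nat.clog 2 v * (2 + 1) + 1)) (Run.seq (Q' := fun s' =>
    s'.reg p = 1 ∧ s'.reg l = 0 ∧ s'.reg 54 = 1) ((Run.straight rfl ?_).le (by rfl))
    fun s₁ h₁ hf₁ => ?_) (by omega)
  · simp [Prog.sem, Config.setReg, h1, hpl, hp, hl]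
  · have hx₁ : s₁.reg x = v := by
      rw [hf₁.reg x (by simp [Prog.writes, hxp, hxl, hx54]), hx]
    refine (Run.whileLt (fun k s' => s'.reg p = 2 ^ k ∧ s'.reg l = k) (Nat.clog 2 v) 2
      ⟨h₁.1, h₁.2.1⟩ ?_ ?_).mono le_rfl fun s' h' => h'
    · rintro k hk s₂ hf₂ ⟨hp₂, hl₂⟩
      have hx₂ : s₂.reg x = v := by rw [hf₂.reg x (by simp [Prog.writes, hxp, hxl]), hx₁]
      have h54 : s₂.reg 54 = 1 := by
        rw [hf₂.reg 54 (by simp [Prog.writes, hp.symm, hl.symm]), h₁.2.2]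
      have hk' := hpow k hk
      have hk2 : k < 2 ^ k := Nat.lt_two_pow_self
      refine ⟨by rw [hp₂, hx₂]; exact hk', (Run.straight rfl ?_).le (by rfl)⟩
      have r1 : (2 ^ k + 2 ^ k) % 2 ^ w = 2 ^ (k + 1) := by
        rw [Nat.mod_eq_of_lt (by omega)]
        ring
      have r2 : (k + 1) % 2 ^ w = k + 1 := Nat.mod_eq_of_lt (by omega)
      simp [Prog.sem, Config.setReg, WordOp.eval, hp₂, hl₂, h54, hlp, hp.symm, hpl, r1, r2]
    · rintro s₂ hf₂ ⟨hp₂, -⟩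
      have hx₂ : s₂.reg x = v := by rw [hf₂.reg x (by simp [Prog.writes, hxp, hxl]), hx₁]
      rw [hp₂, hx₂, not_lt]
      exact Nat.le_pow_clog (by decide) _

variable {w m n q t b N s₀ : ℕ} {s : Config} {τ : List Bool}

/-- Labels are computed once per vertex and stored, so that the exact count spends constant time per
edge. Only the winner is counted this way, which keeps the dependence on `m n` linear. -/
theorem labelProg_run (h : GEnv w m n q t b N s₀ s) (hL : Loaded m n q t b s₀ τ N s) {c : ℕ}
    (hc : c < N) (h63 : s.reg 63 = 0) (h9 : s.arr 9 0 = c) (hmn : m * n < 2 ^ w) :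
    Run w labelProg s (150 * (m * n * (q * t * t))) fun s' =>
      (∀ x < m, s'.arr 1 x = bestX (tableAt n q (s.arr 0)) q t (sampleY t s₀ (itemAt b m n τ) c)
        (sampleLab (tableAt n q (s.arr 0)) q t s₀ (itemAt b m n τ) c) x) ∧
      (∀ y < n, s'.arr 2 y = respY (tableAt n q (s.arr 0)) q t (sampleY t s₀ (itemAt b m n τ) c)
        (sampleLab (tableAt n q (s.arr 0)) q t s₀ (itemAt b m n τ) c)
        (sampleX t s₀ (itemAt b m n τ) c) y) ∧
      s'.reg 72 = ∑ x ∈ Finset.range m, ∑ y ∈ Finset.range n,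
        hit (tableAt n q (s.arr 0)) q t (sampleY t s₀ (itemAt b m n τ) c)
        (sampleLab (tableAt n q (s.arr 0)) q t s₀ (itemAt b m n τ) c)
        (sampleX t s₀ (itemAt b m n τ) c) x y := by
  have hm0 := h.m_pos
  have hn0 := h.n_pos
  have hq0 := h.q_pos
  have ht0 := h.t_pos
  set Y := sampleY t s₀ (itemAt b m n τ) c with hY
  set X := sampleX t s₀ (itemAt b m n τ) c with hX
  set tb := tableAt n q (s.arr 0) with htb
  set lab := sampleLab tb q t s₀ (itemAt b m n τ) c with hlab
  have hle : ∀ x y, hit tb q t Y lab X x y ≤ 1 := fun _ _ => hit_le (fun _ _ _ _ => h.table_le _) _ _ _ _ _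
  refine Run.le (T := 4 + (40 * (q * t * t) + ((m * ((1 + (30 * (q * t) + 1)) + 3) + 2) +
    ((n * ((1 + (30 * (q * t) + 1)) + 3) + 2) + (1 + (m * ((n * ((2 + (7 + 1)) + 3) + 2) + 3) + 2))))))
    (Run.seq (Q' := fun s' => s'.reg 29 = c * (2 * t) ∧ s'.reg 30 = (c + 1) * t)
    ((Run.straight rfl ?_).le (by rfl)) fun s₁ h₁ hf₁ => ?_) ?_
  · rw [Prog.sem, selectArm_sem (c := c) (r := 66) (t := t) (N := N) ?_ ?_ ?_ h.t_pos h.N_lt ?_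
      hc (by decide)]
    all_goals simp [Prog.sem, Config.setReg, h.one_eq, h.tt_eq, h.t_eq, h63, h9]
  have hE₁ := h.frame hf₁ rfl rfl
  have hL₁ := hL.frame hf₁ rfl
  have hA₁ := hL₁.armOK hE₁ hc le_rfl
  refine Run.seq (prepare_run hE₁.toEnv hA₁ h₁.1 h₁.2) fun s₂ h₂ hf₂ => ?_
  have hE₂ := hE₁.frame hf₂ rfl rfl
  have hL₂ := hL₁.frame hf₂ rfl
  have a0 : s₂.arr 0 = s.arr 0 := by rw [hf₂.arr 0 rfl, hf₁.arr 0 rfl]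
  have hfx : ∀ k < t, s₂.arr 6 k = bestX tb q t Y lab (X k) := fun k hk => by
    rw [h₂ k hk, hL₁.xs c hc k hk, hf₁.arr 0 rfl]
    refine bestX_congr (hL₁.ys c hc) (fun k hk => ?_) _
    rw [hL₁.lab c hc k hk, hf₁.arr 0 rfl]
  have e29 : s₂.reg 29 = c * (2 * t) := by rw [hf₂.reg 29 rfl, h₁.1]
  have e30 : s₂.reg 30 = (c + 1) * t := by rw [hf₂.reg 30 rfl, h₁.2]
  refine Run.seq (Run.forLt (fun i s' => ∀ x < i, s'.arr 1 x = bestX tb q t Y lab x) m _ rfl rfl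
    (by decide) (by decide) (by decide) h.m_lt hE₂.m_eq (by simp) ?_ ?_) fun s₃ h₃ hf₃ => ?_
  · intro i hi s₃ hf₃ h₃ h70
    have hE₃ := hE₂.frame hf₃ rfl rfl
    have hL₃ := hL₂.frame hf₃ rfl
    refine Run.seq (Q' := fun s' => s'.reg 20 = i) ((Run.straight rfl ?_).le (by rfl))
      fun s₄ h₄ hf₄ => ?_
    · simp [Prog.sem, Config.setReg, h70]
    have hE₄ := hE₃.frame hf₄ rfl rfl
    have hL₄ := hL₃.frame hf₄ rfl
    refine Run.seq (evalX_run hE₄.toEnv (hL₄.armOK hE₄ hc le_rfl)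
      (by rw [hf₄.reg 29 rfl, hf₃.reg 29 rfl, e29]) (by rw [hf₄.reg 30 rfl, hf₃.reg 30 rfl, e30])
      (by omega)) fun s₅ h₅ hf₅ => (Run.straight rfl ?_).le (by rfl)
    have f0 : s₄.arr 0 = s.arr 0 := by rw [hf₄.arr 0 rfl, hf₃.arr 0 rfl, a0]
    have e28 : s₅.reg 28 = bestX tb q t Y lab i := by
      rw [h₅, f0, h₄]
      refine bestX_congr (hL₄.ys c hc) (fun k hk => ?_) _
      rw [hL₄.lab c hc k hk, f0]
    have e70 : s₅.reg 70 = i := by rw [hf₅.reg 70 rfl, hf₄.reg 70 rfl, h70]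
    intro x hx
    simp only [Prog.sem, Config.setArr, Function.update_self, e28, e70]
    rcases Nat.lt_succ_iff_lt_or_eq.mp hx with hx | rfl
    · rw [Function.update_of_ne hx.ne, hf₅.arr 1 rfl, hf₄.arr 1 rfl, h₃ x hx]
    · simp
  · intro k s' v h'
    simpa [Config.setReg] using h'
  have hE₃ := hE₂.frame hf₃ rfl rfl
  have hL₃ := hL₂.frame hf₃ rfl
  refine Run.seq (Run.forLt (fun i s' => ∀ y < i, s'.arr 2 y = respY tb q t Y lab X y) n _ rfl rfl
    (by decide) (by decide) (by decide) h.n_lt hE₃.n_eq (by simp) ?_ ?_) fun s₄ h₄ hf₄ => ?_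
  · intro i hi s₄ hf₄ h₄ h71
    have hE₄ := hE₃.frame hf₄ rfl rfl
    have hL₄ := hL₃.frame hf₄ rfl
    refine Run.seq (Q' := fun s' => s'.reg 21 = i) ((Run.straight rfl ?_).le (by rfl))
      fun s₅ h₅ hf₅ => ?_
    · simp [Prog.sem, Config.setReg, h71]
    have hE₅ := hE₄.frame hf₅ rfl rfl
    have hL₅ := hL₄.frame hf₅ rfl
    have f6 : s₅.arr 6 = s₂.arr 6 := by rw [hf₅.arr 6 rfl, hf₄.arr 6 rfl, hf₃.arr 6 rfl]
    refine Run.seq (evalY_run hE₅.toEnv (hL₅.armOK hE₅ hc le_rfl)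
      (by rw [hf₅.reg 29 rfl, hf₄.reg 29 rfl, hf₃.reg 29 rfl, e29])
      (by omega) (fun k hk => by rw [f6, hfx k hk]; exact bestX_lt hq0 _ _ _))
      fun s₆ h₆ hf₆ => (Run.straight rfl ?_).le (by rfl)
    have f0 : s₅.arr 0 = s.arr 0 := by rw [hf₅.arr 0 rfl, hf₄.arr 0 rfl, hf₃.arr 0 rfl, a0]
    have e28 : s₆.reg 28 = respY tb q t Y lab X i := by
      rw [h₆, f0, h₅, f6]
      exact bestY_congr (hL₅.xs c hc) (fun k hk => hfx k hk) _
    have e71 : s₆.reg 71 = i := by rw [hf₆.reg 71 rfl, hf₅.reg 71 rfl, h71]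
    intro y hy
    simp only [Prog.sem, Config.setArr, Function.update_self, e28, e71]
    rcases Nat.lt_succ_iff_lt_or_eq.mp hy with hy | rfl
    · rw [Function.update_of_ne hy.ne, hf₆.arr 2 rfl, hf₅.arr 2 rfl, h₄ y hy]
    · simp
  · intro k s' v h'
    simpa [Config.setReg] using h'
  have hE₄ := hE₃.frame hf₄ rfl rfl
  refine Run.seq (Q' := fun s' => s'.reg 72 = 0) ((Run.straight rfl ?_).le (by rfl))
    fun s₅ h₅ hf₅ => ?_
  · simp [Prog.sem, Config.setReg]
  have hE₅ := hE₄.frame hf₅ rfl rfl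
  have a1 : ∀ x < m, s₅.arr 1 x = bestX tb q t Y lab x := by
    rw [hf₅.arr 1 rfl, hf₄.arr 1 rfl]
    exact h₃
  have a2 : ∀ y < n, s₅.arr 2 y = respY tb q t Y lab X y := by
    rw [hf₅.arr 2 rfl]
    exact h₄
  have g0 : s₅.arr 0 = s.arr 0 := by rw [hf₅.arr 0 rfl, hf₄.arr 0 rfl, hf₃.arr 0 rfl, a0]
  refine (Run.forLt (fun i s' => s'.reg 72 = ∑ x ∈ Finset.range i, ∑ y ∈ Finset.range n,
    hit tb q t Y lab X x y) m _ rfl rfl (by decide) (by decide) (by decide) h.m_lt hE₅.m_eq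
    (by simpa [Config.setReg] using h₅) ?_ ?_).post fun s' h' hf' => ⟨?_, ?_, h'⟩
  · intro i hi s₆ hf₆ h₆ h70
    have hE₆ := hE₅.frame hf₆ rfl rfl
    refine (Run.forLt (fun j s' => s'.reg 72 = (∑ x ∈ Finset.range i, ∑ y ∈ Finset.range n,
      hit tb q t Y lab X x y) + ∑ y ∈ Finset.range j, hit tb q t Y lab X i y) n _ rfl rfl
      (by decide) (by decide) (by decide) h.n_lt hE₆.n_eq (by simpa [Config.setReg] using h₆)
      ?_ ?_).mono le_rfl fun s' h' => by rw [h', Finset.sum_range_succ]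
    · intro j hj s₇ hf₇ h₇ h71
      have hE₇ := hE₆.frame hf₇ rfl rfl
      have i70 : s₇.reg 70 = i := by rw [hf₇.reg 70 rfl, h70]
      refine Run.seq (Q' := fun s' => s'.reg 73 = bestX tb q t Y lab i ∧
        s'.reg 74 = respY tb q t Y lab X j) ((Run.straight rfl ?_).le (by rfl)) fun s₈ h₈ hf₈ => ?_
      · simp [Prog.sem, Config.setReg, i70, h71, hf₇.arr 1 rfl, hf₆.arr 1 rfl, a1 i hi,
          hf₇.arr 2 rfl, hf₆.arr 2 rfl, a2 j hj]
      have j70 : s₈.reg 70 = i := by rw [hf₈.reg 70 rfl, i70]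
      have j71 : s₈.reg 71 = j := by rw [hf₈.reg 71 rfl, h71]
      refine Run.seq (P := lookup 70 71 73 74) (P' := .arith .plus 72 72 24)
        (lookup_run (hE₇.frame hf₈ rfl rfl).toEnv (by decide) (by decide) (by decide)
        (by omega) (by omega) (by rw [h₈.1]; exact bestX_lt hq0 _ _ _)
        (by rw [h₈.2]; exact respY_lt hq0 _ _ _ _)) fun s₉ h₉ hf₉ =>
        (Run.straight rfl ?_).le (by rfl)
      have k24 : s₉.reg 24 = hit tb q t Y lab X i j := by
        rw [h₉, j70, j71, h₈.1, h₈.2, hf₈.arr 0 rfl, hf₇.arr 0 rfl, hf₆.arr 0 rfl, g0, hit]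
      have k72 : s₉.reg 72 = (∑ x ∈ Finset.range i, ∑ y ∈ Finset.range n,
          hit tb q t Y lab X x y) + ∑ y ∈ Finset.range j, hit tb q t Y lab X i y := by
        rw [hf₉.reg 72 rfl, hf₈.reg 72 rfl, h₇]
      have b1 : ∑ x ∈ Finset.range i, ∑ y ∈ Finset.range n, hit tb q t Y lab X x y ≤ i * n := by
        refine (Finset.sum_le_card_nsmul _ _ n fun x _ => ?_).trans (by simp)
        exact (Finset.sum_le_card_nsmul _ _ 1 fun y _ => hle x y).trans (by simp)
      have b2 : ∑ y ∈ Finset.range j, hit tb q t Y lab X i y ≤ j :=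
        (Finset.sum_le_card_nsmul _ _ 1 fun y _ => hle i y).trans (by simp)
      have b3 := hle i j
      have b4 : (i + 1) * n ≤ m * n := Nat.mul_le_mul_right _ hi
      rw [add_mul, one_mul] at b4
      simp only [Prog.sem, Config.setReg, WordOp.eval, Function.update_self, k24, k72]
      rw [Nat.mod_eq_of_lt (by omega), Finset.sum_range_succ, add_assoc]
    · intro k s' v h'
      simpa [Config.setReg] using h'
  · intro k s' v h'
    simpa [Config.setReg] using h'
  · rw [hf'.arr 1 rfl]
    exact a1
  · rw [hf'.arr 2 rfl]
    exact a2
  · have hqt : 0 < q * t := Nat.mul_pos hq0 ht0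
    have c1 : q * t ≤ q * t * t := Nat.le_mul_of_pos_right _ ht0
    have c2 : m ≤ m * n := Nat.le_mul_of_pos_right _ hn0
    have c3 : n ≤ m * n := Nat.le_mul_of_pos_left _ hm0
    have c4 : m * n * 1 ≤ m * n * (q * t * t) := Nat.mul_le_mul_left _ (by omega)
    have c5 : m * (q * t) ≤ m * n * (q * t * t) := Nat.mul_le_mul c2 c1
    have c6 : n * (q * t) ≤ m * n * (q * t * t) := Nat.mul_le_mul c3 c1
    have c7 : 1 * (q * t * t) ≤ m * n * (q * t * t) := Nat.mul_le_mul_right _ (by omega)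
    nlinarith

/-! ## The whole program -/

/-- The inverse of the accuracy `p / d`, rounded up generously. -/
def invEps (p d : ℕ) : ℕ := d / p + 1

/-- The size of the samples. -/
def sampleSize (q e : ℕ) : ℕ := 32 * e * e * Nat.clog 2 (q * e)

/-- The number of bits of the random numbers. -/
def bitLength (m n e : ℕ) : ℕ := Nat.clog 2 (8 * e * (m + n))

/-- The number of rounds of the tournament. -/
def numRounds (m n q : ℕ) : ℕ := Nat.clog 2 (2 * m * n * q * q + 2)

/-- The number of edges on which the labelings of a sample are compared. -/
def groupEdges (q e : ℕ) : ℕ := 8 * e * e * q * sampleSize q e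

/-- The number of edges per match in the first round. -/
def matchEdges (e L : ℕ) : ℕ := 128 * e * e * L * L * L

/-- Compute the parameters. -/
def setupProg : Prog :=
  .seq (.seq (.arith .quot 8 6 5) <| .seq (.arith .plus 8 8 7) (.arith .times 80 2 8)) <|
  .seq (log2Prog 80 81 82) <|
  .seq (.seq (.const 83 32) <| .seq (.arith .times 9 83 8) <| .seq (.arith .times 9 9 8) <|
    .seq (.arith .times 9 9 82) <| .seq (.arith .plus 15 9 9) <| .seq (.const 83 8) <|
    .seq (.arith .times 80 83 8) <| .seq (.arith .plus 84 0 1) (.arith .times 80 80 84)) <|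
  .seq (log2Prog 80 10 85) <|
  .seq (.seq (.const 83 2) <| .seq (.arith .times 80 83 0) <| .seq (.arith .times 80 80 1) <|
    .seq (.arith .times 80 80 2) <| .seq (.arith .times 80 80 2) (.arith .plus 80 80 83)) <|
  .seq (log2Prog 80 11 12) <|
  .seq (.const 83 8) <| .seq (.arith .times 13 83 8) <| .seq (.arith .times 13 13 8) <|
    .seq (.arith .times 13 13 2) <| .seq (.arith .times 13 13 9) <|
    .seq (.const 83 128) <| .seq (.arith .times 14 83 8) <| .seq (.arith .times 14 14 8) <|
    .seq (.arith .times 14 14 12) <| .seq (.arith .times 14 14 12) (.arith .times 14 14 12)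

/-- The algorithm. -/
def solveProg : Prog :=
  .seq (.seq (.const 7 1) (.const 83 2)) <| .ifLt 2 83 (.const 0 1) <| .ifLt 5 6
    (.seq setupProg <| .seq (.forLt 46 11 groupProg) <| .seq tournament <|
      .seq labelProg checkProg)
    (.const 0 1)

/-- All numbers that occur fit into words. -/
structure Fits (w m n q p₀ d₀ p d : ℕ) : Prop where
  qe : 2 * (q * invEps p d) < 2 ^ w
  t : 2 * sampleSize q (invEps p d) < 2 ^ w
  U : 2 * (8 * invEps p d * (m + n)) < 2 ^ w
  N : 2 * (2 * m * n * q * q + 2) < 2 ^ w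
  s₀ : groupEdges q (invEps p d) < 2 ^ w
  S : 2 ^ numRounds m n q * matchEdges (invEps p d) (numRounds m n q) < 2 ^ w
  samples : (2 ^ numRounds m n q + 1) * (2 * sampleSize q (invEps p d)) < 2 ^ w
  check : m * n * (d₀ * d) + m * n * p₀ * d + 12 * p * (m * n) * d₀ + 12 < 2 ^ w
  const : 128 < 2 ^ w

theorem setupProg_run {w m n q p d : ℕ} {s : Config} (h0 : s.reg 0 = m) (h1 : s.reg 1 = n)
    (h2 : s.reg 2 = q) (h5 : s.reg 5 = p) (h6 : s.reg 6 = d) (h7 : s.reg 7 = 1) (hm : 0 < m)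
    (hn : 0 < n) (hq : 1 < q) (hqe : 2 * (q * invEps p d) < 2 ^ w)
    (ht : 2 * sampleSize q (invEps p d) < 2 ^ w) (hU : 2 * (8 * invEps p d * (m + n)) < 2 ^ w)
    (hN : 2 * (2 * m * n * q * q + 2) < 2 ^ w) (hs₀ : groupEdges q (invEps p d) < 2 ^ w)
    (hS : matchEdges (invEps p d) (numRounds m n q) < 2 ^ w)
    (hsm : (2 ^ numRounds m n q + 1) * (2 * sampleSize q (invEps p d)) < 2 ^ w)
    (hc : 128 < 2 ^ w) (ha : ∀ i, s.arr 0 i ≤ 1) :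
    Run w setupProg s (3 * (Nat.clog 2 (q * invEps p d) + bitLength m n (invEps p d) +
      numRounds m n q) + 41) fun s' =>
      GEnv w m n q (sampleSize q (invEps p d)) (bitLength m n (invEps p d))
        (2 ^ numRounds m n q) (groupEdges q (invEps p d)) s' ∧
      s'.reg 14 = matchEdges (invEps p d) (numRounds m n q) := by
  set e := invEps p d with he
  have he0 : 0 < e := Nat.succ_pos _
  set l := Nat.clog 2 (q * e) with hl
  have hqe2 : 1 < q * e := lt_of_lt_of_le hq (Nat.le_mul_of_pos_right _ he0)
  have hl0 : 0 < l := Nat.clog_pos (by decide) hqe2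
  have hqle : q ≤ q * e := Nat.le_mul_of_pos_right _ he0
  have hele : e ≤ q * e := Nat.le_mul_of_pos_left _ (by omega)
  have hdp : d / p + 1 = e := rfl
  refine Run.le (T := 3 + ((3 * l + 4) + (9 + ((3 * bitLength m n e + 4) + (6 +
    ((3 * numRounds m n q + 4) + 11)))))) (Run.seq (Q' := fun s' => s'.reg 8 = e ∧
      s'.reg 80 = q * e) ((Run.straight rfl ?_).le (by rfl)) fun s₁ hs₁ hf₁ => ?_) (by omega)
  · have r1 : d / p % 2 ^ w = d / p := Nat.mod_eq_of_lt (by omega)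
    have r2 : e % 2 ^ w = e := Nat.mod_eq_of_lt (by omega)
    have r3 : q * e % 2 ^ w = q * e := Nat.mod_eq_of_lt (by omega)
    simp [Prog.sem, Config.setReg, WordOp.eval, h2, h5, h6, h7, r1, hdp, r2, r3]
  refine Run.seq (log2Prog_run (by decide) (by decide) (by decide) (by decide) (by decide)
    (by decide) hs₁.2 hqe2 hqe) fun s₂ hs₂ hf₂ => ?_
  have e8 : s₂.reg 8 = e := by rw [hf₂.reg 8 rfl, hs₁.1]
  have e0 : s₂.reg 0 = m := by rw [hf₂.reg 0 rfl, hf₁.reg 0 rfl, h0]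
  have e1 : s₂.reg 1 = n := by rw [hf₂.reg 1 rfl, hf₁.reg 1 rfl, h1]
  refine Run.seq (Q' := fun s' => s'.reg 9 = sampleSize q e ∧ s'.reg 15 = 2 * sampleSize q e ∧
    s'.reg 80 = 8 * e * (m + n)) ((Run.straight rfl ?_).le (by rfl)) fun s₃ hs₃ hf₃ => ?_
  · have a1 : 32 * e * e ≤ sampleSize q e := Nat.le_mul_of_pos_right _ hl0
    have a2 : 32 * e ≤ 32 * e * e := Nat.le_mul_of_pos_right _ he0
    have a3 : 8 * e ≤ 8 * e * (m + n) := Nat.le_mul_of_pos_right _ (by omega)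
    have a4 : m + n ≤ 8 * e * (m + n) := Nat.le_mul_of_pos_left _ (by omega)
    have r0 : 32 % 2 ^ w = 32 := Nat.mod_eq_of_lt (by omega)
    have r1 : 32 * e % 2 ^ w = 32 * e := Nat.mod_eq_of_lt (by omega)
    have r2 : 32 * e * e % 2 ^ w = 32 * e * e := Nat.mod_eq_of_lt (by omega)
    have hT : sampleSize q e = 32 * e * e * l := rfl
    rw [hT] at ht a1 ⊢
    have r3 : 32 * e * e * l % 2 ^ w = 32 * e * e * l := Nat.mod_eq_of_lt (by omega)
    have r4 : (32 * e * e * l + 32 * e * e * l) % 2 ^ w = 2 * (32 * e * e * l) := by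
      rw [Nat.mod_eq_of_lt (by omega), two_mul]
    have r5 : 8 % 2 ^ w = 8 := Nat.mod_eq_of_lt (by omega)
    have r6 : 8 * e % 2 ^ w = 8 * e := Nat.mod_eq_of_lt (by omega)
    have r7 : (m + n) % 2 ^ w = m + n := Nat.mod_eq_of_lt (by omega)
    have r8 : 8 * e * (m + n) % 2 ^ w = 8 * e * (m + n) := Nat.mod_eq_of_lt (by omega)
    simp [Prog.sem, Config.setReg, WordOp.eval, e8, e0, e1, hs₂.2, ← hl, r0, r1, r2, r3, r4, r5, r6, r7,
      r8]
  have hU1 : 1 < 8 * e * (m + n) := by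
    have : 8 * e * 1 ≤ 8 * e * (m + n) := Nat.mul_le_mul_left _ (by omega)
    omega
  refine Run.seq (log2Prog_run (by decide) (by decide) (by decide) (by decide) (by decide)
    (by decide) hs₃.2.2 hU1 hU) fun s₄ hs₄ hf₄ => ?_
  refine Run.seq (Q' := fun s' => s'.reg 80 = 2 * m * n * q * q + 2)
    ((Run.straight rfl ?_).le (by rfl)) fun s₅ hs₅ hf₅ => ?_
  · have a1 : 2 * m ≤ 2 * m * n := Nat.le_mul_of_pos_right _ hn
    have a2 : 2 * m * n ≤ 2 * m * n * q := Nat.le_mul_of_pos_right _ (by omega)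
    have a3 : 2 * m * n * q ≤ 2 * m * n * q * q := Nat.le_mul_of_pos_right _ (by omega)
    have r0 : 2 % 2 ^ w = 2 := Nat.mod_eq_of_lt (by omega)
    have r1 : 2 * m % 2 ^ w = 2 * m := Nat.mod_eq_of_lt (by omega)
    have r2 : 2 * m * n % 2 ^ w = 2 * m * n := Nat.mod_eq_of_lt (by omega)
    have r3 : 2 * m * n * q % 2 ^ w = 2 * m * n * q := Nat.mod_eq_of_lt (by omega)
    have r4 : 2 * m * n * q * q % 2 ^ w = 2 * m * n * q * q := Nat.mod_eq_of_lt (by omega)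
    have r5 : (2 * m * n * q * q + 2) % 2 ^ w = 2 * m * n * q * q + 2 :=
      Nat.mod_eq_of_lt (by omega)
    have f0 : s₄.reg 0 = m := by rw [hf₄.reg 0 rfl, hf₃.reg 0 rfl, e0]
    have f1 : s₄.reg 1 = n := by rw [hf₄.reg 1 rfl, hf₃.reg 1 rfl, e1]
    have f2 : s₄.reg 2 = q := by
      rw [hf₄.reg 2 rfl, hf₃.reg 2 rfl, hf₂.reg 2 rfl, hf₁.reg 2 rfl, h2]
    simp [Prog.sem, Config.setReg, WordOp.eval, f0, f1, f2, r0, r1, r2, r3, r4, r5]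
  refine Run.seq (log2Prog_run (by decide) (by decide) (by decide) (by decide) (by decide)
    (by decide) hs₅ (by omega) hN) fun s₆ hs₆ hf₆ => ?_
  have hL0 : 0 < numRounds m n q := Nat.clog_pos (by decide) (by omega)
  set L := numRounds m n q with hL
  have f8 : s₆.reg 8 = e := by
    rw [hf₆.reg 8 rfl, hf₅.reg 8 rfl, hf₄.reg 8 rfl, hf₃.reg 8 rfl, e8]
  have f2 : s₆.reg 2 = q := by
    rw [hf₆.reg 2 rfl, hf₅.reg 2 rfl, hf₄.reg 2 rfl, hf₃.reg 2 rfl, hf₂.reg 2 rfl, hf₁.reg 2 rfl, h2]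
  have f9 : s₆.reg 9 = sampleSize q e := by
    rw [hf₆.reg 9 rfl, hf₅.reg 9 rfl, hf₄.reg 9 rfl, hs₃.1]
  have f12 : s₆.reg 12 = L := hs₆.2
  have ht0 : 0 < sampleSize q e := by
    unfold sampleSize
    positivity
  refine ((Run.straight (Q := fun s' => s'.reg 13 = groupEdges q e ∧ s'.reg 14 = matchEdges e L)
    rfl ?_).le (by rfl)).post ?_
  · have a1 : 8 * e * e * q ≤ groupEdges q e := Nat.le_mul_of_pos_right _ ht0
    have a2 : 8 * e * e ≤ 8 * e * e * q := Nat.le_mul_of_pos_right _ (by omega)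
    have a3 : 8 * e ≤ 8 * e * e := Nat.le_mul_of_pos_right _ he0
    have a4 : 128 * e ≤ 128 * e * e := Nat.le_mul_of_pos_right _ he0
    have a5 : 128 * e * e ≤ 128 * e * e * L := Nat.le_mul_of_pos_right _ hL0
    have a6 : 128 * e * e * L ≤ 128 * e * e * L * L := Nat.le_mul_of_pos_right _ hL0
    have a7 : 128 * e * e * L * L ≤ matchEdges e L := Nat.le_mul_of_pos_right _ hL0
    have r0 : 8 % 2 ^ w = 8 := Nat.mod_eq_of_lt (by omega)
    have r1 : 8 * e % 2 ^ w = 8 * e := Nat.mod_eq_of_lt (by omega)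
    have r2 : 8 * e * e % 2 ^ w = 8 * e * e := Nat.mod_eq_of_lt (by omega)
    have r3 : 8 * e * e * q % 2 ^ w = 8 * e * e * q := Nat.mod_eq_of_lt (by omega)
    have r4 : 8 * e * e * q * sampleSize q e % 2 ^ w = groupEdges q e := Nat.mod_eq_of_lt hs₀
    have r5 : 128 % 2 ^ w = 128 := Nat.mod_eq_of_lt hc
    have r6 : 128 * e % 2 ^ w = 128 * e := Nat.mod_eq_of_lt (by omega)
    have r7 : 128 * e * e % 2 ^ w = 128 * e * e := Nat.mod_eq_of_lt (by omega)
    have r8 : 128 * e * e * L % 2 ^ w = 128 * e * e * L := Nat.mod_eq_of_lt (by omega)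
    have r9 : 128 * e * e * L * L % 2 ^ w = 128 * e * e * L * L := Nat.mod_eq_of_lt (by omega)
    have r10 : 128 * e * e * L * L * L % 2 ^ w = matchEdges e L := Nat.mod_eq_of_lt hS
    simp [Prog.sem, Config.setReg, WordOp.eval, f2, f8, f9, f12, r0, r1, r2, r3, r4, r5, r6, r7,
      r8, r9, r10]
  · rintro s' ⟨h13, h14⟩ hf₇
    -- Rounding up to a power of two less than doubles a number greater than `1`.
    have hpow : 2 ^ bitLength m n e < 2 * (8 * e * (m + n)) := by
      have := Nat.pow_pred_clog_lt_self (b := 2) (by decide) hU1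
      rw [bitLength]
      have hpos : 0 < Nat.clog 2 (8 * e * (m + n)) := Nat.clog_pos (by decide) hU1
      obtain ⟨k, hk⟩ := Nat.exists_eq_succ_of_ne_zero hpos.ne'
      rw [hk] at this ⊢
      rw [pow_succ]
      simp at this
      omega
    refine ⟨⟨⟨?_, ?_, ?_, ?_, ?_, hm, hn, by omega, ht0, ?_, by omega, ?_⟩, ?_, ?_, h13, ?_, ?_,
      by omega, hsm, hs₀⟩, h14⟩
    · rw [hf₇.reg 0 rfl, hf₆.reg 0 rfl, hf₅.reg 0 rfl, hf₄.reg 0 rfl, hf₃.reg 0 rfl, e0]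
    · rw [hf₇.reg 1 rfl, hf₆.reg 1 rfl, hf₅.reg 1 rfl, hf₄.reg 1 rfl, hf₃.reg 1 rfl, e1]
    · rw [hf₇.reg 2 rfl, f2]
    · rw [hf₇.reg 7 rfl, hf₆.reg 7 rfl, hf₅.reg 7 rfl, hf₄.reg 7 rfl, hf₃.reg 7 rfl,
        hf₂.reg 7 rfl, hf₁.reg 7 rfl, h7]
    · rw [hf₇.reg 9 rfl, f9]
    · have : 2 * m * n * q * q = 2 * (m * n * q * q) := by ring
      omega
    · rw [hf₇.arr 0 rfl, hf₆.arr 0 rfl, hf₅.arr 0 rfl, hf₄.arr 0 rfl, hf₃.arr 0 rfl,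
        hf₂.arr 0 rfl, hf₁.arr 0 rfl]
      exact ha
    · rw [hf₇.reg 10 rfl, hf₆.reg 10 rfl, hf₅.reg 10 rfl, hs₄.1, bitLength]
    · rw [hf₇.reg 11 rfl, hs₆.1, hL, numRounds]
    · rw [hf₇.reg 15 rfl, hf₆.reg 15 rfl, hf₅.reg 15 rfl, hf₄.reg 15 rfl, hs₃.2.1]
    · exact Nat.clog_pos (by decide) hU1

theorem champion_lt (tb : ℕ → ℕ → ℕ → ℕ → ℕ) (q t s₀ : ℕ) (ω : ℕ → ℕ × ℕ) (L S : ℕ) :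
    ∀ i ≤ L, ∀ p < 2 ^ (L - i), champion tb q t s₀ ω L S i p < 2 ^ L := by
  intro i
  induction i with
  | zero => intro _ p hp; simpa [champion] using hp
  | succ i ih =>
    intro hi p hp
    have h : 2 ^ (L - i) = 2 * 2 ^ (L - (i + 1)) := by
      rw [← pow_succ']
      congr 1
      omega
    rw [champion]
    split_ifs <;> exact ih (by omega) _ (by omega)

/-- The running time of the algorithm. -/
def solveTime (m n q e : ℕ) : ℕ :=
  let t := sampleSize q e
  let b := bitLength m n e
  let L := numRounds m n q
  3 * (Nat.clog 2 (q * e) + b + L) +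
    (2 ^ L * (200 * (b * q ^ t * (q * t * (t + groupEdges q e))) + 3) +
    (tournamentTime q t b L (matchEdges e L) + 150 * (m * n * (q * t * t)))) + 65

/-- The group that wins the tournament. -/
def winner (m n q e : ℕ) (a : ℕ → ℕ) (ω : ℕ → ℕ × ℕ) : ℕ :=
  champion (tableAt n q a) q (sampleSize q e) (groupEdges q e) ω (numRounds m n q)
    (matchEdges e (numRounds m n q)) (numRounds m n q) 0

/-- The label of `x` that the algorithm returns. -/
def outX (m n q e : ℕ) (a : ℕ → ℕ) (ω : ℕ → ℕ × ℕ) (x : ℕ) : ℕ :=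
  bestX (tableAt n q a) q (sampleSize q e)
    (sampleY (sampleSize q e) (groupEdges q e) ω (winner m n q e a ω))
    (sampleLab (tableAt n q a) q (sampleSize q e) (groupEdges q e) ω (winner m n q e a ω)) x

/-- The label of `y` that the algorithm returns. -/
def outY (m n q e : ℕ) (a : ℕ → ℕ) (ω : ℕ → ℕ × ℕ) (y : ℕ) : ℕ :=
  respY (tableAt n q a) q (sampleSize q e)
    (sampleY (sampleSize q e) (groupEdges q e) ω (winner m n q e a ω))
    (sampleLab (tableAt n q a) q (sampleSize q e) (groupEdges q e) ω (winner m n q e a ω))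
    (sampleX (sampleSize q e) (groupEdges q e) ω (winner m n q e a ω)) y

/-- The number of edges satisfied by the labeling that the algorithm returns. -/
def outCount (m n q e : ℕ) (a : ℕ → ℕ) (ω : ℕ → ℕ × ℕ) : ℕ :=
  ∑ x ∈ Finset.range m, ∑ y ∈ Finset.range n,
    tableAt n q a x y (outX m n q e a ω x) (outY m n q e a ω y)

theorem outCount_le {m n q e : ℕ} {a : ℕ → ℕ} (ha : ∀ i, a i ≤ 1) (ω : ℕ → ℕ × ℕ) :
    outCount m n q e a ω ≤ m * n := by
  refine (Finset.sum_le_card_nsmul _ _ n fun x _ => ?_).trans (by simp)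
  exact (Finset.sum_le_card_nsmul _ _ 1 fun y _ => ha _).trans (by simp)

/-- This separates the machine from the mathematics: with `ω` the items on the tape, everything the
program returns is given by `outX`, `outY` and `outCount`. The initial zeros of array `5` (from
`ha0`) supply the counter and the empty label cells. -/
theorem solveProg_run {w m n q p₀ d₀ p d : ℕ} {s : Config} {τ : List Bool}
    (h0 : s.reg 0 = m) (h1 : s.reg 1 = n) (h2 : s.reg 2 = q) (h3 : s.reg 3 = p₀)
    (h4 : s.reg 4 = d₀) (h5 : s.reg 5 = p) (h6 : s.reg 6 = d) (ha : ∀ i, s.arr 0 i ≤ 1)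
    (ha0 : ∀ a ≠ 0, ∀ i, s.arr a i = 0) (hτ : s.tape = τ) (hm : 0 < m) (hn : 0 < n) (hq : 1 < q)
    (hd₀ : 0 < d₀) (hpd : p < d) (hF : Fits w m n q p₀ d₀ p d) :
    let e := invEps p d
    let ω := itemAt (bitLength m n e) m n τ
    Run w solveProg s (solveTime m n q e) fun s' =>
      (s'.reg 0 = if outCount m n q e (s.arr 0) ω * (d₀ * d) + m * n * p₀ * d +
        12 * p * (m * n) * d₀ < m * n * (d₀ * d) then 0 else 1) ∧
      (∀ x < m, s'.arr 1 x = outX m n q e (s.arr 0) ω x) ∧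
      ∀ y < n, s'.arr 2 y = outY m n q e (s.arr 0) ω y := by
  intro e ω
  have hw := hF.const
  set t := sampleSize q e with ht
  set b := bitLength m n e with hb
  set L := numRounds m n q with hL
  have hS : matchEdges e L < 2 ^ w :=
    lt_of_le_of_lt (Nat.le_mul_of_pos_left _ (by positivity)) hF.S
  have hL0 : 0 < L := Nat.clog_pos (by decide) (by omega)
  have he0 : 0 < e := Nat.succ_pos _
  have hS0 : 0 < matchEdges e L := by unfold matchEdges; positivity
  refine Run.le (T := 2 + ((3 * (Nat.clog 2 (q * e) + b + L) + 41 +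
    (2 ^ L * (200 * (b * q ^ t * (q * t * (t + groupEdges q e))) + 3) + 2 +
    (tournamentTime q t b L (matchEdges e L) + (150 * (m * n * (q * t * t)) + 15)))) + 1 + 1))
    (Run.seq (Q' := fun s' => s'.reg 7 = 1 ∧ s'.reg 83 = 2) ((Run.straight rfl ?_).le (by rfl))
    fun s₁ hs₁ hf₁ => Run.ifLt (fun hlt => ?_) fun _ => Run.ifLt (fun _ => ?_) fun hlt => ?_) ?_
  · simp [Prog.sem, Config.setReg, Nat.mod_eq_of_lt (show 1 < 2 ^ w by omega),
      Nat.mod_eq_of_lt (show 2 < 2 ^ w by omega)]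
  · rw [hs₁.2, hf₁.reg 2 rfl, h2] at hlt
    omega
  · have a0 : s₁.arr 0 = s.arr 0 := hf₁.arr 0 rfl
    refine Run.seq (setupProg_run (m := m) (n := n) (q := q) (p := p) (d := d)
      (by rw [hf₁.reg 0 rfl, h0]) (by rw [hf₁.reg 1 rfl, h1])
      (by rw [hf₁.reg 2 rfl, h2]) (by rw [hf₁.reg 5 rfl, h5]) (by rw [hf₁.reg 6 rfl, h6]) hs₁.1 hm
      hn hq hF.qe hF.t hF.U hF.N hF.s₀ hS hF.samples hw (by rw [a0]; exact ha))
      fun s₂ hs₂ hf₂ => ?_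
    obtain ⟨hE₂, h14⟩ := hs₂
    have htp₂ : s₂.tape = τ := by rw [hf₂.tape rfl, hf₁.tape rfl, hτ]
    have g0 : s₂.arr 0 = s.arr 0 := by rw [hf₂.arr 0 rfl, a0]
    refine Run.seq (groups_run hE₂ htp₂ (fun i => by
      rw [hf₂.arr 5 rfl, hf₁.arr 5 rfl, ha0 5 (by decide)])) fun s₃ hs₃ hf₃ => ?_
    obtain ⟨hL₃, htp₃, h9₃⟩ := hs₃
    have hE₃ := hE₂.frame hf₃ rfl rfl
    have g0₃ : s₃.arr 0 = s.arr 0 := by rw [hf₃.arr 0 rfl, g0]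
    refine Run.seq (tournament_run hE₃ hL₃ ((hf₃.reg 14 rfl).trans h14) hF.S hS0 htp₃ h9₃
      (champion_lt _ _ _ _ _ _ _)) fun s₄ hs₄ hf₄ => ?_
    have hE₄ := hE₃.frame hf₄ rfl rfl
    have hL₄ := hL₃.frame hf₄ rfl
    have g0₄ : s₄.arr 0 = s.arr 0 := by rw [hf₄.arr 0 rfl, g0₃]
    rw [g0₃] at hs₄
    have hmn : m * n < 2 ^ w := by
      have h1 := hF.check
      have h2 : m * n ≤ m * n * (d₀ * d) := Nat.le_mul_of_pos_right _
        (Nat.mul_pos hd₀ (by omega))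
      omega
    refine Run.seq (labelProg_run (c := winner m n q e (s.arr 0) ω) hE₄ hL₄
      (champion_lt _ _ _ _ _ _ _ L le_rfl 0 (by simp)) hs₄.2 hs₄.1 hmn) fun s₅ hs₅ hf₅ => ?_
    obtain ⟨hx₅, hy₅, hc₅⟩ := hs₅
    rw [g0₄] at hx₅ hy₅ hc₅
    -- The input registers stay untouched until the final check, which needs the sizes and both
    -- accuracies.
    have hreg : ∀ r, r < 7 → s₅.reg r = s.reg r := by
      intro r hr
      have : setupProg.writes r = false ∧ (Prog.forLt 46 11 groupProg).writes r = false ∧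
          tournament.writes r = false ∧ labelProg.writes r = false ∧
          ((Prog.const 7 1).seq (.const 83 2)).writes r = false := by
        interval_cases r <;> exact ⟨rfl, rfl, rfl, rfl, rfl⟩
      rw [hf₅.reg r this.2.2.2.1, hf₄.reg r this.2.2.1, hf₃.reg r this.2.1, hf₂.reg r this.1,
        hf₁.reg r this.2.2.2.2]
    refine (checkProg_run (c := outCount m n q e (s.arr 0) ω) ((hreg 0 (by decide)).trans h0)
      ((hreg 1 (by decide)).trans h1) ((hreg 3 (by decide)).trans h3)
      ((hreg 4 (by decide)).trans h4) ((hreg 5 (by decide)).trans h5)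
      ((hreg 6 (by decide)).trans h6) hc₅ (outCount_le ha _) hm hn hd₀ (by omega) hF.check).post
      fun s₆ hs₆ hf₆ => ⟨hs₆, ?_, ?_⟩
    · rw [hf₆.arr 1 rfl]
      exact hx₅
    · rw [hf₆.arr 2 rfl]
      exact hy₅
  · rw [hf₁.reg 5 rfl, hf₁.reg 6 rfl, h5, h6] at hlt
    omega
  · simp only [solveTime, ← ht, ← hb, ← hL]
    omega

/-! ## Finite probability -/

open Finset in
open scoped BigOperators in
open Classical in
/-- The probability of an event under the uniform distribution on a finite type. -/
noncomputable def prob {Ω : Type*} [Fintype Ω] (p : Ω → Prop) : ℝ :=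
  𝔼 ω, if p ω then (1 : ℝ) else 0

section Prob

open Finset
open scoped BigOperators

variable {Ω : Type*} [Fintype Ω]

theorem prob_mono {p p' : Ω → Prop} (h : ∀ ω, p ω → p' ω) : prob p ≤ prob p' := by
  refine expect_le_expect fun ω _ => ?_
  by_cases hp : p ω
  · simp [hp, h ω hp]
  · simp only [hp, if_false]
    split_ifs <;> norm_num

theorem prob_or_le (p p' : Ω → Prop) : prob (fun ω => p ω ∨ p' ω) ≤ prob p + prob p' := by
  unfold prob
  rw [← expect_add_distrib]
  refine expect_le_expect fun ω _ => ?_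
  by_cases h : p ω <;> by_cases h' : p' ω <;> simp [h, h']

theorem prob_exists_le {ι : Type*} (s : Finset ι) (p : ι → Ω → Prop) :
    prob (fun ω => ∃ i ∈ s, p i ω) ≤ ∑ i ∈ s, prob (p i) := by
  classical
  induction s using Finset.induction_on with
  | empty => simp [prob]
  | insert a s ha ih =>
    rw [sum_insert ha]
    refine le_trans (prob_mono fun ω => ?_) ((prob_or_le (p a) _).trans (by gcongr))
    rintro ⟨i, hi, h⟩
    rcases mem_insert.mp hi with rfl | hi
    · exact Or.inl h
    · exact Or.inr ⟨i, hi, h⟩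

/-- Markov's inequality, in product form so that `ε` needs no sign. -/
theorem prob_mul_le_expect {f : Ω → ℝ} (hf : ∀ ω, 0 ≤ f ω) (ε : ℝ) :
    prob (fun ω => ε ≤ f ω) * ε ≤ 𝔼 ω, f ω := by
  unfold prob
  rw [expect_mul]
  refine expect_le_expect fun ω _ => ?_
  split_ifs with h
  · simpa using h
  · simpa using hf ω

/-! ### Independence through resampling, and concentration -/

variable {I V : Type*} [Fintype I] [DecidableEq I] [Fintype V]

/-- Resampling the coordinates in `B` does not change averages. -/
theorem expect_piecewise [Nonempty V] (B : Finset I) (F : (I → V) → ℝ) :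
    𝔼 ω : I → V, 𝔼 v : I → V, F (B.piecewise v ω) = 𝔼 ω, F ω := by
  have h : 𝔼 x : (I → V) × (I → V), F (B.piecewise x.2 x.1) =
      𝔼 x : (I → V) × (I → V), F x.1 := by
    -- Exchanging the coordinates in `B` between two independent copies is an involution of the
    -- product space.
    refine Fintype.expect_equiv
      (Function.Involutive.toPerm (fun x : (I → V) × (I → V) =>
        (B.piecewise x.2 x.1, B.piecewise x.1 x.2)) ?_) _ _ fun x => rfl
    intro x
    ext i <;> by_cases hi : i ∈ B <;> simp [Finset.piecewise, hi]
  rw [← univ_product_univ, expect_product, expect_product] at h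
  rw [h]
  exact expect_congr rfl fun ω _ => expect_const (univ_nonempty (α := I → V)) (F ω)

/-- Redraw the block `B`. By `hA` the event `A` is decided by the other coordinates, and given
these, `W` has probability at most `δ`. This plays the part of conditional probability. -/
theorem prob_and_le_of_resample [Nonempty V] (B : Finset I) {A W : (I → V) → Prop} {δ : ℝ}
    (hA : ∀ ω v, A (B.piecewise v ω) → A ω)
    (hW : ∀ ω, prob (fun v => W (B.piecewise v ω)) ≤ δ) :
    prob (fun ω => A ω ∧ W ω) ≤ δ * prob A := by
  unfold prob
  rw [← expect_piecewise B, mul_expect]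
  refine expect_le_expect fun ω _ => ?_
  by_cases h : A ω
  · rw [if_pos h, mul_one]
    refine le_trans (expect_le_expect fun v _ => ?_) (hW ω)
    by_cases h' : W (B.piecewise v ω)
    · simp only [h', and_true, if_true]
      split_ifs <;> norm_num
    · simp [h']
  · rw [if_neg h, mul_zero]
    refine le_of_eq (expect_eq_zero fun v _ => ?_)
    rw [if_neg fun h' => h (hA ω v h'.1)]

theorem prob_le_of_resample [Nonempty V] (B : Finset I) {W : (I → V) → Prop} {δ : ℝ}
    (hW : ∀ ω, prob (fun v => W (B.piecewise v ω)) ≤ δ) : prob W ≤ δ := by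
  have h := prob_and_le_of_resample B (A := fun _ => True) (fun _ _ _ => trivial) hW
  have h1 : prob (fun _ : I → V => True) = 1 := by
    simp [prob]
  rw [h1, mul_one] at h
  exact (prob_mono fun ω h => ⟨trivial, h⟩).trans h

/-- Events that depend on disjoint blocks (and on coordinates outside all blocks), each of small
conditional probability, are unlikely to happen simultaneously. -/
theorem prob_forall_le [Nonempty V] {ι : Type*} [DecidableEq ι] (B : ι → Finset I)
    (W : ι → (I → V) → Prop) {δ : ℝ} (hδ : 0 ≤ δ) (Q : Finset ι)
    (hinv : ∀ p ∈ Q, ∀ p' ∈ Q, p ≠ p' → ∀ ω v, W p' ((B p).piecewise v ω) → W p' ω)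
    (hW : ∀ p ∈ Q, ∀ ω, prob (fun v => W p ((B p).piecewise v ω)) ≤ δ) :
    prob (fun ω => ∀ p ∈ Q, W p ω) ≤ δ ^ #Q := by
  induction Q using Finset.induction_on with
  | empty => simp [prob]
  | insert a s ha ih =>
    have ih := ih (fun p hp p' hp' => hinv p (mem_insert_of_mem hp) p' (mem_insert_of_mem hp'))
      fun p hp => hW p (mem_insert_of_mem hp)
    have h := prob_and_le_of_resample (B a) (A := fun ω => ∀ p ∈ s, W p ω) (W := W a) (δ := δ)
      (fun ω v h p hp => hinv a (mem_insert_self a s) p (mem_insert_of_mem hp)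
        (fun e => ha (e ▸ hp)) ω v (h p hp)) (hW a (mem_insert_self a s))
    rw [card_insert_of_notMem ha, pow_succ']
    refine le_trans (prob_mono fun ω hω => ?_) (h.trans (mul_le_mul_of_nonneg_left ih hδ))
    exact ⟨fun p hp => hω p (mem_insert_of_mem hp), hω a (mem_insert_self a s)⟩

-- If `k` events happen, then some set of `k` events happens simultaneously; there are at most `2 ^
-- #P` such sets, and `prob_forall_le` bounds each of them.
open Classical in
theorem prob_card_le [Nonempty V] {ι : Type*} (B : ι → Finset I)
    (W : ι → (I → V) → Prop) {δ : ℝ} (hδ : 0 ≤ δ) (P : Finset ι)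
    (hinv : ∀ p ∈ P, ∀ p' ∈ P, p ≠ p' → ∀ ω v, W p' ((B p).piecewise v ω) → W p' ω)
    (hW : ∀ p ∈ P, ∀ ω, prob (fun v => W p ((B p).piecewise v ω)) ≤ δ) (k : ℕ) :
    prob (fun ω => k ≤ #{p ∈ P | W p ω}) ≤ 2 ^ #P * δ ^ k := by
  calc prob (fun ω => k ≤ #{p ∈ P | W p ω})
      ≤ prob (fun ω => ∃ Q ∈ P.powersetCard k, ∀ p ∈ Q, W p ω) := by
        refine prob_mono fun ω h => ?_
        obtain ⟨Q, hQ, hc⟩ := exists_subset_card_eq h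
        exact ⟨Q, mem_powersetCard.mpr ⟨hQ.trans (filter_subset _ _), hc⟩,
          fun p hp => (mem_filter.mp (hQ hp)).2⟩
    _ ≤ ∑ Q ∈ P.powersetCard k, prob (fun ω => ∀ p ∈ Q, W p ω) := prob_exists_le _ _
    _ ≤ ∑ Q ∈ P.powersetCard k, δ ^ k := by
        refine sum_le_sum fun Q hQ => ?_
        obtain ⟨hQ, hc⟩ := mem_powersetCard.mp hQ
        rw [← hc]
        exact prob_forall_le B W hδ Q (fun p hp p' hp' => hinv p (hQ hp) p' (hQ hp'))
          fun p hp => hW p (hQ hp)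
    _ ≤ 2 ^ #P * δ ^ k := by
        rw [sum_const, nsmul_eq_mul]
        refine mul_le_mul_of_nonneg_right ?_ (pow_nonneg hδ k)
        rw [card_powersetCard]
        exact_mod_cast Nat.choose_le_two_pow _ _

/-- Expanding the product over all coordinates of the sums over `V` gives the sum over all
functions; coordinates outside `B` contribute the factor `1`. -/
theorem expect_prod [Nonempty V] (B : Finset I) (φ : V → ℝ) :
    𝔼 ω : I → V, ∏ i ∈ B, φ (ω i) = (𝔼 v, φ v) ^ #B := by
  have h1 : ∀ ω : I → V, ∏ i ∈ B, φ (ω i) = ∏ i, if i ∈ B then φ (ω i) else 1 := fun ω => by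
    simp [Finset.prod_ite_mem]
  simp only [h1]
  have h2 := Finset.prod_univ_sum (fun _ : I => (univ : Finset V))
    (fun i v => if i ∈ B then φ v else 1)
  rw [Fintype.piFinset_univ] at h2
  rw [Fintype.expect_eq_sum_div_card, ← h2, Fintype.card_fun, Nat.cast_pow, ← Finset.card_univ (α := I),
    ← Finset.prod_const, ← Finset.prod_div_distrib]
  have h3 : ∀ i : I, (∑ v : V, if i ∈ B then φ v else 1) / (Fintype.card V : ℝ) =
      if i ∈ B then 𝔼 v, φ v else 1 := fun i => by
    split_ifs
    · rw [Fintype.expect_eq_sum_div_card]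
    · simp
  simp only [h3]
  simp [Finset.prod_ite_mem]

/-- Chernoff's method with parameter `ε / 2`. From `exp x ≤ 1 + x + x²` for `|x| ≤ 1` and mean zero,
the exponential moment of one coordinate is at most `exp (ε² / 4)`; Markov's inequality turns this
into the exponent `ε² / 4 - ε² / 2` per coordinate. -/
theorem prob_sum_ge [Nonempty V] (B : Finset I) {g : V → ℝ} (hg : ∀ v, |g v| ≤ 1)
    (h0 : 𝔼 v, g v = 0) {ε : ℝ} (hε : 0 ≤ ε) (hε1 : ε ≤ 1) :
    prob (fun ω : I → V => ε * #B ≤ ∑ i ∈ B, g (ω i)) ≤ Real.exp (-(ε ^ 2 * #B / 4)) := by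
  have hexp : 𝔼 v, Real.exp (ε / 2 * g v) ≤ Real.exp ((ε / 2) ^ 2) := by
    calc 𝔼 v, Real.exp (ε / 2 * g v) ≤ 𝔼 v, (1 + (ε / 2 * g v) + (ε / 2) ^ 2) := by
          refine expect_le_expect fun v _ => ?_
          have hle : |ε / 2 * g v| ≤ 1 := by
            rw [abs_mul, abs_of_nonneg (by positivity)]
            have := hg v
            nlinarith [abs_nonneg (g v)]
          have h := (abs_le.mp (Real.abs_exp_sub_one_sub_id_le hle)).2
          have h2 : (ε / 2 * g v) ^ 2 ≤ (ε / 2) ^ 2 := by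
            rw [mul_pow]
            have : g v ^ 2 ≤ 1 := by
              rw [← sq_abs]
              have := hg v
              nlinarith [abs_nonneg (g v)]
            nlinarith [sq_nonneg (ε / 2)]
          linarith
      _ = 1 + (ε / 2) ^ 2 := by
          rw [expect_add_distrib, expect_add_distrib, ← mul_expect, h0,
            expect_const univ_nonempty, expect_const univ_nonempty]
          ring
      _ ≤ Real.exp ((ε / 2) ^ 2) := by linarith [Real.add_one_le_exp ((ε / 2) ^ 2)]
  have hm := prob_mul_le_expect (Ω := I → V) (f := fun ω => Real.exp (ε / 2 * ∑ i ∈ B, g (ω i)))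
    (fun _ => (Real.exp_pos _).le) (Real.exp (ε / 2 * (ε * #B)))
  have hprod : 𝔼 ω : I → V, Real.exp (ε / 2 * ∑ i ∈ B, g (ω i)) ≤
      Real.exp ((ε / 2) ^ 2) ^ #B := by
    have : ∀ ω : I → V, Real.exp (ε / 2 * ∑ i ∈ B, g (ω i)) =
        ∏ i ∈ B, Real.exp (ε / 2 * g (ω i)) := fun ω => by rw [mul_sum, Real.exp_sum]
    simp only [this]
    rw [expect_prod B (fun v => Real.exp (ε / 2 * g v))]
    exact pow_le_pow_left₀ (expect_nonneg fun _ _ => (Real.exp_pos _).le) hexp _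
  have hmono : prob (fun ω : I → V => ε * #B ≤ ∑ i ∈ B, g (ω i)) ≤ prob (fun ω : I → V =>
      Real.exp (ε / 2 * (ε * #B)) ≤ Real.exp (ε / 2 * ∑ i ∈ B, g (ω i))) :=
    prob_mono fun ω h => Real.exp_le_exp.mpr (mul_le_mul_of_nonneg_left h (by positivity))
  have hpos := Real.exp_pos (ε / 2 * (ε * #B))
  have h1 : prob (fun ω : I → V => ε * #B ≤ ∑ i ∈ B, g (ω i)) * Real.exp (ε / 2 * (ε * #B)) ≤
      Real.exp ((ε / 2) ^ 2) ^ #B :=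
    (mul_le_mul_of_nonneg_right hmono hpos.le).trans (hm.trans hprod)
  rw [← Real.exp_nat_mul, ← le_div_iff₀ hpos, ← Real.exp_sub] at h1
  refine h1.trans (le_of_eq ?_)
  congr 1
  ring

/-- A simple version of Hoeffding's inequality. -/
theorem prob_deviation_le [Nonempty V] (B : Finset I) {h : V → ℝ} (h0 : ∀ v, 0 ≤ h v)
    (h1 : ∀ v, h v ≤ 1) {ε : ℝ} (hε : 0 ≤ ε) (hε1 : ε ≤ 1) :
    prob (fun ω : I → V => ε * #B ≤ |∑ i ∈ B, h (ω i) - #B * 𝔼 v, h v|) ≤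
      2 * Real.exp (-(ε ^ 2 * #B / 4)) := by
  set μ := 𝔼 v, h v with hμ
  have hμ0 : 0 ≤ μ := expect_nonneg fun v _ => h0 v
  have hμ1 : μ ≤ 1 := expect_le univ_nonempty fun v _ => h1 v
  have hc : 𝔼 _v : V, μ = μ := expect_const univ_nonempty _
  have e1 := prob_sum_ge (I := I) B (g := fun v => h v - μ)
    (fun v => abs_le.mpr ⟨by linarith [h0 v], by linarith [h1 v]⟩)
    (by rw [expect_sub_distrib, hc]; linarith) hε hε1
  have e2 := prob_sum_ge (I := I) B (g := fun v => μ - h v)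
    (fun v => abs_le.mpr ⟨by linarith [h1 v], by linarith [h0 v]⟩)
    (by rw [expect_sub_distrib, hc]; linarith) hε hε1
  refine (prob_mono fun ω hω => ?_).trans ((prob_or_le _ _).trans
    ((add_le_add e1 e2).trans (two_mul _).symm.le))
  simp only [sum_sub_distrib, sum_const, nsmul_eq_mul]
  clear e1 e2
  rcases le_abs.mp hω with h | h
  · exact Or.inl h
  · right
    rwa [neg_sub] at h

end Prob

/-! ## Sampling -/

section Sampling

open Finset
open scoped BigOperators

/-- Labels that are best on a random sample are nearly best on average. -/
theorem prob_response_le {I V W : Type*} [Fintype I] [DecidableEq I] [Fintype V] [Nonempty V]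
    [Fintype W] [Nonempty W] (B : Finset I) (hB : 0 < #B) (q : ℕ) {h : W → ℕ → V → ℝ}
    (h0 : ∀ w σ v, 0 ≤ h w σ v) (h1 : ∀ w σ v, h w σ v ≤ 1) (resp : (I → V) → W → ℕ)
    (hr : ∀ ω w, resp ω w < q)
    (hbest : ∀ ω w, ∀ σ < q, ∑ i ∈ B, h w σ (ω i) ≤ ∑ i ∈ B, h w (resp ω w) (ω i))
    {φ : W → ℕ} (hφ : ∀ w, φ w < q) {ε : ℝ} (hε : 0 < ε) (hε1 : ε ≤ 1) :
    prob (fun ω : I → V => 𝔼 w, 𝔼 v, h w (resp ω w) v < 𝔼 w, 𝔼 v, h w (φ w) v - 3 * ε) ≤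
      2 * q * Real.exp (-(ε ^ 2 * #B / 4)) / ε := by
  classical
  -- `D ω w`: for the vertex `w` the sample misjudges some label by `ε`. For all other vertices the
  -- best response to the sample loses at most `2 * ε` against `φ w`. So a loss above `3 * ε` on
  -- average forces more than an `ε` fraction of vertices into `D`, which Markov's inequality makes
  -- unlikely.
  set D : (I → V) → W → Prop := fun ω w =>
    ∃ σ ∈ range q, ε * #B ≤ |∑ i ∈ B, h w σ (ω i) - #B * 𝔼 v, h w σ v| with hD
  have hBr : (0 : ℝ) < #B := by exact_mod_cast hB
  have hmu : ∀ w σ, 𝔼 v, h w σ v ≤ 1 := fun w σ => expect_le univ_nonempty fun v _ => h1 w σ v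
  have hmu0 : ∀ w σ, 0 ≤ 𝔼 v, h w σ v := fun w σ => expect_nonneg fun v _ => h0 w σ v
  have key : ∀ ω w, 𝔼 v, h w (φ w) v - 2 * ε - (if D ω w then (1 : ℝ) else 0) ≤
      𝔼 v, h w (resp ω w) v := by
    intro ω w
    by_cases hd : D ω w
    · rw [if_pos hd]
      linarith [hmu w (φ w), hmu0 w (resp ω w)]
    · rw [if_neg hd]
      simp only [hD, not_exists, not_and, not_le, mem_range] at hd
      have e1 := (abs_lt.mp (hd _ (hr ω w))).2
      have e2 := (abs_lt.mp (hd _ (hφ w))).1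
      have e3 := hbest ω w _ (hφ w)
      have : #B * (𝔼 v, h w (φ w) v - 2 * ε) ≤ #B * 𝔼 v, h w (resp ω w) v := by
        rw [mul_sub]
        linarith
      linarith [le_of_mul_le_mul_left this hBr]
  have hsub : prob (fun ω : I → V => 𝔼 w, 𝔼 v, h w (resp ω w) v < 𝔼 w, 𝔼 v, h w (φ w) v - 3 * ε) ≤
      prob (fun ω : I → V => ε ≤ 𝔼 w, if D ω w then (1 : ℝ) else 0) := by
    refine prob_mono fun ω hω => ?_
    have := expect_le_expect (s := univ) fun w _ => key ω w
    rw [expect_sub_distrib, expect_sub_distrib, Fintype.expect_const (ι := W)] at this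
    linarith
  rw [le_div_iff₀ hε]
  refine (mul_le_mul_of_nonneg_right hsub hε.le).trans ?_
  refine (prob_mul_le_expect (fun ω => expect_nonneg fun w _ => by split_ifs <;> norm_num) ε).trans ?_
  -- The expected fraction of misjudged vertices is the average over `w` of the probability that `w`
  -- is misjudged; a union bound over labels treats each `w`.
  rw [expect_comm]
  refine expect_le univ_nonempty fun w _ => ?_
  have : (𝔼 ω : I → V, if D ω w then (1 : ℝ) else 0) = prob (fun ω => D ω w) := by
    unfold prob
    refine expect_congr rfl fun ω _ => ?_
    congr
  rw [this]
  refine (prob_exists_le (range q) _).trans ((sum_le_sum fun σ _ =>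
    prob_deviation_le B (h0 w σ) (h1 w σ) hε.le hε1).trans ?_)
  rw [sum_const, card_range, nsmul_eq_mul]
  exact le_of_eq (by ring)

/-! ### Labelings on edges drawn from a product space -/

variable {U : Type*} (px py : U → ℕ) (tb : ℕ → ℕ → ℕ → ℕ → ℕ)

/-- The value of a labeling when both ends of an edge are drawn from `U` and mapped to vertices. -/
noncomputable def drawnVal [Fintype U] (F G : ℕ → ℕ) : ℝ :=
  𝔼 v : U × U, (tb (px v.1) (py v.2) (F (px v.1)) (G (py v.2)) : ℝ)

/-- The value of the labeling of group `j`. -/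
noncomputable def armVal [Fintype U] (q t s₀ : ℕ) (ω : ℕ → ℕ × ℕ) (j : ℕ) : ℝ :=
  drawnVal px py tb (bestX tb q t (sampleY t s₀ ω j) (sampleLab tb q t s₀ ω j))
    (respY tb q t (sampleY t s₀ ω j) (sampleLab tb q t s₀ ω j) (sampleX t s₀ ω j))

/-- The stream of random edges given by finitely many draws. -/
def drawn {M : ℕ} (ω : Fin M → U × U) (i : ℕ) : ℕ × ℕ :=
  if h : i < M then (px (ω ⟨i, h⟩).1, py (ω ⟨i, h⟩).2) else (0, 0)

/-- The draws at the positions from `o` to `o + S - 1`. -/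
def block (M o S : ℕ) : Finset (Fin M) := univ.filter fun i => o ≤ i ∧ (i : ℕ) < o + S

theorem sum_block {M o S : ℕ} (h : o + S ≤ M) {A : Type*} [AddCommMonoid A] (g : ℕ → A) :
    ∑ i ∈ block M o S, g i = ∑ k ∈ range S, g (o + k) := by
  refine (sum_bij (fun k hk => (⟨o + k, by have := mem_range.mp hk; omega⟩ : Fin M))
    (fun k hk => ?_) (fun a _ b _ hab => ?_) (fun i hi => ?_) fun k hk => rfl).symm
  · have := mem_range.mp hk
    simp [block, this]
  · simpa using hab
  · simp only [block, mem_filter, mem_univ, true_and] at hi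
    exact ⟨i - o, by simp; omega, by ext; simp; omega⟩

theorem card_block {M o S : ℕ} (h : o + S ≤ M) : #(block M o S) = S := by
  rw [card_eq_sum_ones, sum_block h (fun _ => 1)]
  simp

variable {px py}

theorem sum_drawn {M o S : ℕ} (h : o + S ≤ M) (ω : Fin M → U × U) (g : ℕ × ℕ → ℝ) :
    ∑ k ∈ range S, g (drawn px py ω (o + k)) =
      ∑ i ∈ block M o S, g (px (ω i).1, py (ω i).2) := by
  rw [← sum_block h (fun i => g (drawn px py ω i))]
  refine sum_congr rfl fun i _ => ?_
  simp [drawn]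

theorem drawn_piecewise_of_mem {M o S : ℕ} (ω v : Fin M → U × U) {i : ℕ}
    (hi : o ≤ i ∧ i < o + S) :
    drawn px py ((block M o S).piecewise v ω) i = drawn px py v i := by
  unfold drawn
  split_ifs with h
  · rw [piecewise_eq_of_mem _ _ _ (by simp [block, hi])]
  · rfl

theorem drawn_piecewise_of_notMem {M o S : ℕ} (ω v : Fin M → U × U) {i : ℕ}
    (hi : ¬ (o ≤ i ∧ i < o + S)) :
    drawn px py ((block M o S).piecewise v ω) i = drawn px py ω i := by
  unfold drawn
  split_ifs with h
  · rw [piecewise_eq_of_notMem _ _ _ (by simpa [block] using hi)]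
  · rfl

/-- All choices of a group are made from its own segment of the stream. Hence different groups are
independent, and later edges are fresh for them. -/
theorem sampleLab_congr {tb : ℕ → ℕ → ℕ → ℕ → ℕ} {q t s₀ j : ℕ} {ω ω' : ℕ → ℕ × ℕ}
    (h : ∀ i, j * groupSize t s₀ ≤ i → i < (j + 1) * groupSize t s₀ → ω i = ω' i) :
    (∀ k < t, sampleY t s₀ ω j k = sampleY t s₀ ω' j k) ∧
    (∀ k < t, sampleX t s₀ ω j k = sampleX t s₀ ω' j k) ∧
    sampleLab tb q t s₀ ω j = sampleLab tb q t s₀ ω' j := by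
  have hG : (j + 1) * groupSize t s₀ = j * groupSize t s₀ + (2 * t + s₀) := by
    rw [add_mul, one_mul, groupSize]
  have hy : ∀ k < t, sampleY t s₀ ω j k = sampleY t s₀ ω' j k := fun k hk => by
    rw [sampleY, sampleY, h _ (by omega) (by omega)]
  have hx : ∀ k < t, sampleX t s₀ ω j k = sampleX t s₀ ω' j k := fun k hk => by
    rw [sampleX, sampleX, h _ (by omega) (by omega)]
  refine ⟨hy, hx, ?_⟩
  unfold sampleLab
  congr 1
  refine bestLab_congr hy hx (fun k hk => ?_) (fun k hk => ?_) <;>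
    rw [edgeAt, edgeAt, h _ (by omega) (by omega)]

theorem armVal_congr [Fintype U] {tb : ℕ → ℕ → ℕ → ℕ → ℕ} {q t s₀ j : ℕ} {ω ω' : ℕ → ℕ × ℕ}
    (h : ∀ i, j * groupSize t s₀ ≤ i → i < (j + 1) * groupSize t s₀ → ω i = ω' i) :
    armVal px py tb q t s₀ ω j = armVal px py tb q t s₀ ω' j := by
  obtain ⟨hy, hx, hl⟩ := sampleLab_congr (tb := tb) (q := q) h
  unfold armVal
  rw [hl]
  congr 1 <;> funext x
  · exact bestX_congr hy (fun _ _ => rfl) x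
  · exact respY_congr hy (fun _ _ => rfl) hx x

theorem groupScore_congr {tb : ℕ → ℕ → ℕ → ℕ → ℕ} {q t s₀ j o S : ℕ} {ω ω' : ℕ → ℕ × ℕ}
    (h : ∀ i, j * groupSize t s₀ ≤ i → i < (j + 1) * groupSize t s₀ → ω i = ω' i)
    (h' : ∀ k < S, ω (o + k) = ω' (o + k)) :
    groupScore tb q t s₀ ω j o S = groupScore tb q t s₀ ω' j o S := by
  obtain ⟨hy, hx, hl⟩ := sampleLab_congr (tb := tb) (q := q) h
  unfold groupScore
  rw [hl]
  exact score_congr hy (fun _ _ => rfl) hx (fun k hk => by rw [h' k hk])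
    (fun k hk => by rw [h' k hk])

/-- Every finite sequence of digits is that of a number. -/
theorem exists_digit_eq {q : ℕ} (lab : ℕ → ℕ) (t : ℕ) (h : ∀ k < t, lab k < q) :
    ∃ a < q ^ t, ∀ k < t, digit q a k = lab k := by
  induction t with
  | zero => exact ⟨0, by simp, by simp⟩
  | succ t ih =>
    obtain ⟨a, ha, hd⟩ := ih fun k hk => h k (by omega)
    have hl := h t (Nat.lt_succ_self t)
    refine ⟨a + lab t * q ^ t, ?_, fun k hk => ?_⟩
    · rw [pow_succ']
      nlinarith
    · rcases Nat.lt_succ_iff_lt_or_eq.mp hk with hk | rfl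
      · rw [← hd k hk]
        obtain ⟨d, rfl⟩ := Nat.exists_eq_add_of_lt hk
        have hq : 0 < q := by omega
        rw [digit, digit, show lab (k + d + 1) * q ^ (k + d + 1) =
          q ^ k * (q * (lab (k + d + 1) * q ^ d)) by ring,
          Nat.add_mul_div_left _ _ (pow_pos hq k), Nat.add_mul_mod_self_left]
      · have hq : 0 < q ^ k := by omega
        rw [digit, Nat.add_mul_div_right _ _ hq, Nat.div_eq_of_lt ha, zero_add, Nat.mod_eq_of_lt hl]

variable {tb} [Fintype U] [Nonempty U]

/-- The first end is drawn separately, while the second stays a function of a whole item in `U × U`.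
This is the shape that `prob_response_le` requires, a sample being a list of items of which one end
is used. The primed version exchanges the ends. -/
theorem drawnVal_eq (F G : ℕ → ℕ) : drawnVal px py tb F G =
    𝔼 u : U, 𝔼 v : U × U, (tb (px u) (py v.2) (F (px u)) (G (py v.2)) : ℝ) := by
  have h : ∀ f : U → ℝ, 𝔼 v : U × U, f v.2 = 𝔼 u, f u := fun f => by
    rw [← univ_product_univ, expect_product]
    exact expect_const (univ_nonempty (α := U)) (𝔼 u, f u)
  rw [drawnVal, ← univ_product_univ, expect_product]
  refine expect_congr rfl fun u _ => ?_
  rw [univ_product_univ, h fun u' => (tb (px u) (py u') (F (px u)) (G (py u')) : ℝ)]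

theorem drawnVal_eq' (F G : ℕ → ℕ) : drawnVal px py tb F G =
    𝔼 u : U, 𝔼 v : U × U, (tb (px v.1) (py u) (F (px v.1)) (G (py u)) : ℝ) := by
  have h : ∀ f : U → ℝ, 𝔼 v : U × U, f v.1 = 𝔼 u, f u := fun f => by
    rw [← univ_product_univ, expect_product, expect_comm]
    exact expect_const (univ_nonempty (α := U)) (𝔼 u, f u)
  rw [drawnVal, ← univ_product_univ, expect_product, expect_comm]
  refine expect_congr rfl fun u _ => ?_
  rw [univ_product_univ, h fun u' => (tb (px u') (py u) (F (px u')) (G (py u)) : ℝ)]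

/-- The chosen labeling of a group is nearly optimal with constant probability. -/
theorem prob_group_bad_le (htb : ∀ x y σ τ, tb x y σ τ ≤ 1) {q t s₀ M j : ℕ} (hq : 0 < q)
    (ht : 0 < t) (hs₀ : 0 < s₀) (hM : (j + 1) * groupSize t s₀ ≤ M) {F G : ℕ → ℕ}
    (hF : ∀ x, F x < q) (hG : ∀ y, G y < q) {ε : ℝ} (hε : 0 < ε) (hε1 : ε ≤ 1) :
    prob (fun ω : Fin M → U × U =>
      armVal px py tb q t s₀ (drawn px py ω) j < drawnVal px py tb F G - 8 * ε) ≤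
      2 * (2 * q * Real.exp (-(ε ^ 2 * t / 4)) / ε) +
        2 * q ^ t * Real.exp (-(ε ^ 2 * s₀ / 4)) := by
  classical
  have htb0 : ∀ x y σ τ, (0 : ℝ) ≤ tb x y σ τ := fun _ _ _ _ => Nat.cast_nonneg _
  have htb1 : ∀ x y σ τ, (tb x y σ τ : ℝ) ≤ 1 := fun x y σ τ => by exact_mod_cast htb x y σ τ
  have hGr : (j + 1) * groupSize t s₀ = j * groupSize t s₀ + (2 * t + s₀) := by
    rw [add_mul, one_mul, groupSize]
  set o := j * groupSize t s₀ with ho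
  set Y : (Fin M → U × U) → ℕ → ℕ := fun ω => sampleY t s₀ (drawn px py ω) j with hY
  set X : (Fin M → U × U) → ℕ → ℕ := fun ω => sampleX t s₀ (drawn px py ω) j with hX
  -- The labels that the comparison labeling gives to the sample. The algorithm does not know them,
  -- but they are among the `q ^ t` labelings it tries.
  set lab : (Fin M → U × U) → ℕ → ℕ := fun ω k => G (Y ω k) with hlab
  set FF : (Fin M → U × U) → ℕ → ℕ := fun ω => bestX tb q t (Y ω) (lab ω) with hFF
  set GG : (Fin M → U × U) → ℕ → ℕ := fun ω => respY tb q t (Y ω) (lab ω) (X ω) with hGG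
  set δ := 2 * q * Real.exp (-(ε ^ 2 * t / 4)) / ε with hδ
  -- the first sample
  have p1 : prob (fun ω : Fin M → U × U =>
      drawnVal px py tb (FF ω) G < drawnVal px py tb F G - 3 * ε) ≤ δ := by
    have h := prob_response_le (block M o t) (by rw [card_block (by omega)]; exact ht) q
      (h := fun (u : U) σ (v : U × U) => (tb (px u) (py v.2) σ (G (py v.2)) : ℝ))
      (fun _ _ _ => htb0 _ _ _ _) (fun _ _ _ => htb1 _ _ _ _)
      (fun ω u => FF ω (px u)) (fun ω u => bestX_lt hq _ _ _) (fun ω u σ hσ => ?_)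
      (φ := fun u => F (px u)) (fun u => hF _) hε hε1
    · rw [card_block (by omega)] at h
      simp only [drawnVal_eq]
      exact h
    · rw [← sum_drawn (by omega) ω fun e => (tb (px u) e.2 σ (G e.2) : ℝ),
        ← sum_drawn (by omega) ω fun e => (tb (px u) e.2 (FF ω (px u)) (G e.2) : ℝ)]
      exact_mod_cast le_scan (fun σ => ∑ k ∈ range t, tb (px u) (Y ω k) σ (lab ω k)) hσ
  -- the second sample
  have p2 : prob (fun ω : Fin M → U × U =>
      drawnVal px py tb (FF ω) (GG ω) < drawnVal px py tb (FF ω) G - 3 * ε) ≤ δ := by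
    -- Redrawing only the second sample keeps the first one, and with it the labeling `FF ω`, fixed.
    refine prob_le_of_resample (block M (o + t) t) fun ω => ?_
    have hYv : ∀ v, ∀ k < t, Y ((block M (o + t) t).piecewise v ω) k = Y ω k := fun v k hk => by
      simp only [hY, sampleY]
      rw [drawn_piecewise_of_notMem _ _ (by omega)]
    have hXv : ∀ v, ∀ k < t, X ((block M (o + t) t).piecewise v ω) k = X v k := fun v k hk => by
      simp only [hX, sampleX]
      rw [drawn_piecewise_of_mem _ _ (by omega)]
    have hFv : ∀ v, FF ((block M (o + t) t).piecewise v ω) = FF ω := fun v => by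
      funext x
      exact bestX_congr (hYv v) (fun k hk => by simp only [hlab, hYv v k hk]) x
    have hGv : ∀ v, GG ((block M (o + t) t).piecewise v ω) = respY tb q t (Y ω) (lab ω) (X v) :=
      fun v => by
        funext y
        exact respY_congr (hYv v) (fun k hk => by simp only [hlab, hYv v k hk]) (hXv v) y
    simp only [hFv, hGv]
    have h := prob_response_le (block M (o + t) t) (by rw [card_block (by omega)]; exact ht) q
      (h := fun (u : U) τ (v : U × U) => (tb (px v.1) (py u) (FF ω (px v.1)) τ : ℝ))
      (fun _ _ _ => htb0 _ _ _ _) (fun _ _ _ => htb1 _ _ _ _)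
      (fun v u => respY tb q t (Y ω) (lab ω) (X v) (py u)) (fun v u => respY_lt hq _ _ _ _)
      (fun v u τ hτ => ?_) (φ := fun u => G (py u)) (fun u => hG _) hε hε1
    · rw [card_block (by omega)] at h
      simp only [drawnVal_eq']
      exact h
    · rw [← sum_drawn (px := px) (py := py) (by omega) v
          fun e => (tb e.1 (py u) (FF ω e.1) τ : ℝ),
        ← sum_drawn (px := px) (py := py) (by omega) v fun e => (tb e.1 (py u) (FF ω e.1)
          (respY tb q t (Y ω) (lab ω) (X v) (py u)) : ℝ)]
      have := le_scan (fun τ => ∑ k ∈ range t, tb (X v k) (py u) (FF ω (X v k)) τ) hτ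
      have hXk : ∀ k, (drawn px py v (o + t + k)).1 = X v k := fun k => by
        rw [add_assoc]
        rfl
      simp only [hXk]
      exact_mod_cast this
  -- the edges
  set AF : (Fin M → U × U) → ℕ → ℕ → ℕ := fun ω a => bestX tb q t (Y ω) (digit q a) with hAF
  set AG : (Fin M → U × U) → ℕ → ℕ → ℕ := fun ω a => respY tb q t (Y ω) (digit q a) (X ω) with hAG
  set sc : (Fin M → U × U) → ℕ → ℕ := fun ω a => score tb q t (Y ω) (digit q a) (X ω)
    (fun k => (edgeAt t s₀ (drawn px py ω) j k).1)
    (fun k => (edgeAt t s₀ (drawn px py ω) j k).2) s₀ with hsc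
  have p3 : prob (fun ω : Fin M → U × U => ∃ a ∈ range (q ^ t),
      ε * s₀ ≤ |sc ω a - s₀ * drawnVal px py tb (AF ω a) (AG ω a)|) ≤
      2 * q ^ t * Real.exp (-(ε ^ 2 * s₀ / 4)) := by
    -- Once both samples are fixed, the `q ^ t` candidates are fixed labelings, so Hoeffding's
    -- inequality and a union bound apply to fresh test edges.
    refine prob_le_of_resample (block M (o + 2 * t) s₀) fun ω => ?_
    have hYv : ∀ v, ∀ k < t, Y ((block M (o + 2 * t) s₀).piecewise v ω) k = Y ω k := fun v k hk => by
      simp only [hY, sampleY]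
      rw [drawn_piecewise_of_notMem _ _ (by omega)]
    have hXv : ∀ v, ∀ k < t, X ((block M (o + 2 * t) s₀).piecewise v ω) k = X ω k := fun v k hk => by
      simp only [hX, sampleX]
      rw [drawn_piecewise_of_notMem _ _ (by omega)]
    have hAFv : ∀ v a, AF ((block M (o + 2 * t) s₀).piecewise v ω) a = AF ω a := fun v a => by
      funext x
      exact bestX_congr (hYv v) (fun _ _ => rfl) x
    have hAGv : ∀ v a, AG ((block M (o + 2 * t) s₀).piecewise v ω) a = AG ω a := fun v a => by
      funext y
      exact respY_congr (hYv v) (fun _ _ => rfl) (hXv v) y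
    have hsv : ∀ v a, (sc ((block M (o + 2 * t) s₀).piecewise v ω) a : ℝ) =
        ∑ i ∈ block M (o + 2 * t) s₀, (tb (px (v i).1) (py (v i).2) (AF ω a (px (v i).1))
          (AG ω a (py (v i).2)) : ℝ) := fun v a => by
      rw [← sum_drawn (by omega) v fun e => (tb e.1 e.2 (AF ω a e.1) (AG ω a e.2) : ℝ)]
      simp only [hsc, score, Nat.cast_sum]
      refine sum_congr rfl fun k hk => ?_
      have hk := mem_range.mp hk
      rw [hit_congr (hYv v) (fun _ _ => rfl) (hXv v), hit, edgeAt,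
        drawn_piecewise_of_mem _ _ (by omega), add_assoc]
    simp only [hsv, hAFv, hAGv]
    refine (prob_exists_le (range (q ^ t)) _).trans ((sum_le_sum fun a _ => ?_).trans_eq
      (b := ∑ a ∈ range (q ^ t), 2 * Real.exp (-(ε ^ 2 * s₀ / 4))) ?_)
    · have h := prob_deviation_le (block M (o + 2 * t) s₀) (h := fun v : U × U =>
        (tb (px v.1) (py v.2) (AF ω a (px v.1)) (AG ω a (py v.2)) : ℝ))
        (fun _ => htb0 _ _ _ _) (fun _ => htb1 _ _ _ _) hε.le hε1
      rw [card_block (by omega)] at h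
      exact h
    · rw [sum_const, card_range, nsmul_eq_mul]
      push_cast
      ring
  have hs₀r : (0 : ℝ) < s₀ := by exact_mod_cast hs₀
  -- Outside the three events the loss is `3 * ε` for each of the two responses and `2 * ε` for
  -- selecting by scores that are accurate up to `ε`: together `8 * ε`.
  refine (prob_mono (p' := fun ω => (_ ∨ _) ∨ _) fun ω hω => ?_).trans
    ((prob_or_le _ _).trans (add_le_add ((prob_or_le _ _).trans (add_le_add p1 p2)) p3)) |>.trans_eq
    (by ring)
  by_contra hcon
  simp only [not_or, not_lt, not_exists, not_and, not_le, mem_range] at hcon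
  obtain ⟨⟨c1, c2⟩, c3⟩ := hcon
  obtain ⟨a, ha, hd⟩ := exists_digit_eq (lab ω) t fun k _ => hG _
  have eF : AF ω a = FF ω := by
    funext x
    exact bestX_congr (fun _ _ => rfl) hd x
  have eG : AG ω a = GG ω := by
    funext y
    exact respY_congr (fun _ _ => rfl) hd (fun _ _ => rfl) y
  set a' := bestLab tb q t (Y ω) (X ω) (fun k => (edgeAt t s₀ (drawn px py ω) j k).1)
    (fun k => (edgeAt t s₀ (drawn px py ω) j k).2) s₀ with ha'
  have ha'lt : a' < q ^ t := scan_fst_lt _ (pow_pos hq t)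
  have hle : (sc ω a : ℝ) ≤ sc ω a' := by exact_mod_cast le_scan (sc ω) ha
  have c4 := (abs_lt.mp (c3 a ha)).1
  have c5 := (abs_lt.mp (c3 a' ha'lt)).2
  have harm : armVal px py tb q t s₀ (drawn px py ω) j = drawnVal px py tb (AF ω a') (AG ω a') := rfl
  rw [eF, eG] at c4
  rw [harm] at hω
  have : s₀ * (drawnVal px py tb (FF ω) (GG ω) - 2 * ε) ≤
      s₀ * drawnVal px py tb (AF ω a') (AG ω a') := by
    rw [mul_sub]
    linarith
  have := le_of_mul_le_mul_left this hs₀r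
  linarith

end Sampling

/-! ## The tournament -/

section Tournament

open Finset
open scoped BigOperators

theorem mul_pow_le_of_lt {L i p : ℕ} (hi : i < L) (hp : p < 2 ^ (L - (i + 1))) :
    (p + 1) * 2 ^ i ≤ 2 ^ (L - 1) := by
  have : 2 ^ (L - 1) = 2 ^ (L - (i + 1)) * 2 ^ i := by
    rw [← pow_add]
    congr 1
    omega
  rw [this]
  exact Nat.mul_le_mul_right _ hp

/-- The `2 ^ (L - 1 - i)` matches of round `i`, with `2 ^ i * S` edges each, fill the `2 ^ (L - 1) *
S` positions of the round exactly. -/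
theorem roundStart_add_le {t s₀ L S i p : ℕ} (hi : i < L) (hp : p < 2 ^ (L - (i + 1))) :
    roundStart t s₀ L S i + p * (2 ^ i * S) + 2 ^ i * S ≤ roundStart t s₀ L S (i + 1) := by
  have h := Nat.mul_le_mul_right S (mul_pow_le_of_lt hi hp)
  have e1 : p * (2 ^ i * S) + 2 ^ i * S = (p + 1) * 2 ^ i * S := by ring
  have e2 : (i + 1) * (2 ^ (L - 1) * S) = i * (2 ^ (L - 1) * S) + 2 ^ (L - 1) * S := by ring
  unfold roundStart
  omega

theorem roundStart_mono {t s₀ L S i j : ℕ} (h : i ≤ j) :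
    roundStart t s₀ L S i ≤ roundStart t s₀ L S j := by
  unfold roundStart
  gcongr

theorem succ_mul_groupSize_le {t s₀ L S i c : ℕ} (h : c < 2 ^ L) :
    (c + 1) * groupSize t s₀ ≤ roundStart t s₀ L S i :=
  (Nat.mul_le_mul_right _ h).trans (Nat.le_add_right _ _)

theorem two_mul_lt_pow {L i p : ℕ} (hi : i < L) (hp : p < 2 ^ (L - (i + 1))) :
    2 * p + 1 < 2 ^ (L - i) := by
  have h : 2 ^ (L - i) = 2 * 2 ^ (L - (i + 1)) := by
    rw [← pow_succ']
    congr 1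
    omega
  omega

/-- The first rounds of the tournament only depend on the first random edges. -/
theorem champion_congr {tb : ℕ → ℕ → ℕ → ℕ → ℕ} {q t s₀ L S : ℕ} {ω ω' : ℕ → ℕ × ℕ} :
    ∀ i ≤ L, (∀ k < roundStart t s₀ L S i, ω k = ω' k) → ∀ p < 2 ^ (L - i),
      champion tb q t s₀ ω L S i p = champion tb q t s₀ ω' L S i p := by
  intro i
  induction i with
  | zero => intros; rfl
  | succ i ih =>
    intro hi h p hp
    have h2 := two_mul_lt_pow hi hp
    have hle := roundStart_add_le (t := t) (s₀ := s₀) (S := S) hi hp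
    have ih := ih (by omega) fun k hk => h k (hk.trans_le (roundStart_mono (Nat.le_succ i)))
    have hsc : ∀ p' < 2 ^ (L - i),
        groupScore tb q t s₀ ω (champion tb q t s₀ ω' L S i p')
          (roundStart t s₀ L S i + p * (2 ^ i * S)) (2 ^ i * S) =
        groupScore tb q t s₀ ω' (champion tb q t s₀ ω' L S i p')
          (roundStart t s₀ L S i + p * (2 ^ i * S)) (2 ^ i * S) := fun p' hp' => by
      have hc := champion_lt tb q t s₀ ω' L S i (by omega) p' hp'
      refine groupScore_congr (fun k _ hk => h k (hk.trans_le (succ_mul_groupSize_le hc)))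
        fun k hk => h _ (by omega)
    simp only [champion]
    rw [ih _ h2, ih (2 * p) (by omega), hsc _ h2, hsc (2 * p) (by omega)]

open Classical in
/-- If at most half of the players are bad, and few matches are wrongly decided in each round,
then the winner is good. -/
theorem not_bad_of_few_upsets {L : ℕ} (hL : 0 < L) (bad mis : ℕ → ℕ → Prop)
    (hstep : ∀ i < L, ∀ p < 2 ^ (L - (i + 1)), bad (i + 1) p →
      mis i p ∨ bad i (2 * p) ∧ bad i (2 * p + 1))
    (h0 : 2 * #{p ∈ range (2 ^ L) | bad 0 p} ≤ 2 ^ L)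
    (hm : ∀ i < L, 4 * L * #{p ∈ range (2 ^ (L - (i + 1))) | mis i p} ≤ 2 ^ (L - (i + 1))) :
    ¬ bad L 0 := by
  -- The proportion of bad players after `i` rounds is at most `1 / 2 + i / (4 L)`. For `i = L` this
  -- is `3 / 4`, less than the single player who remains.
  have key : ∀ i ≤ L, 4 * L * #{p ∈ range (2 ^ (L - i)) | bad i p} ≤ (2 * L + i) * 2 ^ (L - i) := by
    intro i
    induction i with
    | zero =>
      intro _
      simp only [Nat.sub_zero, Nat.add_zero]
      nlinarith
    | succ i ih =>
      intro hi
      have ih := ih (by omega)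
      have hmi := hm i hi
      have hpow : 2 ^ (L - i) = 2 * 2 ^ (L - (i + 1)) := by
        rw [← pow_succ']
        congr 1
        omega
      set K := 2 ^ (L - (i + 1)) with hK
      -- A bad winner uses up either a misjudged match, which is charged `2`, or two bad players.
      have hcount : 2 * #{p ∈ range K | bad (i + 1) p} ≤
          2 * #{p ∈ range K | mis i p} + #{p ∈ range (2 ^ (L - i)) | bad i p} := by
        have hsum : ∀ K', ∑ p ∈ range (2 * K'), (if bad i p then 1 else 0) =
            ∑ p ∈ range K', ((if bad i (2 * p) then 1 else 0) +
              if bad i (2 * p + 1) then 1 else 0) := fun K' => by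
          induction K' with
          | zero => rfl
          | succ k ihk =>
            rw [show 2 * (k + 1) = 2 * k + 1 + 1 by ring, sum_range_succ, sum_range_succ, ihk,
              sum_range_succ, add_assoc]
        simp only [card_filter]
        rw [hpow, hsum, mul_sum, mul_sum, ← sum_add_distrib]
        refine sum_le_sum fun p hp => ?_
        have := hstep i hi p (mem_range.mp hp)
        by_cases hb : bad (i + 1) p
        · rcases this hb with h | ⟨h, h'⟩
          · simp [hb, h]
          · simp [hb, h, h']
        · simp [hb]
      rw [hpow] at ih hcount
      have := Nat.mul_le_mul_left (4 * L) hcount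
      nlinarith
  have h := key L le_rfl
  intro hb
  have : #{p ∈ range (2 ^ (L - L)) | bad L p} = 1 := by
    rw [Nat.sub_self, pow_zero, range_one, filter_singleton, if_pos hb, card_singleton]
  rw [this, Nat.sub_self] at h
  omega

variable {U : Type*} [Fintype U] {px py : U → ℕ} {tb : ℕ → ℕ → ℕ → ℕ → ℕ}

/-- The score of a labeling on fresh edges is close to its expectation. -/
theorem prob_groupScore_deviation_le [Nonempty U] (htb : ∀ x y σ τ, tb x y σ τ ≤ 1) {q t s₀ M c o S : ℕ}
    (hc : (c + 1) * groupSize t s₀ ≤ o) (ho : o + S ≤ M) (ω : Fin M → U × U) {ε : ℝ}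
    (hε : 0 ≤ ε) (hε1 : ε ≤ 1) :
    prob (fun v : Fin M → U × U => ε * S ≤
      |(groupScore tb q t s₀ (drawn px py ((block M o S).piecewise v ω)) c o S : ℝ) -
        S * armVal px py tb q t s₀ (drawn px py ω) c|) ≤ 2 * Real.exp (-(ε ^ 2 * S / 4)) := by
  set F := bestX tb q t (sampleY t s₀ (drawn px py ω) c) (sampleLab tb q t s₀ (drawn px py ω) c)
    with hF
  set G := respY tb q t (sampleY t s₀ (drawn px py ω) c)
    (sampleLab tb q t s₀ (drawn px py ω) c) (sampleX t s₀ (drawn px py ω) c) with hG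
  have h := prob_deviation_le (block M o S) (h := fun v : U × U =>
    (tb (px v.1) (py v.2) (F (px v.1)) (G (py v.2)) : ℝ)) (fun _ => Nat.cast_nonneg _)
    (fun _ => by exact_mod_cast htb _ _ _ _) hε hε1
  rw [card_block ho] at h
  have hs : ∀ v : Fin M → U × U,
      (groupScore tb q t s₀ (drawn px py ((block M o S).piecewise v ω)) c o S : ℝ) =
      ∑ i ∈ block M o S, (tb (px (v i).1) (py (v i).2) (F (px (v i).1)) (G (py (v i).2)) : ℝ) :=
    fun v => by
      obtain ⟨hy, hx, hl⟩ := sampleLab_congr (tb := tb) (q := q) (t := t) (s₀ := s₀) (j := c)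
        (ω := drawn px py ((block M o S).piecewise v ω)) (ω' := drawn px py ω)
        fun i _ hi => drawn_piecewise_of_notMem _ _ (by omega)
      rw [← sum_drawn ho v fun e => (tb e.1 e.2 (F e.1) (G e.2) : ℝ)]
      simp only [groupScore, score, Nat.cast_sum]
      refine sum_congr rfl fun k hk => ?_
      have hk := mem_range.mp hk
      rw [hl, hit_congr hy (fun _ _ => rfl) hx, hit, drawn_piecewise_of_mem _ _ (by omega)]
  simp only [hs]
  exact h

/-- The match of the champions `2 p` and `2 p + 1` after round `i` is misjudged. -/
def Misjudged (px py : U → ℕ) (tb : ℕ → ℕ → ℕ → ℕ → ℕ) (q t s₀ L S : ℕ) (ε : ℝ)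
    (ω : ℕ → ℕ × ℕ) (i p : ℕ) : Prop :=
  ∃ p' ∈ ({2 * p, 2 * p + 1} : Finset ℕ), ε * (2 ^ i * S : ℕ) ≤
    |(groupScore tb q t s₀ ω (champion tb q t s₀ ω L S i p')
        (roundStart t s₀ L S i + p * (2 ^ i * S)) (2 ^ i * S) : ℝ) -
      (2 ^ i * S : ℕ) * armVal px py tb q t s₀ ω (champion tb q t s₀ ω L S i p')|

theorem mem_pair_lt {L i p p' : ℕ} (hi : i < L) (hp : p < 2 ^ (L - (i + 1)))
    (h : p' ∈ ({2 * p, 2 * p + 1} : Finset ℕ)) : p' < 2 ^ (L - i) := by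
  have := two_mul_lt_pow hi hp
  simp only [mem_insert, mem_singleton] at h
  omega

/-- Both scores are within `ε` of the true values, so the higher score belongs to a player at most
`2 * ε` worse than the other. -/
theorem armVal_champion_of_not_misjudged {q t s₀ L S : ℕ} (hS : 0 < S) {ε : ℝ}
    {ω : ℕ → ℕ × ℕ} {i p : ℕ} (h : ¬ Misjudged px py tb q t s₀ L S ε ω i p) {p' : ℕ}
    (hp' : p' ∈ ({2 * p, 2 * p + 1} : Finset ℕ)) :
    armVal px py tb q t s₀ ω (champion tb q t s₀ ω L S i p') - 2 * ε ≤
      armVal px py tb q t s₀ ω (champion tb q t s₀ ω L S (i + 1) p) := by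
  simp only [Misjudged, not_exists, not_and, not_le] at h
  have hpos : (0 : ℝ) < (2 ^ i * S : ℕ) := by
    have : 0 < 2 ^ i * S := by positivity
    exact_mod_cast this
  have e0 := abs_lt.mp (h (2 * p) (by simp))
  have e1 := abs_lt.mp (h (2 * p + 1) (by simp))
  have fin : ∀ a b : ℝ, (2 ^ i * S : ℕ) * a - (2 ^ i * S : ℕ) * b ≤ 2 * (ε * (2 ^ i * S : ℕ)) →
      a - 2 * ε ≤ b := fun a b hab => by
    refine le_of_mul_le_mul_left (a := ((2 ^ i * S : ℕ) : ℝ)) ?_ hpos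
    rw [mul_sub]
    linarith
  have hε : 0 ≤ ε * (2 ^ i * S : ℕ) := by linarith [e0.1, e0.2]
  apply fin
  rw [champion]
  simp only [mem_insert, mem_singleton] at hp'
  split_ifs with hlt
  · have hlt' := (Nat.cast_lt (α := ℝ)).mpr hlt
    rcases hp' with rfl | rfl <;> linarith [e0.1, e1.2]
  · have hlt' := (Nat.cast_le (α := ℝ)).mpr (not_lt.mp hlt)
    rcases hp' with rfl | rfl <;> linarith [e1.1, e0.2]

-- Matches of one round use disjoint blocks of edges. Redrawing one block changes neither the
-- champions entering the round nor the values of the groups, since these depend on earlier edges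
-- only; so `prob_card_le` applies. The factor `4` stands for two players with two-sided deviations.
open Classical in
theorem prob_card_misjudged_le [Nonempty U] (htb : ∀ x y σ τ, tb x y σ τ ≤ 1) {q t s₀ L S M i : ℕ}
    (hM : roundStart t s₀ L S L ≤ M) (hi : i < L) {ε : ℝ} (hε : 0 ≤ ε) (hε1 : ε ≤ 1) (k : ℕ) :
    prob (fun ω : Fin M → U × U => k ≤ #{p ∈ range (2 ^ (L - (i + 1))) |
      Misjudged px py tb q t s₀ L S ε (drawn px py ω) i p}) ≤
      2 ^ 2 ^ (L - (i + 1)) * (4 * Real.exp (-(ε ^ 2 * (2 ^ i * S : ℕ) / 4))) ^ k := by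
  set o : ℕ → ℕ := fun p => roundStart t s₀ L S i + p * (2 ^ i * S) with ho
  have hend : ∀ p < 2 ^ (L - (i + 1)), o p + 2 ^ i * S ≤ M := fun p hp =>
    (roundStart_add_le hi hp).trans ((roundStart_mono hi).trans hM)
  have hchamp : ∀ p (ω v : Fin M → U × U), ∀ p' < 2 ^ (L - i),
      champion tb q t s₀ (drawn px py ((block M (o p) (2 ^ i * S)).piecewise v ω)) L S i p' =
        champion tb q t s₀ (drawn px py ω) L S i p' := fun p ω v p' hp' =>
    champion_congr i hi.le (fun k hk => drawn_piecewise_of_notMem _ _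
      (by simp only [ho]; omega)) p' hp'
  have harm : ∀ p (ω v : Fin M → U × U), ∀ c < 2 ^ L,
      armVal px py tb q t s₀ (drawn px py ((block M (o p) (2 ^ i * S)).piecewise v ω)) c =
        armVal px py tb q t s₀ (drawn px py ω) c := fun p ω v c hc =>
    armVal_congr fun k _ hk => drawn_piecewise_of_notMem _ _ (by
      have := succ_mul_groupSize_le (t := t) (s₀ := s₀) (S := S) (i := i) hc
      simp only [ho]
      omega)
  have h := prob_card_le (fun p => block M (o p) (2 ^ i * S))
    (fun p (ω : Fin M → U × U) => Misjudged px py tb q t s₀ L S ε (drawn px py ω) i p)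
    (δ := 4 * Real.exp (-(ε ^ 2 * (2 ^ i * S : ℕ) / 4))) (by positivity)
    (range (2 ^ (L - (i + 1)))) ?_ ?_ k
  · rwa [card_range] at h
  · intro p hp r hr hne ω v hW
    have hr := mem_range.mp hr
    obtain ⟨p', hp', hdev⟩ := hW
    have hlt := mem_pair_lt hi hr hp'
    refine ⟨p', hp', ?_⟩
    have hc := champion_lt tb q t s₀ (drawn px py ω) L S i hi.le p' hlt
    rw [hchamp p ω v p' hlt, harm p ω v _ hc] at hdev
    rwa [groupScore_congr (ω' := drawn px py ω)] at hdev
    · intro k _ hk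
      have := succ_mul_groupSize_le (t := t) (s₀ := s₀) (S := S) (i := i) hc
      exact drawn_piecewise_of_notMem _ _ (by simp only [ho]; omega)
    · intro k hk
      refine drawn_piecewise_of_notMem _ _ ?_
      simp only [ho]
      rintro ⟨h1, h2⟩
      rcases Nat.lt_or_gt_of_ne hne with h | h
      · have := Nat.mul_le_mul_right (2 ^ i * S) (Nat.succ_le_of_lt h)
        rw [Nat.succ_mul] at this
        omega
      · have := Nat.mul_le_mul_right (2 ^ i * S) (Nat.succ_le_of_lt h)
        rw [Nat.succ_mul] at this
        omega
  · intro p hp ω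
    have hp := mem_range.mp hp
    refine (prob_exists_le ({2 * p, 2 * p + 1} : Finset ℕ) _).trans ((sum_le_sum
      (g := fun _ => 2 * Real.exp (-(ε ^ 2 * (2 ^ i * S : ℕ) / 4))) fun p' hp' => ?_).trans_eq ?_)
    · have hlt := mem_pair_lt hi hp hp'
      have hc := champion_lt tb q t s₀ (drawn px py ω) L S i hi.le p' hlt
      simp only [hchamp p ω _ p' hlt, harm p ω _ _ hc]
      exact prob_groupScore_deviation_le htb ((succ_mul_groupSize_le hc).trans
        (Nat.le_add_right _ _)) (hend p hp) ω hε hε1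
    · rw [sum_const, card_pair (by omega), nsmul_eq_mul]
      push_cast
      ring

-- Different groups read disjoint segments of the stream, so `prob_card_le` applies to them.
open Classical in
theorem prob_card_bad_le [Nonempty U] {q t s₀ L M : ℕ} {θ δ : ℝ} (hδ : 0 ≤ δ)
    (hbad : ∀ j < 2 ^ L, prob (fun ω : Fin M → U × U =>
      armVal px py tb q t s₀ (drawn px py ω) j < θ) ≤ δ) (k : ℕ) :
    prob (fun ω : Fin M → U × U => k ≤ #{j ∈ range (2 ^ L) |
      armVal px py tb q t s₀ (drawn px py ω) j < θ}) ≤ 2 ^ 2 ^ L * δ ^ k := by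
  have hstep : ∀ j, j * groupSize t s₀ + groupSize t s₀ = (j + 1) * groupSize t s₀ := fun j => by
    ring
  have h := prob_card_le (fun j => block M (j * groupSize t s₀) (groupSize t s₀))
    (fun j (ω : Fin M → U × U) => armVal px py tb q t s₀ (drawn px py ω) j < θ) hδ
    (range (2 ^ L)) ?_ ?_ k
  · rwa [card_range] at h
  · intro p _ r _ hne ω v hW
    rwa [armVal_congr (ω' := drawn px py ω)] at hW
    intro i h1 h2
    refine drawn_piecewise_of_notMem _ _ ?_
    rw [hstep]
    rintro ⟨h3, h4⟩
    have a1 := lt_of_mul_lt_mul_right (h1.trans_lt h4) (Nat.zero_le _)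
    have a2 := lt_of_mul_lt_mul_right (h3.trans_lt h2) (Nat.zero_le _)
    omega
  · intro j hj ω
    have e : ∀ v, armVal px py tb q t s₀ (drawn px py
        ((block M (j * groupSize t s₀) (groupSize t s₀)).piecewise v ω)) j =
        armVal px py tb q t s₀ (drawn px py v) j := fun v => armVal_congr fun i h1 h2 =>
      drawn_piecewise_of_mem _ _ (by rw [hstep]; exact ⟨h1, h2⟩)
    simp only [e]
    exact hbad j (mem_range.mp hj)

/-- The winner of the tournament is nearly optimal with overwhelming probability. -/
theorem prob_champion_lt_le [Nonempty U] (htb : ∀ x y σ τ, tb x y σ τ ≤ 1) {q t s₀ L S M : ℕ} (hL : 0 < L)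
    (hS : 0 < S) (hM : roundStart t s₀ L S L ≤ M) {θ δ ε : ℝ} (hδ : 0 ≤ δ) (hδ1 : δ ≤ 1 / 64)
    (hbad : ∀ j < 2 ^ L, prob (fun ω : Fin M → U × U =>
      armVal px py tb q t s₀ (drawn px py ω) j < θ) ≤ δ) (hε : 0 ≤ ε) (hε1 : ε ≤ 1)
    (hS' : 128 * L ≤ ε ^ 2 * S) :
    prob (fun ω : Fin M → U × U => armVal px py tb q t s₀ (drawn px py ω)
      (champion tb q t s₀ (drawn px py ω) L S L 0) < θ - 2 * L * ε) ≤ (1 / 2) ^ 2 ^ L := by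
  classical
  have hL1 : 2 ^ L = 2 * 2 ^ (L - 1) := by
    rw [← pow_succ']
    congr 1
    omega
  set H := 2 ^ (L - 1) with hH
  -- There are `2 ^ (2 * H)` sets of groups, each with probability at most `64 ^ -H`; the quotient
  -- `4 / 64` is below `(1 / 2) ^ 3`.
  have p0 : prob (fun ω : Fin M → U × U => H ≤ #{j ∈ range (2 ^ L) |
      armVal px py tb q t s₀ (drawn px py ω) j < θ}) ≤ (1 / 2) ^ (3 * H) := by
    refine (prob_card_bad_le hδ hbad H).trans ?_
    calc (2 : ℝ) ^ 2 ^ L * δ ^ H ≤ 2 ^ 2 ^ L * (1 / 64) ^ H := by gcongr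
      _ = (2 ^ 2 * (1 / 64)) ^ H := by rw [hL1, mul_pow, pow_mul]
      _ ≤ ((1 / 2) ^ 3) ^ H := pow_le_pow_left₀ (by norm_num) (by norm_num) _
      _ = (1 / 2) ^ (3 * H) := by rw [pow_mul]
  -- The threshold is the least number of misjudged matches that exceeds the fraction `1 / (4 L)`
  -- tolerated by `not_bad_of_few_upsets`.
  have pm : ∀ i ∈ range L, prob (fun ω : Fin M → U × U => 2 ^ (L - (i + 1)) / (4 * L) + 1 ≤
      #{p ∈ range (2 ^ (L - (i + 1))) | Misjudged px py tb q t s₀ L S ε (drawn px py ω) i p}) ≤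
      (1 / 2) ^ (3 * H) := fun i hi => by
    have hi := mem_range.mp hi
    refine (prob_card_misjudged_le htb hM hi hε hε1 _).trans ?_
    set k := 2 ^ (L - (i + 1)) / (4 * L) + 1 with hk
    have hk1 : 2 ^ (L - (i + 1)) ≤ 4 * L * k := by
      exact (Nat.lt_mul_div_succ (2 ^ (L - (i + 1))) (b := 4 * L) (by omega)).le
    have hHi : H = 2 ^ i * 2 ^ (L - (i + 1)) := by
      rw [hH, ← pow_add]
      congr 1
      omega
    -- The number `k` of misjudgments times the exponent `2 ^ i * (16 * L)` of each is at least `4 *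
    -- H` in every round, independently of `i`.
    have hk2 : 4 * H ≤ 2 ^ i * (16 * L) * k := by
      have := Nat.mul_le_mul_left (2 ^ i * 4) hk1
      rw [hHi]
      calc 4 * (2 ^ i * 2 ^ (L - (i + 1))) = 2 ^ i * 4 * 2 ^ (L - (i + 1)) := by ring
        _ ≤ _ := this
        _ = _ := by ring
    have hhalf : Real.exp (-1) ≤ 1 / 2 := by
      rw [Real.exp_neg, inv_eq_one_div]
      have := Real.add_one_le_exp (1 : ℝ)
      exact one_div_le_one_div_of_le (by norm_num) (by linarith)
    -- The hypothesis `hS'` provides the exponent `32 * L * 2 ^ i`; half of it is given away to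
    -- absorb the factor `4`.
    have hexp : 4 * Real.exp (-(ε ^ 2 * (2 ^ i * S : ℕ) / 4)) ≤ (1 / 2) ^ (2 ^ i * (16 * L)) := by
      have h1 : ((2 ^ i * (32 * L) : ℕ) : ℝ) ≤ ε ^ 2 * (2 ^ i * S : ℕ) / 4 := by
        push_cast
        have : (0 : ℝ) < 2 ^ i := by positivity
        nlinarith
      have h2 : Real.exp (-(ε ^ 2 * (2 ^ i * S : ℕ) / 4)) ≤ (1 / 2) ^ (2 ^ i * (32 * L)) := by
        refine (Real.exp_le_exp.mpr (neg_le_neg h1)).trans ?_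
        rw [← mul_neg_one, Real.exp_nat_mul]
        exact pow_le_pow_left₀ (Real.exp_pos _).le hhalf _
      have h3 : (1 / 2 : ℝ) ^ (2 ^ i * (32 * L)) ≤ (1 / 2) ^ (2 + 2 ^ i * (16 * L)) := by
        refine pow_le_pow_of_le_one (by norm_num) (by norm_num) ?_
        have := Nat.mul_le_mul_left (2 ^ i) hL
        have := Nat.one_le_two_pow (n := i)
        have e1 : 2 ^ i * (32 * L) = 32 * (2 ^ i * L) := by ring
        have e2 : 2 ^ i * (16 * L) = 16 * (2 ^ i * L) := by ring
        omega
      rw [pow_add] at h3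
      linarith
    calc (2 : ℝ) ^ 2 ^ (L - (i + 1)) * (4 * Real.exp (-(ε ^ 2 * (2 ^ i * S : ℕ) / 4))) ^ k
        ≤ 2 ^ H * (1 / 2) ^ (4 * H) := by
          gcongr ?_ * ?_
          · exact pow_le_pow_right₀ (by norm_num)
              (hHi ▸ Nat.le_mul_of_pos_left _ (by positivity))
          · refine (pow_le_pow_left₀ (by positivity) hexp k).trans ?_
            rw [← pow_mul]
            exact pow_le_pow_of_le_one (by norm_num) (by norm_num) hk2
      _ = (1 / 2) ^ (3 * H) := by
          rw [show 4 * H = H + 3 * H by ring, pow_add, ← mul_assoc, ← mul_pow]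
          norm_num
  have hsub : ∀ ω : Fin M → U × U, armVal px py tb q t s₀ (drawn px py ω)
      (champion tb q t s₀ (drawn px py ω) L S L 0) < θ - 2 * L * ε →
      H ≤ #{j ∈ range (2 ^ L) | armVal px py tb q t s₀ (drawn px py ω) j < θ} ∨
      ∃ i ∈ range L, 2 ^ (L - (i + 1)) / (4 * L) + 1 ≤ #{p ∈ range (2 ^ (L - (i + 1))) |
        Misjudged px py tb q t s₀ L S ε (drawn px py ω) i p} := by
    intro ω hω
    by_contra hcon
    simp only [not_or, not_le, not_exists, not_and, mem_range] at hcon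
    -- The threshold for being bad sinks by `2 * ε` per round, so that a correctly judged match with
    -- a good player has a good winner.
    refine not_bad_of_few_upsets hL
      (fun i p => armVal px py tb q t s₀ (drawn px py ω)
        (champion tb q t s₀ (drawn px py ω) L S i p) < θ - 2 * i * ε)
      (Misjudged px py tb q t s₀ L S ε (drawn px py ω)) (fun i hi p hp hb => ?_) ?_
      (fun i hi => ?_) hω
    · by_contra hc
      simp only [not_or] at hc
      refine hc.2 ⟨?_, ?_⟩
      · have := armVal_champion_of_not_misjudged hS hc.1 (p' := 2 * p) (by simp)
        push_cast at hb
        linarith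
      · have := armVal_champion_of_not_misjudged hS hc.1 (p' := 2 * p + 1) (by simp)
        push_cast at hb
        linarith
    · simp only [champion, Nat.cast_zero, mul_zero, zero_mul, sub_zero]
      omega
    · have h1 := hcon.2 i hi
      have := Nat.mul_le_mul_left (4 * L) (Nat.le_of_lt_succ h1)
      exact this.trans (Nat.mul_div_le _ _)
  refine (prob_mono hsub).trans ((prob_or_le _ _).trans ((add_le_add p0
    ((prob_exists_le _ _).trans (sum_le_sum pm))).trans ?_))
  rw [sum_const, card_range, nsmul_eq_mul]
  -- There are `L + 1 ≤ 2 ^ H` events of probability at most `2 ^ -(3 H)` each, which leaves `2 ^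
  -- -(2 H) = 2 ^ -(2 ^ L)`.
  have hLH : L ≤ H := by
    have := Nat.lt_two_pow_self (n := L - 1)
    omega
  have h1 : ((L + 1 : ℕ) : ℝ) ≤ 2 ^ H := by
    have h : L + 1 ≤ 2 ^ H := Nat.succ_le_of_lt (hLH.trans_lt Nat.lt_two_pow_self)
    exact_mod_cast h
  have h2 : (1 / 2 : ℝ) ^ (3 * H) = (1 / 2) ^ 2 ^ L * (1 / 2) ^ H := by
    rw [hL1, ← pow_add]
    congr 1
    ring
  rw [h2]
  have h3 : (2 : ℝ) ^ H * (1 / 2) ^ H = 1 := by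
    rw [← mul_pow]
    norm_num
  have h4 : (0 : ℝ) < (1 / 2) ^ H := by positivity
  have h5 : (0 : ℝ) < (1 / 2) ^ 2 ^ L := by positivity
  push_cast at h1
  nlinarith [mul_pos h4 h5]

/-- With `l` the rounded-up logarithm of `q e`, the sample size makes the first exponent `8 l`,
while the prefactor `4 q e` is at most `4 * 2 ^ l`. The number of test edges makes the second
exponent `2 q t`, which beats the `q ^ t ≤ 2 ^ (q t)` candidates. -/
theorem group_failure_le {q e : ℕ} (hq : 1 < q) (he : 1 < e) :
    2 * (2 * q * Real.exp (-((1 / (e : ℝ)) ^ 2 * sampleSize q e / 4)) / (1 / e)) +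
      2 * (q : ℝ) ^ sampleSize q e *
        Real.exp (-((1 / (e : ℝ)) ^ 2 * groupEdges q e / 4)) ≤ 1 / 64 := by
  have he0 : (0 : ℝ) < e := by exact_mod_cast (by omega : 0 < e)
  set l := Nat.clog 2 (q * e) with hl
  set t := sampleSize q e with ht
  have hl2 : 2 ≤ l := by
    have h4 : 2 * 2 ≤ q * e := Nat.mul_le_mul hq he
    have : Nat.clog 2 4 ≤ l := Nat.clog_mono_right 2 h4
    have h2 : Nat.clog 2 4 = 2 := by
      rw [show 4 = 2 ^ 2 by norm_num, Nat.clog_pow _ _ (by norm_num)]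
    omega
  have hqe : q * e ≤ 2 ^ l := Nat.le_pow_clog (by decide) _
  have htl : 8 ≤ t := by
    rw [ht, sampleSize, ← hl]
    have : 32 * 1 * 1 * 2 ≤ 32 * e * e * l := by gcongr
    omega
  have e1 : (1 / (e : ℝ)) ^ 2 * t / 4 = (8 * l : ℕ) := by
    rw [ht, sampleSize, ← hl]
    push_cast
    field_simp
    ring
  have e2 : (1 / (e : ℝ)) ^ 2 * groupEdges q e / 4 = (2 * (q * t) : ℕ) := by
    rw [groupEdges, ← ht]
    push_cast
    field_simp
    ring
  have hhalf : ∀ k : ℕ, Real.exp (-(k : ℝ)) ≤ (1 / 2) ^ k := fun k => by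
    rw [← mul_neg_one, Real.exp_nat_mul]
    refine pow_le_pow_left₀ (Real.exp_pos _).le ?_ _
    rw [Real.exp_neg, inv_eq_one_div]
    have := Real.add_one_le_exp (1 : ℝ)
    exact one_div_le_one_div_of_le (by norm_num) (by linarith)
  rw [e1, e2]
  have a1 : 2 * (2 * (q : ℝ) * Real.exp (-((8 * l : ℕ) : ℝ)) / (1 / e)) ≤ 1 / 128 := by
    have h1 : (q : ℝ) * e ≤ 2 ^ l := by exact_mod_cast hqe
    have h2 : (1 / 2 : ℝ) ^ (8 * l) = (1 / 2) ^ l * (1 / 2) ^ (7 * l) := by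
      rw [← pow_add]
      congr 1
      ring
    have h3 : (2 : ℝ) ^ l * (1 / 2) ^ l = 1 := by
      rw [← mul_pow]
      norm_num
    have h4 : (1 / 2 : ℝ) ^ (7 * l) ≤ (1 / 2) ^ 14 :=
      pow_le_pow_of_le_one (by norm_num) (by norm_num) (by omega)
    calc 2 * (2 * (q : ℝ) * Real.exp (-((8 * l : ℕ) : ℝ)) / (1 / e))
        = 4 * (q * e) * Real.exp (-((8 * l : ℕ) : ℝ)) := by field_simp; ring
      _ ≤ 4 * 2 ^ l * (1 / 2) ^ (8 * l) := by
          gcongr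
          exact hhalf _
      _ = 4 * (2 ^ l * (1 / 2) ^ l) * (1 / 2) ^ (7 * l) := by rw [h2]; ring
      _ ≤ 4 * 1 * (1 / 2) ^ 14 := by rw [h3]; gcongr
      _ ≤ 1 / 128 := by norm_num
  have a2 : 2 * (q : ℝ) ^ t * Real.exp (-((2 * (q * t) : ℕ) : ℝ)) ≤ 1 / 128 := by
    have h1 : (q : ℝ) ^ t ≤ 2 ^ (q * t) := by
      rw [pow_mul]
      refine pow_le_pow_left₀ (by positivity) ?_ _
      exact_mod_cast (Nat.lt_two_pow_self (n := q)).le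
    have h2 : (2 : ℝ) ^ (q * t) * (1 / 2) ^ (q * t) = 1 := by
      rw [← mul_pow]
      norm_num
    have h4 : (1 / 2 : ℝ) ^ (q * t) ≤ (1 / 2) ^ 8 :=
      pow_le_pow_of_le_one (by norm_num) (by norm_num)
        (htl.trans (Nat.le_mul_of_pos_left _ (by omega)))
    calc 2 * (q : ℝ) ^ t * Real.exp (-((2 * (q * t) : ℕ) : ℝ))
        ≤ 2 * 2 ^ (q * t) * (1 / 2) ^ (2 * (q * t)) := by
          gcongr
          exact hhalf _
      _ = 2 * (2 ^ (q * t) * (1 / 2) ^ (q * t)) * (1 / 2) ^ (q * t) := by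
          rw [two_mul (q * t), pow_add]; ring
      _ ≤ 2 * 1 * (1 / 2) ^ 8 := by rw [h2]; gcongr
      _ = 1 / 128 := by norm_num
  linarith

/-- The labeling that the algorithm finds is nearly optimal with overwhelming probability. -/
theorem prob_winner_lt_le [Nonempty U] (htb : ∀ x y σ τ, tb x y σ τ ≤ 1) {q e L M : ℕ} (hq : 1 < q) (he : 1 < e)
    (hL : 0 < L)
    (hM : roundStart (sampleSize q e) (groupEdges q e) L (matchEdges e L) L ≤ M) {F G : ℕ → ℕ}
    (hF : ∀ x, F x < q) (hG : ∀ y, G y < q) :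
    prob (fun ω : Fin M → U × U =>
      armVal px py tb q (sampleSize q e) (groupEdges q e) (drawn px py ω)
        (champion tb q (sampleSize q e) (groupEdges q e) (drawn px py ω) L (matchEdges e L) L 0) <
      drawnVal px py tb F G - 10 / e) ≤ (1 / 2) ^ 2 ^ L := by
  have he0 : (0 : ℝ) < e := by exact_mod_cast (by omega : 0 < e)
  have hL0 : (0 : ℝ) < L := by exact_mod_cast hL
  have hl0 : 0 < Nat.clog 2 (q * e) := Nat.clog_pos (by decide)
    (lt_of_lt_of_le hq (Nat.le_mul_of_pos_right _ (by omega)))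
  have ht0 : 0 < sampleSize q e := by
    unfold sampleSize
    positivity
  have hs0 : 0 < groupEdges q e := by
    unfold groupEdges
    positivity
  have he1 : 1 / (e : ℝ) ≤ 1 := by
    rw [div_le_one he0]
    exact_mod_cast he.le
  -- The matches are judged up to `1 / (e L)`, so `L` rounds lose `2 / e` on top of the `8 / e` of a
  -- good group. The number `128 e² L³` of edges per match is what `hS'` demands at this accuracy,
  -- with equality.
  have h := prob_champion_lt_le (px := px) (py := py) htb (q := q) (t := sampleSize q e)
    (s₀ := groupEdges q e) (S := matchEdges e L) hL
    (by unfold matchEdges; positivity) hM (θ := drawnVal px py tb F G - 8 * (1 / e))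
    (by positivity) (group_failure_le hq he)
    (fun j hj => prob_group_bad_le htb (by omega) ht0 hs0
      ((succ_mul_groupSize_le hj).trans hM) hF hG (by positivity) he1)
    (ε := 1 / (e * L)) (by positivity) ?_ (le_of_eq ?_)
  · refine le_trans (prob_mono fun ω hω => hω.trans_eq ?_) h
    field_simp
    ring
  · rw [div_le_one (by positivity)]
    exact_mod_cast Nat.mul_pos (by omega) hL
  · rw [matchEdges]
    push_cast
    field_simp

end Tournament

/-! ## Random bits -/

section Bits

open Finset
open scoped BigOperators

/-- Restricting uniform bits to some of the positions gives uniform bits. -/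
theorem prob_comp_injective {I J V : Type*} [Fintype I] [Fintype J] [DecidableEq I]
    [DecidableEq J] [Fintype V] [Nonempty V] {ι : J → I} (hι : Function.Injective ι)
    (p : (J → V) → Prop) : prob (fun r : I → V => p (r ∘ ι)) = prob p := by
  classical
  -- A bit vector is the pair of its restrictions to the range of `ι`, reindexed by `J`, and to the
  -- complement; the event sees only the first component.
  let f := (Equiv.piEquivPiSubtypeProd (fun i => i ∈ Set.range ι) fun _ : I => V).trans
    (Equiv.prodCongr ((Equiv.ofInjective ι hι).arrowCongr (Equiv.refl V)).symm (Equiv.refl _))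
  have h : prob (fun r : I → V => p (r ∘ ι)) =
      prob (fun x : (J → V) × ({i // i ∉ Set.range ι} → V) => p x.1) := by
    unfold prob
    refine Fintype.expect_equiv f _ _ fun r => ?_
    rfl
  rw [h]
  unfold prob
  rw [← univ_product_univ, expect_product]
  exact expect_congr rfl fun x _ => expect_const
    (univ_nonempty (α := {i // i ∉ Set.range ι} → V)) (if p x then (1 : ℝ) else 0)

theorem prob_equiv {A B : Type*} [Fintype A] [Fintype B] (f : A ≃ B) (p : B → Prop) :
    prob (fun a => p (f a)) = prob p := by
  unfold prob
  exact Fintype.expect_equiv f _ _ fun _ => rfl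

theorem bitsVal_congr {τ τ' : List Bool} {b : ℕ}
    (h : ∀ k < b, τ.getD k false = τ'.getD k false) : bitsVal τ b = bitsVal τ' b := by
  induction b with
  | zero => rfl
  | succ b ih => rw [bitsVal, bitsVal, ih fun k hk => h k (by omega), h b (by omega)]

theorem eq_of_toNat_eq {c c' : Bool} (h : c.toNat = c'.toNat) : c = c' := by
  cases c <;> cases c' <;> simp_all

theorem getD_eq_of_bitsVal_eq {τ τ' : List Bool} {b : ℕ} (h : bitsVal τ b = bitsVal τ' b) :
    ∀ k < b, τ.getD k false = τ'.getD k false := by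
  induction b with
  | zero => omega
  | succ b ih =>
    rw [bitsVal, bitsVal] at h
    have h1 := Bool.toNat_le (τ.getD b false)
    have h2 := Bool.toNat_le (τ'.getD b false)
    intro k hk
    rcases Nat.lt_succ_iff_lt_or_eq.mp hk with hk | rfl
    · exact ih (by omega) k hk
    · exact eq_of_toNat_eq (by omega)

theorem getD_ofFn {T : ℕ} (r : Fin T → Bool) {k : ℕ} (hk : k < T) :
    (List.ofFn r).getD k false = r ⟨k, hk⟩ := by
  rw [List.getD_eq_getElem _ _ (by simpa using hk), List.getElem_ofFn]

/-- The number with binary digits `u`. -/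
def wordVal {b : ℕ} (u : Fin b → Bool) : ℕ := bitsVal (List.ofFn u) b

/-- Binary expansion is injective, hence by cardinality a bijection onto the numbers below `2 ^ b`.
-/
theorem sum_wordVal (b : ℕ) (f : ℕ → ℝ) :
    ∑ u : Fin b → Bool, f (wordVal u) = ∑ k ∈ range (2 ^ b), f k := by
  have hinj : Function.Injective (wordVal (b := b)) := fun u v h => by
    funext k
    have := getD_eq_of_bitsVal_eq h k k.2
    rwa [getD_ofFn _ k.2, getD_ofFn _ k.2] at this
  have himg : (univ : Finset (Fin b → Bool)).image wordVal = range (2 ^ b) := by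
    refine eq_of_subset_of_card_le (fun k hk => ?_) ?_
    · obtain ⟨u, -, rfl⟩ := mem_image.mp hk
      exact mem_range.mpr (bitsVal_lt _ _)
    · rw [card_image_of_injective _ hinj]
      simp
  rw [← himg, sum_image fun u _ v _ h => hinj h]

theorem sum_range_mod (φ : ℕ → ℝ) (m N : ℕ) :
    ∑ k ∈ range N, φ (k % m) =
      (N / m : ℕ) * ∑ x ∈ range m, φ x + ∑ x ∈ range (N % m), φ x := by
  have h : ∀ Q, ∑ k ∈ range (m * Q), φ (k % m) = Q * ∑ x ∈ range m, φ x := fun Q => by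
    induction Q with
    | zero => simp
    | succ Q ih =>
      rw [Nat.mul_succ, sum_range_add, ih]
      push_cast
      rw [add_mul, one_mul]
      congr 1
      refine sum_congr rfl fun x hx => ?_
      rw [Nat.mul_add_mod, Nat.mod_eq_of_lt (mem_range.mp hx)]
  conv_lhs => rw [← Nat.div_add_mod N m]
  rw [sum_range_add, h]
  congr 1
  refine sum_congr rfl fun x hx => ?_
  have : m = 0 ∨ x < m := by
    rcases Nat.eq_zero_or_pos m with h | h
    · exact Or.inl h
    · exact Or.inr ((mem_range.mp hx).trans (Nat.mod_lt _ h))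
  rcases this with rfl | h
  · simp
  · rw [Nat.mul_add_mod, Nat.mod_eq_of_lt h]

/-- A random number modulo `m` is nearly uniform. -/
theorem abs_expect_mod_sub_le {m b : ℕ} (hm : 0 < m) {φ : ℕ → ℝ} (h0 : ∀ x, 0 ≤ φ x)
    (h1 : ∀ x, φ x ≤ 1) :
    |𝔼 u : Fin b → Bool, φ (wordVal u % m) - (∑ x ∈ range m, φ x) / m| ≤ m / 2 ^ b := by
  have hb : (0 : ℝ) < 2 ^ b := by positivity
  have hm' : (0 : ℝ) < m := by exact_mod_cast hm
  rw [Fintype.expect_eq_sum_div_card, sum_wordVal b fun k => φ (k % m), sum_range_mod]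
  have hcard : (Fintype.card (Fin b → Bool) : ℝ) = 2 ^ b := by simp
  rw [hcard]
  set Φ := ∑ x ∈ range m, φ x
  have hΦ0 : 0 ≤ Φ := sum_nonneg fun x _ => h0 x
  have hΦ1 : Φ ≤ m := (sum_le_card_nsmul _ _ 1 fun x _ => h1 x).trans (by simp)
  set R := 2 ^ b % m with hR
  set Ψ := ∑ x ∈ range R, φ x
  have hΨ0 : 0 ≤ Ψ := sum_nonneg fun x _ => h0 x
  have hΨ1 : Ψ ≤ R := (sum_le_card_nsmul _ _ 1 fun x _ => h1 x).trans (by simp)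
  have hRm : (R : ℝ) ≤ m := by exact_mod_cast (Nat.mod_lt _ hm).le
  have hdm : (2 : ℝ) ^ b = m * (2 ^ b / m : ℕ) + R := by
    exact_mod_cast (Nat.div_add_mod (2 ^ b) m).symm
  have hR0 : (0 : ℝ) ≤ R := Nat.cast_nonneg _
  -- Complete periods contribute the exact mean; the whole error comes from the `R < m` leftover
  -- numbers.
  have e : ((2 ^ b / m : ℕ) * Φ + Ψ) / 2 ^ b - Φ / m = (Ψ * m - Φ * R) / (m * 2 ^ b) := by
    rw [div_sub_div _ _ hb.ne' hm'.ne', mul_comm (m : ℝ)]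
    congr 1
    rw [hdm]
    ring
  rw [e, abs_div, abs_of_pos (by positivity : (0 : ℝ) < m * 2 ^ b), div_le_div_iff₀ (by positivity) hb]
  have : |Ψ * m - Φ * R| ≤ m * m := by
    rw [abs_le]
    constructor <;> nlinarith
  nlinarith

/-- The vertex of a part of size `m` that the random word `u` stands for. -/
def wordVertex (m : ℕ) {b : ℕ} (u : Fin b → Bool) : ℕ := wordVal u % m

/-- The two ends are replaced by uniform vertices one after the other; the errors `n / 2 ^ b` and `m
/ 2 ^ b` add up. -/
theorem abs_drawnVal_sub_le {m n b : ℕ} (hm : 0 < m) (hn : 0 < n) {tb : ℕ → ℕ → ℕ → ℕ → ℕ}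
    (htb : ∀ x y σ τ, tb x y σ τ ≤ 1) (F G : ℕ → ℕ) :
    |drawnVal (wordVertex m (b := b)) (wordVertex n) tb F G -
      (∑ x ∈ range m, ∑ y ∈ range n, tb x y (F x) (G y) : ℕ) / (m * n)| ≤ (m + n) / 2 ^ b := by
  have htb0 : ∀ x y σ τ, (0 : ℝ) ≤ tb x y σ τ := fun _ _ _ _ => Nat.cast_nonneg _
  have htb1 : ∀ x y σ τ, (tb x y σ τ : ℝ) ≤ 1 := fun x y σ τ => by exact_mod_cast htb x y σ τ
  have hn' : (0 : ℝ) < n := by exact_mod_cast hn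
  set ψ : ℕ → ℝ := fun x => (∑ y ∈ range n, (tb x y (F x) (G y) : ℝ)) / n with hψ
  have hψ0 : ∀ x, 0 ≤ ψ x := fun x => div_nonneg (sum_nonneg fun _ _ => htb0 _ _ _ _) hn'.le
  have hψ1 : ∀ x, ψ x ≤ 1 := fun x => by
    rw [hψ, div_le_one hn']
    exact (sum_le_card_nsmul _ _ 1 fun y _ => htb1 _ _ _ _).trans (by simp)
  have h1 := abs_expect_mod_sub_le (b := b) hm hψ0 hψ1
  have h2 : |drawnVal (wordVertex m (b := b)) (wordVertex n) tb F G -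
      𝔼 u : Fin b → Bool, ψ (wordVal u % m)| ≤ n / 2 ^ b := by
    rw [drawnVal, ← univ_product_univ, expect_product, ← expect_sub_distrib]
    refine (abs_expect_le _ _).trans (expect_le univ_nonempty fun u _ => ?_)
    exact abs_expect_mod_sub_le hn (φ := fun y => (tb (wordVertex m u) y (F (wordVertex m u)) (G y) : ℝ))
      (fun _ => htb0 _ _ _ _) fun _ => htb1 _ _ _ _
  have h3 : ((∑ x ∈ range m, ∑ y ∈ range n, tb x y (F x) (G y) : ℕ) : ℝ) / (m * n) =
      (∑ x ∈ range m, ψ x) / m := by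
    rw [hψ, ← sum_div, div_div, mul_comm (n : ℝ)]
    push_cast
    rfl
  rw [h3, add_div]
  have := abs_add_le (drawnVal (wordVertex m (b := b)) (wordVertex n) tb F G -
      𝔼 u : Fin b → Bool, ψ (wordVal u % m))
    (𝔼 u : Fin b → Bool, ψ (wordVal u % m) - (∑ x ∈ range m, ψ x) / m)
  rw [sub_add_sub_cancel] at this
  linarith

/-- The random bit of item `i` at place `k` of the first or second word. -/
def bitIndex {M b T : ℕ} (hT : M * (2 * b) ≤ T) (x : Fin M × Bool × Fin b) : Fin T :=
  ⟨(2 * x.1 + x.2.1.toNat) * b + x.2.2, by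
    have h1 := x.1.2
    have h2 := Bool.toNat_le x.2.1
    have h3 := x.2.2.2
    have : (2 * (x.1 : ℕ) + x.2.1.toNat + 1) * b ≤ 2 * M * b := Nat.mul_le_mul_right _ (by omega)
    have e : (2 * (x.1 : ℕ) + x.2.1.toNat + 1) * b = (2 * (x.1 : ℕ) + x.2.1.toNat) * b + b := by ring
    have e' : 2 * M * b = M * (2 * b) := by ring
    omega⟩

theorem bitIndex_injective {M b T : ℕ} (hT : M * (2 * b) ≤ T) :
    Function.Injective (bitIndex hT) := by
  rintro ⟨i, c, k⟩ ⟨i', c', k'⟩ h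
  have h := Fin.mk.inj h
  simp only at h
  have hb : 0 < b := k.pos
  have h1 := congrArg (· % b) h
  have h2 := congrArg (· / b) h
  simp only [Nat.mul_add_mod', Nat.mod_eq_of_lt k.2, Nat.mod_eq_of_lt k'.2] at h1
  simp only [Nat.mul_comm _ b, Nat.mul_add_div hb, Nat.div_eq_of_lt k.2, Nat.div_eq_of_lt k'.2] at h2
  have c1 := Bool.toNat_le c
  have c2 := Bool.toNat_le c'
  have hi : i = i' := Fin.ext (by omega)
  have hc : c = c' := eq_of_toNat_eq (by omega)
  rw [hi, hc, Fin.ext h1]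

/-- Arrange random bits as pairs of words. -/
def wordsEquiv (M b : ℕ) :
    (Fin M × Bool × Fin b → Bool) ≃ (Fin M → (Fin b → Bool) × (Fin b → Bool)) where
  toFun f i := (fun k => f (i, false, k), fun k => f (i, true, k))
  invFun ω x := cond x.2.1 ((ω x.1).2 x.2.2) ((ω x.1).1 x.2.2)
  left_inv f := by
    funext ⟨i, c, k⟩
    cases c <;> rfl
  right_inv ω := rfl

/-- Words of distinct items occupy disjoint stretches of the tape. Thus the items read by the
program are independent draws, as the probabilistic part assumes. -/
theorem itemAt_eq_drawn {M b T m n : ℕ} (hT : M * (2 * b) ≤ T) (r : Fin T → Bool) {i : ℕ}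
    (hi : i < M) : itemAt b m n (List.ofFn r) i =
      drawn (wordVertex m) (wordVertex n) (wordsEquiv M b (r ∘ bitIndex hT)) i := by
  have key : ∀ (c : Bool) (o : ℕ), o = (2 * i + c.toNat) * b →
      bitsVal ((List.ofFn r).drop o) b =
        wordVal fun k => r (bitIndex hT (⟨i, hi⟩, c, k)) := by
    rintro c o rfl
    refine bitsVal_congr fun k hk => ?_
    rw [getD_ofFn _ hk, List.getD_eq_getElem?_getD, List.getElem?_drop,
      ← List.getD_eq_getElem?_getD]
    exact getD_ofFn r (bitIndex hT (⟨i, hi⟩, c, ⟨k, hk⟩)).2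
  rw [itemAt, drawn, dif_pos hi, key false _ (by simp; ring), key true _ (by simp; ring)]
  rfl

/-- With overwhelming probability over the bits of the tape, the algorithm finds a labeling that
is nearly as good as any other. -/
theorem prob_outCount_lt_le {m n q e T : ℕ} {a : ℕ → ℕ} (ha : ∀ i, a i ≤ 1) (hm : 0 < m)
    (hn : 0 < n) (hq : 1 < q) (he : 1 < e)
    (hT : roundStart (sampleSize q e) (groupEdges q e) (numRounds m n q)
      (matchEdges e (numRounds m n q)) (numRounds m n q) * (2 * bitLength m n e) ≤ T) {F G : ℕ → ℕ}
    (hF : ∀ x, F x < q) (hG : ∀ y, G y < q) :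
    prob (fun r : Fin T → Bool =>
      (outCount m n q e a (itemAt (bitLength m n e) m n (List.ofFn r)) : ℝ) / (m * n) <
      (∑ x ∈ range m, ∑ y ∈ range n, tableAt n q a x y (F x) (G y) : ℕ) / (m * n) - 12 / e) ≤
      (1 / 2) ^ (m * n * q * q + 1) := by
  set L := numRounds m n q with hL
  set b := bitLength m n e with hb
  set t := sampleSize q e with ht
  set s₀ := groupEdges q e with hs₀
  set S := matchEdges e L with hS
  set tb := tableAt n q a with htb'
  set M := roundStart t s₀ L S L with hM
  have htb : ∀ x y σ τ, tb x y σ τ ≤ 1 := fun _ _ _ _ => ha _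
  have hL0 : 0 < L := Nat.clog_pos (by decide) (by omega)
  have he0 : (0 : ℝ) < e := by exact_mod_cast (by omega : 0 < e)
  -- `bitLength` is chosen for this. The bias enters twice, for the comparison labeling and for the
  -- output, and fits easily between `10 / e` and `12 / e`.
  have hbias : ((m : ℝ) + n) / 2 ^ b ≤ 1 / (8 * e) := by
    rw [div_le_div_iff₀ (by positivity) (by positivity)]
    have : 8 * e * (m + n) ≤ 2 ^ b := Nat.le_pow_clog (by decide) _
    have : (8 : ℝ) * e * (m + n) ≤ 2 ^ b := by exact_mod_cast this
    linarith
  have h := prob_winner_lt_le (px := wordVertex m (b := b)) (py := wordVertex n) htb hq he hL0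
    (M := M) le_rfl hF hG
  rw [← prob_equiv (wordsEquiv M b), ← prob_comp_injective (bitIndex_injective hT)] at h
  refine (prob_mono fun r hr => ?_).trans (h.trans ?_)
  · set ω := itemAt b m n (List.ofFn r) with hω
    set ω' := drawn (wordVertex m) (wordVertex n) (wordsEquiv M b (r ∘ bitIndex hT)) with hω'
    -- The streams may differ from position `M` on, but the winner and its labeling are determined
    -- by the items below `M`.
    have heq : ∀ i < M, ω i = ω' i := fun i hi => itemAt_eq_drawn hT r hi
    have hc : champion tb q t s₀ ω L S L 0 = champion tb q t s₀ ω' L S L 0 :=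
      champion_congr L le_rfl heq 0 (by simp)
    have hlt : champion tb q t s₀ ω L S L 0 < 2 ^ L := champion_lt _ _ _ _ _ _ _ L le_rfl 0 (by simp)
    have harm : armVal (wordVertex m (b := b)) (wordVertex n) tb q t s₀ ω
        (champion tb q t s₀ ω L S L 0) = armVal (wordVertex m (b := b)) (wordVertex n) tb q t s₀ ω'
        (champion tb q t s₀ ω' L S L 0) := by
      rw [← hc]
      exact armVal_congr fun i _ hi => heq i (hi.trans_le (succ_mul_groupSize_le hlt))
    show armVal _ _ tb q t s₀ ω' (champion tb q t s₀ ω' L S L 0) < _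
    rw [← harm]
    have e1 := abs_drawnVal_sub_le (b := b) hm hn htb F G
    have e2 : |armVal (wordVertex m (b := b)) (wordVertex n) tb q t s₀ ω
        (champion tb q t s₀ ω L S L 0) - (outCount m n q e a ω : ℝ) / (m * n)| ≤ (m + n) / 2 ^ b :=
      abs_drawnVal_sub_le hm hn htb (outX m n q e a ω) (outY m n q e a ω)
    have e3 := (abs_le.mp (e1.trans hbias)).1
    have e4 := (abs_le.mp (e2.trans hbias)).2
    have e5 : (1 : ℝ) / (8 * e) = 1 / 8 * (1 / e) := by field_simp
    have e6 : (12 : ℝ) / e = 12 * (1 / e) := by ring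
    have e7 : (10 : ℝ) / e = 10 * (1 / e) := by ring
    have e8 : (0 : ℝ) < 1 / e := by positivity
    rw [e5] at e3 e4
    rw [e6] at hr
    rw [e7]
    linarith
  -- `numRounds` makes `2 ^ L` at least `2 m n q² + 2`, which is more than the exponent needed for
  -- the union bound over games.
  · refine pow_le_pow_of_le_one (by norm_num) (by norm_num) ?_
    have : 2 * m * n * q * q + 2 ≤ 2 ^ L := Nat.le_pow_clog (by decide) _
    have e : 2 * m * n * q * q = 2 * (m * n * q * q) := by ring
    omega

end Bits

/-! ## Running time and word size -/

section Bounds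

theorem two_pow_clog_le {x : ℕ} (hx : 0 < x) : 2 ^ Nat.clog 2 x ≤ 2 * x := by
  rcases Nat.lt_or_ge 1 x with h | h
  · have h1 := Nat.pow_pred_clog_lt_self (b := 2) (by decide) h
    obtain ⟨k, hk⟩ := Nat.exists_eq_succ_of_ne_zero (Nat.clog_pos (b := 2) (by decide) h).ne'
    rw [hk, Nat.pred_succ] at h1
    rw [hk, pow_succ]
    omega
  · rw [Nat.clog_of_right_le_one h]
    omega

theorem clog_le_self (x : ℕ) : Nat.clog 2 x ≤ x :=
  Nat.clog_le_of_le_pow Nat.lt_two_pow_self.le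

theorem two_pow_numRounds_le {m n q : ℕ} (hm : 0 < m) (hn : 0 < n) (hq : 0 < q) :
    2 ^ numRounds m n q ≤ 8 * (m * n * (q * q)) := by
  have h : 0 < m * n * (q * q) := by positivity
  have h1 := two_pow_clog_le (x := 2 * m * n * q * q + 2) (by omega)
  have e : 2 * m * n * q * q = 2 * (m * n * (q * q)) := by ring
  unfold numRounds
  omega

theorem two_pow_bitLength_le {m n e : ℕ} (hm : 0 < m) (hn : 0 < n) (he : 0 < e) :
    2 ^ bitLength m n e ≤ 32 * e * (m * n) := by
  refine (two_pow_clog_le (by positivity)).trans ?_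
  have : m + n ≤ 2 * (m * n) := by nlinarith
  nlinarith [Nat.mul_le_mul_left e this]

/-- Bounds for the parameters in terms of `q ^ t`. -/
structure ParamBounds (m n q e Q : ℕ) : Prop where
  one_le : 4000 ≤ Q
  sample : sampleSize q e ≤ Q
  labels : q ≤ Q
  sq : 32 * e * e ≤ Q
  log : Nat.clog 2 (q * e) ≤ Q
  N : 2 ^ numRounds m n q ≤ m * n * Q ^ 3
  s₀ : groupEdges q e ≤ Q ^ 3
  S : matchEdges e (numRounds m n q) ≤ 4 * Q * numRounds m n q ^ 3
  U : 2 ^ bitLength m n e ≤ m * n * Q ^ 2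
  bits : 1 ≤ bitLength m n e
  rounds : 1 ≤ numRounds m n q

/-- As `q ≥ 2`, the number `Q = q ^ t` is at least `2 ^ t`, and `t` already dominates `32 e²` and
the logarithm of `q e`. So `Q` bounds all of them; only `m n` and the number of rounds have to be
kept apart. -/
theorem paramBounds {m n q e : ℕ} (hm : 0 < m) (hn : 0 < n) (hq : 1 < q) (he : 1 < e) :
    ParamBounds m n q e (q ^ sampleSize q e) := by
  have hqe : 1 < q * e := lt_of_lt_of_le hq (Nat.le_mul_of_pos_right _ (by omega))
  have hl : 0 < Nat.clog 2 (q * e) := Nat.clog_pos (by decide) hqe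
  set t := sampleSize q e with ht
  set Q := q ^ t with hQ
  have ht1 : 32 * e * e ≤ t := Nat.le_mul_of_pos_right _ hl
  have ht2 : Nat.clog 2 (q * e) ≤ t := Nat.le_mul_of_pos_left _ (by positivity)
  have he4 : 2 * 2 ≤ e * e := Nat.mul_le_mul he he
  have ht3 : 12 ≤ t := by nlinarith
  have h2Q : 2 ^ t ≤ Q := Nat.pow_le_pow_left hq t
  have htQ : t ≤ Q := Nat.lt_two_pow_self.le.trans h2Q
  have hqQ : q ≤ Q := Nat.le_self_pow (by omega) q
  have h1 : 4000 ≤ Q := by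
    have : 2 ^ 12 ≤ 2 ^ t := Nat.pow_le_pow_right (by decide) ht3
    omega
  have heQ : 32 * e * e ≤ Q := ht1.trans htQ
  refine ⟨h1, htQ, hqQ, heQ, ht2.trans htQ, ?_, ?_, ?_, ?_, ?_, ?_⟩
  · refine (two_pow_numRounds_le hm hn (by omega)).trans ?_
    calc 8 * (m * n * (q * q)) ≤ Q * (m * n * (Q * Q)) := by gcongr; omega
      _ = m * n * Q ^ 3 := by ring
  · calc groupEdges q e = 8 * e * e * q * t := rfl
      _ ≤ Q * Q * Q := by
        gcongr
        nlinarith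
      _ = Q ^ 3 := by ring
  · calc matchEdges e (numRounds m n q) = 4 * (32 * e * e) * numRounds m n q ^ 3 := by
          unfold matchEdges
          ring
      _ ≤ 4 * Q * numRounds m n q ^ 3 := by gcongr
  · refine (two_pow_bitLength_le hm hn (by omega)).trans ?_
    calc 32 * e * (m * n) ≤ 32 * e * (m * n) * e := Nat.le_mul_of_pos_right _ (by omega)
      _ = 32 * e * e * (m * n) := by ring
      _ ≤ Q * (m * n) := by gcongr
      _ ≤ Q * (m * n) * Q := Nat.le_mul_of_pos_right _ (by omega)
      _ = m * n * Q ^ 2 := by ring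
  · refine Nat.clog_pos (by decide) ?_
    have : 8 * e * 1 ≤ 8 * e * (m + n) := Nat.mul_le_mul_left _ (by omega)
    omega
  · exact Nat.clog_pos (by decide) (by omega)

/-- The factor `m n` enters linearly and `b`, `L` are logarithmic, so only powers of `Q` may be
spent freely: they merely change the constant in the exponent of `q`. -/
theorem solveTime_le {m n q e : ℕ} (hm : 0 < m) (hn : 0 < n) (hq : 1 < q) (he : 1 < e) :
    solveTime m n q e ≤
      m * n * bitLength m n e * numRounds m n q ^ 4 * (q ^ sampleSize q e) ^ 11 := by
  have P := paramBounds hm hn hq he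
  unfold solveTime tournamentTime
  simp only
  set Q := q ^ sampleSize q e
  set t := sampleSize q e
  set b := bitLength m n e
  set L := numRounds m n q
  set s₀ := groupEdges q e
  set S := matchEdges e L
  set X := m * n with hX
  set Y := X * b * L ^ 4 with hY
  have hX1 : 1 ≤ X := Nat.mul_pos hm hn
  have hb := P.bits
  have hL := P.rounds
  have hQ := P.one_le
  have hL4 : 1 ≤ L ^ 4 := Nat.one_le_pow _ _ hL
  have hXb : X * b ≤ Y := Nat.le_mul_of_pos_right _ hL4
  have hXY : X ≤ Y := (Nat.le_mul_of_pos_right _ hb).trans hXb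
  have hbY : b ≤ Y := (Nat.le_mul_of_pos_left _ hX1).trans hXb
  have hLY : L ≤ Y := (Nat.le_self_pow (by decide) L).trans
    (Nat.le_mul_of_pos_left _ (Nat.mul_pos hX1 hb))
  have hY1 : 1 ≤ Y := hX1.trans hXY
  have hts : t + s₀ ≤ 2 * Q ^ 3 := by
    have h1 := P.sample
    have h2 := P.s₀
    have : Q ≤ Q ^ 3 := Nat.le_self_pow (by decide) Q
    omega
  have htS : t + S ≤ 5 * Q * L ^ 3 := by
    have h1 := P.sample
    have h2 : S ≤ 4 * Q * L ^ 3 := P.S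
    have h3 : Q ≤ Q * L ^ 3 := Nat.le_mul_of_pos_right _ (by positivity)
    have e1 : 5 * Q * L ^ 3 = 4 * Q * L ^ 3 + Q * L ^ 3 := by ring
    omega
  have hpow : ∀ k, 4000 * Q ^ k ≤ Q ^ (k + 1) := fun k => by
    rw [pow_succ']
    exact Nat.mul_le_mul_right _ hQ
  have hQ10 : ∀ k ≤ 10, Y * Q ^ k ≤ Y * Q ^ 10 := fun k hk =>
    Nat.mul_le_mul_left _ (Nat.pow_le_pow_right (by omega) hk)
  have t1 : 3 * (Nat.clog 2 (q * e) + b + L) + 70 ≤ 79 * (Y * Q ^ 10) := by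
    have h0 := hQ10 0 (by decide)
    have h1 := hQ10 1 (by decide)
    have h2 : Q ≤ Y * Q := Nat.le_mul_of_pos_left _ hY1
    have := P.log
    rw [pow_zero, mul_one] at h0
    rw [pow_one] at h1
    omega
  have t2 : 2 ^ L * (200 * (b * Q * (q * t * (t + s₀))) + 3) ≤ 403 * (Y * Q ^ 10) := by
    calc 2 ^ L * (200 * (b * Q * (q * t * (t + s₀))) + 3)
        ≤ X * Q ^ 3 * (200 * (b * Q * (Q * Q * (2 * Q ^ 3))) + 3 * (b * Q ^ 6)) := by
          gcongr
          · exact P.N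
          · exact P.labels
          · exact P.sample
          · exact Nat.le_mul_of_pos_right _ (by positivity)
      _ = 403 * (X * b * Q ^ 9) := by ring
      _ ≤ 403 * (Y * Q ^ 9) := by gcongr
      _ ≤ _ := Nat.mul_le_mul_left _ (hQ10 9 (by decide))
  have t3 : L * (300 * (2 ^ L * (b * (q * t * (t + S))))) ≤ 1500 * (Y * Q ^ 10) := by
    calc L * (300 * (2 ^ L * (b * (q * t * (t + S)))))
        ≤ L * (300 * (X * Q ^ 3 * (b * (Q * Q * (5 * Q * L ^ 3))))) := by
          gcongr
          · exact P.N
          · exact P.labels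
          · exact P.sample
      _ = 1500 * (Y * Q ^ 6) := by rw [hY]; ring
      _ ≤ _ := Nat.mul_le_mul_left _ (hQ10 6 (by decide))
  have t4 : 150 * (X * (q * t * t)) ≤ 150 * (Y * Q ^ 10) := by
    refine Nat.mul_le_mul_left _ (le_trans ?_ (hQ10 3 (by decide)))
    calc X * (q * t * t) ≤ Y * (Q * Q * Q) := by
          gcongr
          · exact P.labels
          · exact P.sample
          · exact P.sample
      _ = Y * Q ^ 3 := by ring
  -- `2132 = 79 + 403 + 1500 + 150`; one more factor `Q ≥ 4000` swallows the numerical constants.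
  have h11 : 2132 * (Y * Q ^ 10) ≤ Y * Q ^ 11 := by
    have : Y * (4000 * Q ^ 10) ≤ Y * Q ^ 11 := Nat.mul_le_mul_left Y (hpow 10)
    have e1 : Y * (4000 * Q ^ 10) = 4000 * (Y * Q ^ 10) := by ring
    rw [e1] at this
    omega
  omega

/-- The tape holds as many bits as the time bound allows steps. This ensures that every item is made
of genuine tape bits and not of the zeros read from an exhausted tape. -/
theorem numBits_le {m n q e : ℕ} (hm : 0 < m) (hn : 0 < n) (hq : 1 < q) (he : 1 < e) :
    roundStart (sampleSize q e) (groupEdges q e) (numRounds m n q)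
      (matchEdges e (numRounds m n q)) (numRounds m n q) * (2 * bitLength m n e) ≤
      m * n * bitLength m n e * numRounds m n q ^ 4 * (q ^ sampleSize q e) ^ 11 := by
  have P := paramBounds hm hn hq he
  unfold roundStart groupSize
  set Q := q ^ sampleSize q e
  set t := sampleSize q e
  set b := bitLength m n e
  set L := numRounds m n q
  set s₀ := groupEdges q e
  set S := matchEdges e L
  have hL := P.rounds
  have hQ := P.one_le
  have hts : 2 * t + s₀ ≤ 3 * Q ^ 3 := by
    have h1 := P.sample
    have h2 := P.s₀
    have : Q ≤ Q ^ 3 := Nat.le_self_pow (by decide) Q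
    omega
  have hL1 : 2 ^ (L - 1) ≤ 2 ^ L := Nat.pow_le_pow_right (by decide) (by omega)
  have hL4 : 1 ≤ L ^ 4 := Nat.one_le_pow _ _ hL
  calc (2 ^ L * (2 * t + s₀) + L * (2 ^ (L - 1) * S)) * (2 * b)
      ≤ (m * n * Q ^ 3 * (3 * Q ^ 3) * L ^ 4 + L * (m * n * Q ^ 3 * (4 * Q * L ^ 3))) * (2 * b) := by
        refine Nat.mul_le_mul_right _ (Nat.add_le_add ?_ (Nat.mul_le_mul_left _
          (Nat.mul_le_mul (hL1.trans P.N) P.S)))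
        exact (Nat.mul_le_mul P.N hts).trans (Nat.le_mul_of_pos_right _ hL4)
    _ = m * n * b * L ^ 4 * (6 * Q ^ 6 + 8 * Q ^ 4) := by ring
    _ ≤ m * n * b * L ^ 4 * Q ^ 11 := by
        gcongr
        have h1 : Q ^ 4 ≤ Q ^ 6 := Nat.pow_le_pow_right (by omega) (by decide)
        have h2 : Q ^ 7 ≤ Q ^ 11 := Nat.pow_le_pow_right (by omega) (by decide)
        have h3 : 4000 * Q ^ 6 ≤ Q ^ 7 := by
          rw [pow_succ' Q 6]
          exact Nat.mul_le_mul_right _ hQ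
        omega

/-- Since `ε ≤ 1`, `e ≤ 2 / ε` and the rounded-up logarithm is at most `6 log (q / ε)`; thus `11 *
32 * 4 * 6 = 8448` fits below `10000`. The `11` is the exponent of `Q` in the running time. -/
theorem mul_sampleSize_le {p d q : ℕ} (hp : 0 < p) (hpd : p ≤ d) (hq : 1 < q) {ε : ℝ}
    (hε : ε = p / d) :
    (11 * sampleSize q (invEps p d) : ℕ) ≤ (10000 : ℕ) * (1 / ε ^ 2) * Real.log (q / ε) := by
  have hp' : (0 : ℝ) < p := by exact_mod_cast hp
  have hd' : (0 : ℝ) < d := by exact_mod_cast (hp.trans_le hpd)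
  have hq' : (2 : ℝ) ≤ q := by exact_mod_cast hq
  have hε0 : 0 < ε := by rw [hε]; positivity
  have hε1 : ε ≤ 1 := by
    rw [hε, div_le_one hd']
    exact_mod_cast hpd
  set e := invEps p d with he
  have he2 : (e : ℝ) ≤ 2 / ε := by
    have h1 : ((d / p : ℕ) : ℝ) ≤ d / p := Nat.cast_div_le
    have h2 : (d : ℝ) / p = 1 / ε := by rw [hε, one_div_div]
    have h3 : 1 ≤ 1 / ε := by rwa [le_div_iff₀ hε0, one_mul]
    rw [he, invEps]
    push_cast
    have : 2 / ε = 1 / ε + 1 / ε := by ring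
    linarith
  have he0 : 0 < e := Nat.succ_pos _
  set l := Nat.clog 2 (q * e) with hl
  have hqε : 2 ≤ q / ε := by
    rw [le_div_iff₀ hε0]
    nlinarith
  have hl1 : (2 : ℝ) ^ l ≤ 4 * (q / ε) := by
    have h1 : 2 ^ l ≤ 2 * (q * e) := two_pow_clog_le (Nat.mul_pos (by omega) he0)
    have h2 : (2 : ℝ) ^ l ≤ 2 * (q * e) := by exact_mod_cast h1
    have h3 : (q : ℝ) * e ≤ q * (2 / ε) := by gcongr
    have h4 : 4 * ((q : ℝ) / ε) = 2 * (q * (2 / ε)) := by ring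
    linarith
  have hlog2 : 1 / 2 ≤ Real.log 2 := by linarith [Real.log_two_gt_d9]
  have hlog : Real.log 2 ≤ Real.log (q / ε) := Real.log_le_log (by norm_num) hqε
  have hl2 : (l : ℝ) ≤ 6 * Real.log (q / ε) := by
    have h1 := Real.log_le_log (by positivity) hl1
    rw [Real.log_pow, Real.log_mul (by norm_num) (by positivity),
      show (4 : ℝ) = 2 ^ 2 by norm_num, Real.log_pow] at h1
    push_cast at h1
    have h2 : (l : ℝ) * (1 / 2) ≤ l * Real.log 2 := by gcongr
    linarith
  have he3 : (e : ℝ) * e ≤ 4 * (1 / ε ^ 2) := by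
    calc (e : ℝ) * e ≤ (2 / ε) * (2 / ε) := by gcongr
      _ = 4 * (1 / ε ^ 2) := by field_simp; norm_num
  have hpos : 0 ≤ 1 / ε ^ 2 * Real.log (q / ε) := by
    have : 0 ≤ Real.log (q / ε) := by linarith
    positivity
  calc ((11 * sampleSize q e : ℕ) : ℝ) = 352 * ((e : ℝ) * e) * l := by
        rw [sampleSize, ← hl]
        push_cast
        ring
    _ ≤ 352 * (4 * (1 / ε ^ 2)) * (6 * Real.log (q / ε)) := by gcongr
    _ = 8448 * (1 / ε ^ 2 * Real.log (q / ε)) := by ring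
    _ ≤ 10000 * (1 / ε ^ 2 * Real.log (q / ε)) := by gcongr; norm_num
    _ = _ := by push_cast; ring

/-- The constant factor of the running time. -/
noncomputable def timeConst : ℕ := ⌈5 * Real.exp 10000⌉₊

theorem one_le_logb_two_add {F : ℝ} (hF : 0 ≤ F) : 1 ≤ Real.logb 2 (2 + F) := by
  rw [Real.le_logb_iff_rpow_le (by norm_num) (by linarith)]
  simpa using hF

theorem five_le_timeConst : 5 ≤ timeConst := by
  have h : (5 : ℝ) ≤ timeConst := by
    refine le_trans ?_ (Nat.le_ceil _)
    have := Real.one_le_exp (x := 10000) (by norm_num)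
    linarith
  exact_mod_cast h

/-- The main factor is at least `m n Q¹¹`, so `b` and `L` are both bounded by its logarithm. The
product `b L⁴` then accounts for the fifth power of the logarithm. -/
theorem le_timeBound {p d m n q X : ℕ} (hm : 0 < m) (hn : 0 < n) (hp : 0 < p) (hpd : p ≤ d)
    (hq : 1 < q) {ε : ℚ} (hε : (ε : ℝ) = p / d)
    (hX : X ≤ m * n * bitLength m n (invEps p d) * numRounds m n q ^ 4 *
      (q ^ sampleSize q (invEps p d)) ^ 11) : X ≤ timeBound timeConst 10000 5 m n q ε := by
  have he : 1 < invEps p d := by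
    have : 0 < d / p := Nat.div_pos hpd hp
    unfold invEps
    omega
  have P := paramBounds hm hn hq he
  set e := invEps p d with hedef
  set t := sampleSize q e with ht
  set Q := q ^ t with hQ
  set b := bitLength m n e
  set L := numRounds m n q
  set F := mainFactor 10000 m n q ε with hF
  have hQ1 := P.one_le
  have hQF : ((m * n * Q ^ 11 : ℕ) : ℝ) ≤ F := by
    rw [hF, mainFactor]
    push_cast
    gcongr
    rw [hQ]
    push_cast
    rw [← pow_mul, ← Real.rpow_natCast]
    refine Real.rpow_le_rpow_of_exponent_le (by exact_mod_cast hq.le) ?_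
    have := mul_sampleSize_le hp hpd hq hε
    rw [mul_comm 11] at this
    exact this
  have hF0 : 0 ≤ F := le_trans (Nat.cast_nonneg _) hQF
  set lam := Real.logb 2 (2 + F) with hlam
  have hlog : ∀ k : ℕ, 2 ^ k ≤ m * n * Q ^ 11 → (k : ℝ) ≤ lam := fun k hk => by
    rw [hlam, Real.le_logb_iff_rpow_le (by norm_num) (by linarith), Real.rpow_natCast]
    have : ((2 ^ k : ℕ) : ℝ) ≤ (m * n * Q ^ 11 : ℕ) := by exact_mod_cast hk
    push_cast at this hQF
    linarith
  have hb : (b : ℝ) ≤ lam := hlog b (P.U.trans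
    (Nat.mul_le_mul_left _ (Nat.pow_le_pow_right (by omega) (by decide))))
  have hL : (L : ℝ) ≤ lam := hlog L (P.N.trans
    (Nat.mul_le_mul_left _ (Nat.pow_le_pow_right (by omega) (by decide))))
  refine Nat.le_floor ?_
  have hX' : (X : ℝ) ≤ (m * n * Q ^ 11 : ℕ) * (b * L ^ 4) := by
    calc (X : ℝ) ≤ (m * n * b * L ^ 4 * Q ^ 11 : ℕ) := by exact_mod_cast hX
      _ = _ := by push_cast; ring
  have hA : (1 : ℝ) ≤ timeConst := by
    have := five_le_timeConst
    exact_mod_cast (by omega : 1 ≤ timeConst)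
  have hlam0 : 0 ≤ lam := (Nat.cast_nonneg _).trans hb
  calc (X : ℝ) ≤ (m * n * Q ^ 11 : ℕ) * (b * L ^ 4) := hX'
    _ ≤ F * (lam * lam ^ 4) := by gcongr
    _ = 1 * F * lam ^ 5 := by ring
    _ ≤ timeConst * F * lam ^ 5 := by gcongr

/-- For `ε > q` the exponent of `q` is negative and the main factor can be less than `1`. From `log
q ≤ q` and `log (ε / q) ≤ ε / q` it is still at least `exp (-10000)`, which explains the size of
`timeConst`. -/
theorem five_le_timeBound {m n q : ℕ} (hm : 0 < m) (hn : 0 < n) (hq : 0 < q) {ε : ℚ}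
    (h : q = 1 ∨ 1 ≤ (ε : ℝ)) : 5 ≤ timeBound timeConst 10000 5 m n q ε := by
  set F := mainFactor 10000 m n q ε with hF
  have hmn : (1 : ℝ) ≤ m * n := by exact_mod_cast Nat.mul_pos hm hn
  have hFe : Real.exp (-10000) ≤ F := by
    rw [hF, mainFactor]
    refine le_trans ?_ (le_mul_of_one_le_left (by positivity) hmn)
    rcases h with rfl | h
    · rw [Nat.cast_one, Real.one_rpow, Real.exp_le_one_iff]
      norm_num
    · set x := (ε : ℝ)
      have hx : 0 < x := by linarith
      have hq' : (1 : ℝ) ≤ q := by exact_mod_cast hq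
      rw [Real.rpow_def_of_pos (by linarith), Real.exp_le_exp]
      have h1 : 0 ≤ Real.log q := Real.log_nonneg hq'
      have h2 : Real.log q ≤ q := (Real.log_le_sub_one_of_pos (by linarith)).trans (by linarith)
      have h3 : -Real.log (q / x) ≤ x / q := by
        rw [← Real.log_inv, inv_div]
        exact (Real.log_le_sub_one_of_pos (by positivity)).trans (by linarith)
      have h4 : -(Real.log q * Real.log (q / x)) ≤ x := by
        rcases le_total 0 (Real.log (q / x)) with h | h
        · nlinarith [mul_nonneg h1 h]
        · calc -(Real.log q * Real.log (q / x)) = Real.log q * -Real.log (q / x) := by ring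
            _ ≤ q * (x / q) := by
                gcongr
                linarith
            _ = x := by field_simp
      have h5 : x * (1 / x ^ 2) ≤ 1 := by
        rw [mul_one_div, div_le_one (by positivity)]
        nlinarith
      have h6 : 0 < 1 / x ^ 2 := by positivity
      have h7 : -(Real.log q * Real.log (q / x)) * (1 / x ^ 2) ≤ x * (1 / x ^ 2) := by gcongr
      push_cast
      nlinarith
  have hF0 : 0 ≤ F := (Real.exp_pos _).le.trans hFe
  refine Nat.le_floor ?_
  have h1 : (1 : ℝ) ≤ Real.logb 2 (2 + F) ^ 5 := one_le_pow₀ (one_le_logb_two_add hF0)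
  have h2 : 5 ≤ (timeConst : ℝ) * F := by
    calc (5 : ℝ) = 5 * Real.exp 10000 * Real.exp (-10000) := by
          rw [mul_assoc, ← Real.exp_add, add_neg_cancel, Real.exp_zero, mul_one]
      _ ≤ timeConst * F := by
          gcongr
          exact Nat.le_ceil _
  push_cast
  nlinarith

-- Every number that occurs is at most a power `Z ^ k` of the input sum `Z`. The largest is the
-- number of edges `2 ^ L * S`, with `k = 25`, where even `L` is bounded crudely by `2 ^ L ≤ Z ^ 5`;
-- so the power `30` is enough.
set_option maxHeartbeats 1000000 in
theorem fits_of_pow_le {w m n q p₀ d₀ p d : ℕ} (hm : 0 < m) (hn : 0 < n) (hq : 1 < q)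
    (hd₀ : 0 < d₀) (hp : 0 < p) (hpd : p < d)
    (h : (m + n + q + p₀ + d₀ + p + d) ^ 30 ≤ 2 ^ w) : Fits w m n q p₀ d₀ p d := by
  set Z := m + n + q + p₀ + d₀ + p + d with hZ
  have hZ8 : 8 ≤ Z := by omega
  have hle : m ≤ Z ∧ n ≤ Z ∧ q ≤ Z ∧ p₀ ≤ Z ∧ d₀ ≤ Z ∧ p ≤ Z ∧ d + 1 ≤ Z := by omega
  clear_value Z
  obtain ⟨hm', hn', hq', hp₀, hd₀', hp', hd'⟩ := hle
  have lt : ∀ {k x : ℕ}, k ≤ 29 → x ≤ Z ^ k → x < 2 ^ w := fun {k x} hk hx =>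
    lt_of_lt_of_le (lt_of_le_of_lt hx (Nat.pow_lt_pow_right (by omega) (by omega))) h
  have c2 : 2 ≤ Z := by omega
  have c64 : 64 ≤ Z ^ 2 := Nat.pow_le_pow_left hZ8 2
  have c512 : 512 ≤ Z ^ 3 := Nat.pow_le_pow_left hZ8 3
  have he : invEps p d ≤ Z := by
    have := Nat.div_le_self d p
    unfold invEps
    omega
  set e := invEps p d with hedef
  set L := numRounds m n q with hLdef
  have hl : Nat.clog 2 (q * e) ≤ Z ^ 2 := (clog_le_self _).trans (by rw [pow_two]; gcongr)
  have ht : sampleSize q e ≤ Z ^ 6 := by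
    calc sampleSize q e = 32 * e * e * Nat.clog 2 (q * e) := rfl
      _ ≤ Z ^ 2 * Z * Z * Z ^ 2 := by gcongr; omega
      _ = Z ^ 6 := by ring
  have hN : 2 ^ L ≤ Z ^ 5 := by
    refine (two_pow_numRounds_le hm hn (by omega)).trans ?_
    calc 8 * (m * n * (q * q)) ≤ Z * (Z * Z * (Z * Z)) := by gcongr
      _ = Z ^ 5 := by ring
  have hL : L ≤ Z ^ 5 := Nat.lt_two_pow_self.le.trans hN
  refine ⟨lt (k := 3) (by decide) ?_, lt (k := 7) (by decide) ?_, lt (k := 4) (by decide) ?_,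
    lt (k := 6) (by decide) ?_, lt (k := 10) (by decide) ?_, lt (k := 25) (by decide) ?_,
    lt (k := 13) (by decide) ?_, lt (k := 7) (by decide) ?_, lt (k := 3) (by decide) (by omega)⟩
  · calc 2 * (q * e) ≤ Z * (Z * Z) := by gcongr
      _ = Z ^ 3 := by ring
  · calc 2 * sampleSize q e ≤ Z * Z ^ 6 := by gcongr
      _ = Z ^ 7 := by ring
  · calc 2 * (8 * e * (m + n)) = 16 * e * (m + n) := by ring
      _ ≤ Z ^ 2 * Z * Z := by
        gcongr
        · omega
        · omega
      _ = Z ^ 4 := by ring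
  · have h1 : 1 ≤ m * n * (q * q) := Nat.mul_pos (Nat.mul_pos hm hn) (by positivity)
    calc 2 * (2 * m * n * q * q + 2) = 4 * (m * n * (q * q)) + 4 := by ring
      _ ≤ 64 * (m * n * (q * q)) := by omega
      _ ≤ Z ^ 2 * (Z * Z * (Z * Z)) := by gcongr
      _ = Z ^ 6 := by ring
  · calc groupEdges q e = 8 * e * e * q * sampleSize q e := rfl
      _ ≤ Z * Z * Z * Z * Z ^ 6 := by gcongr
      _ = Z ^ 10 := by ring
  · calc 2 ^ L * matchEdges e L = 2 ^ L * (128 * e * e * L * L * L) := rfl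
      _ ≤ Z ^ 5 * (Z ^ 3 * Z * Z * Z ^ 5 * Z ^ 5 * Z ^ 5) := by gcongr; omega
      _ = Z ^ 25 := by ring
  · calc (2 ^ L + 1) * (2 * sampleSize q e) ≤ (Z ^ 5 + Z ^ 5) * (Z * Z ^ 6) := by
          gcongr
          exact Nat.one_le_pow _ _ (by omega)
      _ = 2 * Z ^ 12 := by ring
      _ ≤ Z * Z ^ 12 := by gcongr
      _ = Z ^ 13 := by ring
  · have hd : d ≤ Z := by omega
    have h12 : 12 ≤ Z ^ 2 := by omega
    have h1 : Z ^ 4 ≤ Z ^ 6 := Nat.pow_le_pow_right (by omega) (by decide)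
    have h2 : Z ^ 2 ≤ Z ^ 6 := Nat.pow_le_pow_right (by omega) (by decide)
    calc m * n * (d₀ * d) + m * n * p₀ * d + 12 * p * (m * n) * d₀ + 12
        ≤ Z * Z * (Z * Z) + Z * Z * Z * Z + Z ^ 2 * Z * (Z * Z) * Z + Z ^ 2 := by gcongr
      _ = Z ^ 4 + Z ^ 4 + Z ^ 6 + Z ^ 2 := by ring
      _ ≤ 8 * Z ^ 6 := by omega
      _ ≤ Z * Z ^ 6 := by gcongr
      _ = Z ^ 7 := by ring

end Bounds

/-! ## The algorithm on games -/

section Games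

open Finset
open scoped BigOperators

variable {m n q : ℕ}

theorem inputConfig_arr_le (G : FreeGame (Fin m) (Fin n) (Fin q)) (ε₀ ε : ℚ) (τ : List Bool)
    (i : ℕ) : (inputConfig G ε₀ ε τ).arr 0 i ≤ 1 := by
  simp only [inputConfig]
  split_ifs <;> omega

/-- The memory holding the truth table of the game. -/
noncomputable def gameTable (G : FreeGame (Fin m) (Fin n) (Fin q)) : ℕ → ℕ :=
  (inputConfig G 0 0 []).arr 0

theorem inputConfig_arr_zero (G : FreeGame (Fin m) (Fin n) (Fin q)) (ε₀ ε : ℚ) (τ : List Bool) :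
    (inputConfig G ε₀ ε τ).arr 0 = gameTable G := rfl

theorem inputConfig_arr_of_ne (G : FreeGame (Fin m) (Fin n) (Fin q)) (ε₀ ε : ℚ) (τ : List Bool)
    {a : ℕ} (ha : a ≠ 0) (i : ℕ) : (inputConfig G ε₀ ε τ).arr a i = 0 := by
  simp [inputConfig, ha]

theorem gameTable_le (G : FreeGame (Fin m) (Fin n) (Fin q)) (i : ℕ) : gameTable G i ≤ 1 :=
  inputConfig_arr_le G 0 0 [] i

theorem eq_and_eq_of_mul_add_eq {k a b r s : ℕ} (hr : r < k) (hs : s < k)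
    (h : a * k + r = b * k + s) : a = b ∧ r = s := by
  have h1 := congrArg (· % k) h
  have h2 := congrArg (· / k) h
  simp only [Nat.mul_add_mod', Nat.mod_eq_of_lt hr, Nat.mod_eq_of_lt hs] at h1
  simp only [Nat.mul_comm _ k, Nat.mul_add_div (show 0 < k by omega), Nat.div_eq_of_lt hr,
    Nat.div_eq_of_lt hs] at h2
  exact ⟨by omega, h1⟩

/-- Addresses are mixed-radix numbers with digits in range, so the existential in `inputConfig` can
only be witnessed by the given edge and labels. -/
theorem tableAt_gameTable (G : FreeGame (Fin m) (Fin n) (Fin q)) (x : Fin m) (y : Fin n)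
    (σ τ : Fin q) : tableAt n q (gameTable G) x y σ τ =
      if (σ, τ) ∈ G.constraint x y then 1 else 0 := by
  simp only [tableAt, gameTable, inputConfig, true_and]
  congr 1
  refine propext ⟨?_, fun h => ⟨x, y, σ, τ, rfl, h⟩⟩
  rintro ⟨x', y', σ', τ', h, hmem⟩
  obtain ⟨h, hτ⟩ := eq_and_eq_of_mul_add_eq τ.2 τ'.2 h
  obtain ⟨h, hσ⟩ := eq_and_eq_of_mul_add_eq σ.2 σ'.2 h
  obtain ⟨hx, hy⟩ := eq_and_eq_of_mul_add_eq y.2 y'.2 h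
  rw [Fin.ext hx, Fin.ext hy, Fin.ext hσ, Fin.ext hτ]
  exact hmem

theorem val_eq_sum_tableAt (G : FreeGame (Fin m) (Fin n) (Fin q)) (f : Fin m → Fin q)
    (g : Fin n → Fin q) {F H : ℕ → ℕ} (hF : ∀ x : Fin m, F x = f x) (hH : ∀ y : Fin n, H y = g y) :
    G.val f g = (∑ x ∈ range m, ∑ y ∈ range n, tableAt n q (gameTable G) x y (F x) (H y) : ℕ) /
      (m * n) := by
  have h : ∑ x ∈ range m, ∑ y ∈ range n, tableAt n q (gameTable G) x y (F x) (H y) =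
      #{e : Fin m × Fin n | (f e.1, g e.2) ∈ G.constraint e.1 e.2} := by
    rw [card_filter, ← univ_product_univ, sum_product, sum_range]
    refine sum_congr rfl fun x _ => ?_
    rw [sum_range]
    refine sum_congr rfl fun y _ => ?_
    rw [hF, hH, tableAt_gameTable]
  rw [h, FreeGame.val, Fintype.card_fin, Fintype.card_fin]

theorem val_nonneg (G : FreeGame (Fin m) (Fin n) (Fin q)) (f : Fin m → Fin q)
    (g : Fin n → Fin q) : 0 ≤ G.val f g := by
  unfold FreeGame.val
  positivity

theorem val_le_one (G : FreeGame (Fin m) (Fin n) (Fin q)) (f : Fin m → Fin q)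
    (g : Fin n → Fin q) : G.val f g ≤ 1 := by
  unfold FreeGame.val
  refine div_le_one_of_le₀ ?_ (by positivity)
  refine le_trans (Nat.cast_le.mpr (card_le_univ _)) ?_
  simp

theorem exists_val_eq_value (G : FreeGame (Fin m) (Fin n) (Fin q)) (hq : 0 < q) :
    ∃ f g, G.val f g = G.value := by
  have : Nonempty (Fin q) := ⟨⟨0, hq⟩⟩
  obtain ⟨p, hp⟩ := exists_eq_ciSup_of_finite (f := fun p : (Fin m → Fin q) × (Fin n → Fin q) =>
    G.val p.1 p.2)
  exact ⟨p.1, p.2, hp⟩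

/-- The bits of the tape lead the algorithm to a poor labeling. -/
def BadTape (G : FreeGame (Fin m) (Fin n) (Fin q)) (e : ℕ) (τ : List Bool) : Prop :=
  1 < q ∧ 1 < e ∧ (outCount m n q e (gameTable G) (itemAt (bitLength m n e) m n τ) : ℝ) / (m * n) <
    G.value - 12 / e

theorem one_lt_invEps_iff {p d : ℕ} (hp : 0 < p) : 1 < invEps p d ↔ p ≤ d := by
  unfold invEps
  rw [Nat.lt_add_left_iff_pos, Nat.div_pos_iff]
  exact ⟨fun h => h.2, fun h => ⟨hp, h⟩⟩

/-- The comparison labeling is an optimal one, extended by `0` beyond the vertex sets. In the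
degenerate cases no tape is bad, hence the guarded form of `hT`. -/
theorem prob_badTape_le (G : FreeGame (Fin m) (Fin n) (Fin q)) (hm : 0 < m) (hn : 0 < n)
    {e T : ℕ} (hT : 1 < q → 1 < e →
      roundStart (sampleSize q e) (groupEdges q e) (numRounds m n q)
        (matchEdges e (numRounds m n q)) (numRounds m n q) * (2 * bitLength m n e) ≤ T) :
    prob (fun r : Fin T → Bool => BadTape G e (List.ofFn r)) ≤ (1 / 2) ^ (m * n * q * q + 1) := by
  by_cases h : 1 < q ∧ 1 < e
  · obtain ⟨f, g, hfg⟩ := exists_val_eq_value G (by omega)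
    set F : ℕ → ℕ := fun x => if h : x < m then f ⟨x, h⟩ else 0 with hF
    set H : ℕ → ℕ := fun y => if h : y < n then g ⟨y, h⟩ else 0 with hH
    have hFq : ∀ x, F x < q := fun x => by
      simp only [hF]
      split_ifs
      · exact (f _).2
      · omega
    have hHq : ∀ y, H y < q := fun y => by
      simp only [hH]
      split_ifs
      · exact (g _).2
      · omega
    have hv := val_eq_sum_tableAt G f g (F := F) (H := H) (fun x => by simp [hF])
      fun y => by simp [hH]
    refine le_trans (prob_mono fun r hr => ?_) (prob_outCount_lt_le (gameTable_le G) hm hn h.1 h.2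
      (hT h.1 h.2) hFq hHq)
    rw [← hv, hfg]
    exact hr.2.2
  · have : prob (fun r : Fin T → Bool => BadTape G e (List.ofFn r)) = 0 := by
      unfold prob
      exact expect_eq_zero fun r _ => if_neg fun hb => h ⟨hb.1, hb.2.1⟩
    rw [this]
    positivity

theorem cast_eq_toNat_div {x : ℚ} (hx : 0 ≤ x) : (x : ℝ) = x.num.toNat / x.den := by
  have h1 : ((x.num.toNat : ℤ) : ℝ) = x.num := by
    rw [Int.toNat_of_nonneg (Rat.num_nonneg.mpr hx)]
  rw [Int.cast_natCast] at h1
  rw [h1, Rat.cast_def]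

/-- The output arrays start at zero and therefore encode the constant labeling `0`. It is the only
labeling if `q = 1`, and good enough if `ε ≥ 1`, where the required value is not positive. -/
theorem solveProg_run_trivial {w : ℕ} {s : Config} (hw : 2 < 2 ^ w)
    (h : s.reg 2 < 2 ∨ s.reg 6 ≤ s.reg 5) :
    Run w solveProg s 5 fun s' => s'.reg 0 = 1 ∧ s'.arr = s.arr := by
  refine Run.le (T := 2 + (1 + 1 + 1)) (Run.seq (Q' := fun s' => s'.reg 83 = 2)
    ((Run.straight rfl ?_).le (by rfl)) fun s₁ hs₁ hf₁ => ?_) (by norm_num)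
  · simp [Prog.sem, Config.setReg, Nat.mod_eq_of_lt hw]
  · have ha : s₁.arr = s.arr := funext fun a => hf₁.arr a rfl
    have hfin : Run w (.const 0 1) s₁ 1 fun s' => s'.reg 0 = 1 ∧ s'.arr = s.arr :=
      ⟨1, _, Exec.const 0 1 s₁, le_rfl, by
        simp [Config.setReg, Nat.mod_eq_of_lt (show 1 < 2 ^ w by omega)], ha⟩
    refine Run.ifLt (fun _ => hfin.le (by norm_num)) fun h2 => Run.ifLt (fun hlt => ?_) fun _ => hfin
    rw [hs₁, hf₁.reg 2 rfl] at h2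
    rw [hf₁.reg 5 rfl, hf₁.reg 6 rfl] at hlt
    omega

/-- On every tape, the algorithm halts in time. It returns a good labeling or reports failure, the
latter only on bad tapes. -/
theorem solveProg_outcome (hm : 1 ≤ m) (hn : 1 ≤ n) (hq : 1 ≤ q) {ε₀ ε : ℚ} (hε : 0 < ε)
    (G : FreeGame (Fin m) (Fin n) (Fin q)) (hG : 1 - (ε₀ : ℝ) ≤ G.value) {w : ℕ}
    (hw : WordSizeOK 30 m n q ε₀ ε w) (τ : List Bool) :
    ∃ t s, Exec w solveProg (inputConfig G ε₀ ε τ) t s ∧ t ≤ timeBound timeConst 10000 5 m n q ε ∧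
      (ReportsFailure s ∧ BadTape G (invEps ε.num.toNat ε.den) τ ∨
        ReturnsLabeling G (1 - (ε₀ : ℝ) - (12 : ℕ) * (ε : ℝ)) s) := by
  set p := ε.num.toNat with hp
  set d := ε.den with hd
  set p₀ := ε₀.num.toNat with hp₀
  set d₀ := ε₀.den with hd₀
  obtain ⟨f, g, hfg⟩ := exists_val_eq_value G hq
  -- A value never exceeds `1`, so `ε₀` is nonnegative and storing its numerator as a natural number
  -- loses nothing.
  have hε₀ : 0 ≤ ε₀ := by
    have := val_le_one G f g
    have : (0 : ℝ) ≤ ε₀ := by linarith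
    exact_mod_cast this
  have eε : (ε : ℝ) = p / d := cast_eq_toNat_div hε.le
  have eε₀ : (ε₀ : ℝ) = p₀ / d₀ := cast_eq_toNat_div hε₀
  have hp0 : 0 < p := by
    have := Rat.num_pos.mpr hε
    omega
  have hd0 : 0 < d := ε.den_pos
  have hd₀0 : 0 < d₀ := ε₀.den_pos
  have hεr : (0 : ℝ) < ε := by exact_mod_cast hε
  have hε₀r : (0 : ℝ) ≤ ε₀ := by exact_mod_cast hε₀
  have hmn : (0 : ℝ) < m * n := by exact_mod_cast Nat.mul_pos hm hn
  have hdr : (0 : ℝ) < d := by exact_mod_cast hd0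
  have hd₀r : (0 : ℝ) < d₀ := by exact_mod_cast hd₀0
  by_cases hcase : 1 < q ∧ p < d
  · obtain ⟨hq1, hpd⟩ := hcase
    have he : 1 < invEps p d := (one_lt_invEps_iff hp0).mpr hpd.le
    obtain ⟨t, s, hex, ht, h0, h1, h2⟩ := solveProg_run (w := w) (m := m) (n := n) (q := q)
      (p₀ := p₀) (d₀ := d₀) (p := p) (d := d) (s := inputConfig G ε₀ ε τ) (τ := τ)
      rfl rfl rfl rfl rfl rfl rfl (inputConfig_arr_le G ε₀ ε τ)
      (fun a ha i => inputConfig_arr_of_ne G ε₀ ε τ ha i) rfl hm hn hq1 hd₀0 hpd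
      (fits_of_pow_le hm hn hq1 hd₀0 hp0 hpd hw)
    rw [inputConfig_arr_zero] at h0 h1 h2
    set e := invEps p d with hedef
    set ω := itemAt (bitLength m n e) m n τ
    refine ⟨t, s, hex, ht.trans (le_timeBound hm hn hp0 hpd.le hq1 eε (solveTime_le hm hn hq1 he)), ?_⟩
    set c := outCount m n q e (gameTable G) ω with hc
    have key : (c * (d₀ * d) + m * n * p₀ * d + 12 * p * (m * n) * d₀ < m * n * (d₀ * d)) ↔
        (c : ℝ) / (m * n) < 1 - ε₀ - (12 : ℕ) * ε := by
      rw [← Nat.cast_lt (α := ℝ), eε, eε₀, div_lt_iff₀ hmn]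
      push_cast
      have e1 : (1 - (p₀ : ℝ) / d₀ - 12 * (p / d)) * (m * n) =
          (m * n * (d₀ * d) - m * n * p₀ * d - 12 * p * (m * n) * d₀) / (d₀ * d) := by
        field_simp
      rw [e1, lt_div_iff₀ (by positivity)]
      constructor <;> intro h <;> linarith
    have he0 : (0 : ℝ) < e := by exact_mod_cast (by omega : 0 < e)
    have hεe : 12 / (e : ℝ) ≤ 12 * ε := by
      rw [div_le_iff₀ he0, eε]
      have h1 : d < p * e := Nat.lt_mul_div_succ d hp0
      have h2 : (d : ℝ) ≤ p * e := by exact_mod_cast h1.le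
      have h3 : 1 ≤ (p : ℝ) * e / d := by rwa [le_div_iff₀ hdr, one_mul]
      have e2 : 12 * ((p : ℝ) / d) * e = 12 * (p * e / d) := by ring
      linarith
    by_cases hlt : (c : ℝ) / (m * n) < 1 - ε₀ - (12 : ℕ) * ε
    -- A failed check means a value below `1 - ε₀ - 12 ε`, which is at most `G.value - 12 / e`. The
    -- latter bound no longer involves `ε₀`.
    · rw [if_pos (key.mpr hlt)] at h0
      refine Or.inl ⟨h0, hq1, he, ?_⟩
      push_cast at hlt
      linarith
    · rw [if_neg (mt key.mp hlt)] at h0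
      refine Or.inr ⟨by simp [ReportsFailure, h0], fun x => ⟨outX m n q e (gameTable G) ω x,
        bestX_lt hq _ _ _⟩, fun y => ⟨outY m n q e (gameTable G) ω y, respY_lt hq _ _ _ _⟩,
        fun x => h1 x x.2, fun y => h2 y y.2, ?_⟩
      rw [val_eq_sum_tableAt G _ _ (F := outX m n q e (gameTable G) ω)
        (H := outY m n q e (gameTable G) ω) (fun _ => rfl) fun _ => rfl]
      exact not_lt.mp hlt
  · have hw2 : 2 < 2 ^ w := by
      refine lt_of_lt_of_le ?_ hw
      have h3 : 3 ≤ m + n + q + p₀ + d₀ + p + d := by omega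
      have h4 := Nat.pow_le_pow_left h3 30
      exact lt_of_lt_of_le (by norm_num) h4
    have hc : q = 1 ∨ d ≤ p := by omega
    obtain ⟨t, s, hex, ht, h0, h1⟩ := solveProg_run_trivial (w := w) (s := inputConfig G ε₀ ε τ) hw2
      (hc.imp (fun h => by
        show q < 2
        omega) fun h => h)
    have hε1 : d ≤ p → 1 ≤ (ε : ℝ) := fun h => by
      rw [eε, le_div_iff₀ hdr, one_mul]
      exact_mod_cast h
    refine ⟨t, s, hex, ht.trans (five_le_timeBound hm hn hq (hc.imp id hε1)), Or.inr
      ⟨by simp [ReportsFailure, h0], fun _ => ⟨0, hq⟩, fun _ => ⟨0, hq⟩,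
        fun x => by rw [h1, inputConfig_arr_of_ne _ _ _ _ (by decide)],
        fun y => by rw [h1, inputConfig_arr_of_ne _ _ _ _ (by decide)], ?_⟩⟩
    push_cast
    rcases hc with rfl | h
    · have hf : f = fun _ => ⟨0, hq⟩ := funext fun x => Subsingleton.elim _ _
      have hg : g = fun _ => ⟨0, hq⟩ := funext fun x => Subsingleton.elim _ _
      rw [hf, hg] at hfg
      rw [hfg]
      linarith
    · have := val_nonneg G (fun _ => ⟨0, hq⟩) fun _ => ⟨0, hq⟩
      have := hε1 h
      linarith

theorem prob_badTape_timeBound_le (hm : 1 ≤ m) (hn : 1 ≤ n) {ε : ℚ} (hε : 0 < ε)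
    (G : FreeGame (Fin m) (Fin n) (Fin q)) :
    prob (fun r : Fin (timeBound timeConst 10000 5 m n q ε) → Bool =>
      BadTape G (invEps ε.num.toNat ε.den) (List.ofFn r)) ≤ (1 / 2) ^ (m * n * q * q + 1) := by
  have hp : 0 < ε.num.toNat := by
    have := Rat.num_pos.mpr hε
    omega
  refine prob_badTape_le G hm hn fun hq he => ?_
  exact le_timeBound hm hn hp ((one_lt_invEps_iff hp).mp he) hq (cast_eq_toNat_div hε.le)
    (numBits_le hm hn hq he)

open Classical in
theorem prob_eq_card_div {T : ℕ} (p : (Fin T → Bool) → Prop) :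
    prob p = #{r | p r} / 2 ^ T := by
  unfold prob
  rw [Fintype.expect_eq_sum_div_card, sum_boole]
  simp

end Games

/-- Part 1: a uniform Las Vegas algorithm. Part 2: a deterministic non-uniform algorithm, whose
advice depends on the sizes and on `ε`, but neither on the game nor on `ε₀`. -/
theorem theorem1p3 :
    (∃ (P : Prog) (K A B C D : ℕ) (c : ℝ), 0 < c ∧
      ∀ (m n q : ℕ), 1 ≤ m → 1 ≤ n → 1 ≤ q →
      ∀ (ε₀ ε : ℚ), 0 < ε →
      ∀ G : FreeGame (Fin m) (Fin n) (Fin q), 1 - (ε₀ : ℝ) ≤ G.value →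
      ∀ w : ℕ, WordSizeOK K m n q ε₀ ε w →
        LasVegasOn P w G ε₀ ε (1 - (ε₀ : ℝ) - C * (ε : ℝ)) (timeBound A B D m n q ε)
          ((2 : ℝ) ^ (-(c * ((m : ℝ) * q))))) ∧
    (∃ (P : Prog) (K A B C D : ℕ),
      ∀ (m n q : ℕ), 1 ≤ m → 1 ≤ n → 1 ≤ q →
      ∀ ε : ℚ, 0 < ε →
      ∃ a : List Bool, a.length ≤ timeBound A B D m n q ε ∧
        ∀ ε₀ : ℚ, ∀ G : FreeGame (Fin m) (Fin n) (Fin q), 1 - (ε₀ : ℝ) ≤ G.value →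
        ∀ w : ℕ, WordSizeOK K m n q ε₀ ε w →
          SolvesWithAdvice P w G ε₀ ε a (1 - (ε₀ : ℝ) - C * (ε : ℝ))
            (timeBound A B D m n q ε)) := by
  refine ⟨⟨solveProg, 30, timeConst, 10000, 12, 5, 1, one_pos, ?_⟩,
    solveProg, 30, timeConst, 10000, 12, 5, ?_⟩
  · intro m n q hm hn hq ε₀ ε hε G hG w hw
    refine ⟨fun r => ?_, ?_⟩
    · obtain ⟨t, s, hex, ht, h⟩ := solveProg_outcome hm hn hq hε G hG hw (List.ofFn r)
      exact ⟨t, s, hex, ht, h.imp And.left id⟩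
    · rw [← prob_eq_card_div]
      refine (prob_mono fun r hr => ?_).trans ((prob_badTape_timeBound_le hm hn hε G).trans ?_)
      · obtain ⟨t, s, hex, -, h⟩ := solveProg_outcome hm hn hq hε G hG hw (List.ofFn r)
        obtain ⟨t', s', hex', hf⟩ := hr
        obtain ⟨-, rfl⟩ := hex.deterministic hex'
        rcases h with h | h
        · exact h.2
        · exact absurd hf h.1
      · rw [one_div, inv_pow, ← Real.rpow_natCast, ← Real.rpow_neg (by norm_num), one_mul]
        refine Real.rpow_le_rpow_of_exponent_le (by norm_num) (neg_le_neg ?_)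
        have h1 : m * q ≤ m * q * (n * q) := Nat.le_mul_of_pos_right _ (Nat.mul_pos hn hq)
        have h2 : m * n * q * q = m * q * (n * q) := by ring
        exact_mod_cast (by omega : m * q ≤ m * n * q * q + 1)
  · intro m n q hm hn hq ε hε
    -- The probabilistic method: `2 ^ (m n q²)` games, each spoiled by at most a fraction `2 ^ -(m n
    -- q² + 1)` of the tapes, leave at least half of all tapes good for every game.
    have hex : ∃ r : Fin (timeBound timeConst 10000 5 m n q ε) → Bool,
        ∀ c : Fin m → Fin n → Finset (Fin q × Fin q),
          ¬ BadTape ⟨c⟩ (invEps ε.num.toNat ε.den) (List.ofFn r) := by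
      by_contra! hcon
      have h1 := prob_exists_le (Finset.univ : Finset (Fin m → Fin n → Finset (Fin q × Fin q)))
        fun c (r : Fin (timeBound timeConst 10000 5 m n q ε) → Bool) =>
          BadTape ⟨c⟩ (invEps ε.num.toNat ε.den) (List.ofFn r)
      have h2 := h1.trans (Finset.sum_le_card_nsmul _ _ _ fun c _ =>
        prob_badTape_timeBound_le hm hn hε ⟨c⟩)
      have h3 : (1 : ℝ) ≤ prob fun r : Fin (timeBound timeConst 10000 5 m n q ε) → Bool =>
          ∃ c ∈ (Finset.univ : Finset (Fin m → Fin n → Finset (Fin q × Fin q))),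
            BadTape ⟨c⟩ (invEps ε.num.toNat ε.den) (List.ofFn r) := by
        refine le_trans (le_of_eq ?_) (prob_mono (p := fun _ => True) fun r _ => ?_)
        · simp [prob]
        · obtain ⟨c, hc⟩ := hcon r
          exact ⟨c, Finset.mem_univ c, hc⟩
      have h4 : Fintype.card (Fin m → Fin n → Finset (Fin q × Fin q)) = 2 ^ (m * n * q * q) := by
        simp only [Fintype.card_fun, Fintype.card_finset, Fintype.card_prod, Fintype.card_fin,
          ← pow_mul]
        congr 1
        ring
      rw [Finset.card_univ, h4, nsmul_eq_mul, pow_succ, ← mul_assoc] at h2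
      push_cast at h2
      rw [← mul_pow, mul_one_div_cancel two_ne_zero, one_pow] at h2
      linarith
    obtain ⟨r, hr⟩ := hex
    refine ⟨List.ofFn r, by simp, fun ε₀ G hG w hw => ?_⟩
    obtain ⟨t, s, hex, ht, h⟩ := solveProg_outcome hm hn hq hε G hG hw (List.ofFn r)
    refine ⟨t, s, hex, ht, h.resolve_left fun hf => hr G.constraint hf.2⟩
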